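/- **Definitions.** All manifolds are smooth, Hausdorff, second countable and without boundary, $n\ge 0$, and $\tilde\nabla$ and $\det$ denote the flat connection and the standard volume form of $\mathbb R^{n+1}$. A hypersurface immersion $\varphi:M\to\mathbb R^{n+1}$ of an $n$-manifold is *centroaffine* if $\varphi(p)\notin d\varphi(T_pM)$ for all $p\in M$; its *induced data* $(\nabla,g,\nu)$ are the connection $\nabla$, the tensor field $g$ and the $n$-form $\nu$ on $M$ given by $$\tilde\nabla_X\,d\varphi Y=d\varphi(\nabla_XY)+g(X,Y)\,\varphi,\qquad \nu=\det(\varphi,d\varphi\,\cdot,\dots,d\varphi\,\cdot).$$ A *centroaffine manifold* $(M,\nabla,g,\nu)$ is a manifold with a torsion-free connection $\nabla$, a pseudo-Riemannian metric $g$ and a (nowhere vanishing) volume form $\nu$ such that $\nabla\nu=0$, $R(X,Y)Z=-(g(Y,Z)X-g(X,Z)Y)$, and the cubic form $C:=\nabla g$ is completely symmetric. It is an *intrinsic projective special real manifold* if moreover $g$ is positive definite and $$(\nabla_XC)(Y,Z,W)=g(X,Y)g(Z,W)+g(X,Z)g(W,Y)+g(X,W)g(Y,Z)\qquad(X,Y,Z,W\in\mathfrak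 X(M)).$$ A *projective special real manifold* is a smooth embedded hypersurface $\mathcal H\subset\mathbb R^{n+1}$ for which there is a homogeneous cubic polynomial $h$ on $\mathbb R^{n+1}$ with $\mathcal H\subset\{h=1\}$ and with Hessian $\tilde\nabla^2h$ negative definite on $T\mathcal H$. **Theorem.** (i) Let $\mathcal H\subset\mathbb R^{n+1}$ be a projective special real manifold. Then its inclusion into $\mathbb R^{n+1}$ is a centroaffine immersion, so that it induces data $(\nabla,g,\nu)$ on $\mathcal H$, and $(\mathcal H,\nabla,g,\nu)$ is an intrinsic projective special real manifold. (ii) Conversely, let $(M,\nabla,g,\nu)$ be a connected and simply connected intrinsic projective special real manifold of dimension $n$. Then there exists an immersion $\varphi:M\to\mathbb R^{n+1}$ such that $\mathcal H:=\varphi(M)\subset\mathbb R^{n+1}$ is a projective special real manifold whose induced centroaffine structure has $\varphi$-pullback $(\nabla,g,\nu)$. The immersion $\varphi$ is unique up to linear unimodular transformations: a map $\psi:M\to\mathbb R^{n+1}$ is another such immersion if and only if $\psi=A\circ\varphi$ for a linear map $A$ of $\mathbb R^{n+1}$ with $\det A=1$. -/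

import Mathlib

open scoped Manifold ContDiff Bundle

noncomputable section

namespace Centroaffine

/-- The ambient space `ℝ^(n+1)`. -/
abbrev Ambient (n : ℕ) : Type := EuclideanSpace ℝ (Fin (n + 1))

/-- The determinant of `n + 1` vectors of `ℝ^(n+1)` (standard parallel volume form). -/
def ambientDet {n : ℕ} (v : Fin (n + 1) → Ambient n) : ℝ :=
  (EuclideanSpace.basisFun (Fin (n + 1)) ℝ).toBasis.det v

section Intrinsic

variable (n : ℕ) (M : Type*) [TopologicalSpace M] [ChartedSpace (EuclideanSpace ℝ (Fin n)) M]

/-- (Not necessarily smooth) vector fields on an `n`-dimensional manifold `M`. -/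
abbrev VField := ∀ p : M, TangentSpace (𝓡 n) p

variable {n M}

/-- Membership in `𝔛(M)`: smooth vector fields. -/
def IsSmoothField [IsManifold (𝓡 n) ∞ M] (X : VField n M) : Prop :=
  ContMDiff (𝓡 n) (𝓡 n).tangent ∞ (T% X)

variable (n M) in
/-- A triple `(∇, g, ν)` of a smooth connection on `TM`, a smooth field of bilinear forms and a
smooth `n`-form on `M`, with no compatibility required. -/
structure Data [IsManifold (𝓡 n) ∞ M] where
  /-- The connection `∇`; the argument order is `cov Y p v = (∇_v Y)(p)`. -/
  cov : CovariantDerivative (𝓡 n) (EuclideanSpace ℝ (Fin n))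
    (fun p : M ↦ TangentSpace (𝓡 n) p)
  /-- The tensor field `g`. -/
  g : ∀ p : M, LinearMap.BilinForm ℝ (TangentSpace (𝓡 n) p)
  /-- The `n`-form `ν`. -/
  vol : ∀ p : M, (TangentSpace (𝓡 n) p) [⋀^Fin n]→ₗ[ℝ] ℝ
  smooth_cov : CovariantDerivative.ContMDiffCovariantDerivative cov ∞
  smooth_g : ∀ X Y : VField n M, IsSmoothField X → IsSmoothField Y →
    ContMDiff (𝓡 n) 𝓘(ℝ, ℝ) ∞ (fun p ↦ g p (X p) (Y p))
  smooth_vol : ∀ Y : Fin n → VField n M, (∀ i, IsSmoothField (Y i)) →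
    ContMDiff (𝓡 n) 𝓘(ℝ, ℝ) ∞ (fun p ↦ vol p (fun i ↦ Y i p))

namespace Data

variable [IsManifold (𝓡 n) ∞ M] (D : Data n M)

/-- `∇_X Y`. -/
def nabla (X Y : VField n M) : VField n M := fun p ↦ D.cov Y p (X p)

/-- The function `g(X, Y)`. -/
def gFun (X Y : VField n M) : M → ℝ := fun p ↦ D.g p (X p) (Y p)

/-- The curvature `R(X,Y)Z = ∇_X ∇_Y Z - ∇_Y ∇_X Z - ∇_[X,Y] Z`. -/
def curvature (X Y Z : VField n M) : VField n M := fun p ↦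
  D.nabla X (D.nabla Y Z) p - D.nabla Y (D.nabla X Z) p
    - D.nabla (VectorField.mlieBracket (𝓡 n) X Y) Z p

/-- `C(X,Y,Z) = (∇_X g)(Y,Z) = X g(Y,Z) - g(∇_X Y, Z) - g(Y, ∇_X Z)`. -/
def cubic (X Y Z : VField n M) : M → ℝ := fun p ↦
  mvfderiv (𝓡 n) (D.gFun Y Z) p (X p) - D.gFun (D.nabla X Y) Z p - D.gFun Y (D.nabla X Z) p

/-- `(∇_X C)(Y,Z,W)`, the covariant derivative of `C = ∇g`. -/
def nablaCubic (X Y Z W : VField n M) : M → ℝ := fun p ↦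
  mvfderiv (𝓡 n) (D.cubic Y Z W) p (X p) - D.cubic (D.nabla X Y) Z W p
    - D.cubic Y (D.nabla X Z) W p - D.cubic Y Z (D.nabla X W) p

/-- `(∇_X ν)(Y_1, …, Y_n) = X ν(Y_1, …, Y_n) - ∑ i, ν(Y_1, …, ∇_X Y_i, …, Y_n)`. -/
def nablaVol (X : VField n M) (Y : Fin n → VField n M) : M → ℝ := fun p ↦
  mvfderiv (𝓡 n) (fun q ↦ D.vol q (fun i ↦ Y i q)) p (X p)
    - ∑ i, D.vol p (Function.update (fun j ↦ Y j p) i (D.nabla X (Y i) p))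

/-- `(∇, g, ν)` is a centroaffine structure on `M`. -/
structure IsCentroaffine : Prop where
  torsionFree : D.cov.torsion = 0
  g_symm : ∀ p v w, D.g p v w = D.g p w v
  g_nondegenerate : ∀ p v, (∀ w, D.g p v w = 0) → v = 0
  vol_ne_zero : ∀ p, D.vol p ≠ 0
  vol_parallel : ∀ (X : VField n M) (Y : Fin n → VField n M), IsSmoothField X →
    (∀ i, IsSmoothField (Y i)) → ∀ p, D.nablaVol X Y p = 0
  curvature_eq : ∀ X Y Z : VField n M, IsSmoothField X → IsSmoothField Y → IsSmoothField Z →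
    ∀ p, D.curvature X Y Z p = -(D.g p (Y p) (Z p) • X p - D.g p (X p) (Z p) • Y p)
  cubic_symm : ∀ X Y Z : VField n M, IsSmoothField X → IsSmoothField Y → IsSmoothField Z →
    ∀ p, D.cubic X Y Z p = D.cubic Y X Z p ∧ D.cubic X Y Z p = D.cubic X Z Y p

/-- `(M, ∇, g, ν)` is an intrinsic projective special real manifold. -/
structure IsIntrinsicPSR : Prop where
  centroaffine : D.IsCentroaffine
  g_pos : ∀ p v, v ≠ 0 → 0 < D.g p v v
  nablaCubic_eq : ∀ X Y Z W : VField n M, IsSmoothField X → IsSmoothField Y →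
    IsSmoothField Z → IsSmoothField W → ∀ p,
      D.nablaCubic X Y Z W p = D.gFun X Y p * D.gFun Z W p + D.gFun X Z p * D.gFun W Y p
        + D.gFun X W p * D.gFun Y Z p

/-- `(∇, g, ν) = f^* (∇', g', ν')` for a smooth local diffeomorphism `f : M → N` of manifolds of
the same dimension. The condition on the connections is that `df (∇_v X) = ∇'_(df v) Y` whenever
`X` is the pullback `f^* Y` of `Y`, that is, whenever `df ∘ X = Y ∘ f`. -/
structure IsPullback {N : Type*} [TopologicalSpace N] [ChartedSpace (EuclideanSpace ℝ (Fin n)) N]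
    [IsManifold (𝓡 n) ∞ N] (f : M → N) (D' : Data n N) : Prop where
  smooth : ContMDiff (𝓡 n) (𝓡 n) ∞ f
  bijective : ∀ p, Function.Bijective (mfderiv (𝓡 n) (𝓡 n) f p)
  cov_eq : ∀ (X : VField n M) (Y : VField n N), IsSmoothField X → IsSmoothField Y →
    (∀ p, mfderiv (𝓡 n) (𝓡 n) f p (X p) = Y (f p)) →
    ∀ p (v : TangentSpace (𝓡 n) p),
      mfderiv (𝓡 n) (𝓡 n) f p (D.cov X p v) = D'.cov Y (f p) (mfderiv (𝓡 n) (𝓡 n) f p v)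
  g_eq : ∀ p v w, D.g p v w =
    D'.g (f p) (mfderiv (𝓡 n) (𝓡 n) f p v) (mfderiv (𝓡 n) (𝓡 n) f p w)
  vol_eq : ∀ p (v : Fin n → TangentSpace (𝓡 n) p), D.vol p v =
    D'.vol (f p) (fun i ↦ mfderiv (𝓡 n) (𝓡 n) f p (v i))

end Data

end Intrinsic

section Extrinsic

variable {n : ℕ} {M : Type*} [TopologicalSpace M] [ChartedSpace (EuclideanSpace ℝ (Fin n)) M]

/-- Smooth hypersurface immersions `φ : M → ℝ^(n+1)`, where `dim M = n`. -/
def IsHypersurfaceImmersion (φ : M → Ambient n) : Prop :=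
  ContMDiff (𝓡 n) 𝓘(ℝ, Ambient n) ∞ φ ∧ ∀ p, Function.Injective (mvfderiv (𝓡 n) φ p)

/-- Centroaffine hypersurface immersions: the position vector is transversal. -/
def IsCentroaffineImmersion (φ : M → Ambient n) : Prop :=
  IsHypersurfaceImmersion φ ∧ ∀ p, φ p ∉ Set.range (mvfderiv (𝓡 n) φ p)

/-- `(∇, g, ν)` is the centroaffine data induced by the centroaffine immersion `φ`: the Gauss
equation `D_X (dφ Y) = dφ (∇_X Y) + g(X,Y) φ` holds, with `D` the flat connection of `ℝ^(n+1)`,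
and `ν = det(φ, dφ ·, …, dφ ·)`. -/
structure Data.IsInducedBy [IsManifold (𝓡 n) ∞ M] (D : Data n M) (φ : M → Ambient n) : Prop where
  immersion : IsCentroaffineImmersion φ
  gauss : ∀ X Y : VField n M, IsSmoothField X → IsSmoothField Y → ∀ p,
    mvfderiv (𝓡 n) (fun q ↦ mvfderiv (𝓡 n) φ q (Y q)) p (X p) =
      mvfderiv (𝓡 n) φ p (D.nabla X Y p) + D.g p (X p) (Y p) • φ p
  vol_eq : ∀ p (v : Fin n → TangentSpace (𝓡 n) p), D.vol p v =
    ambientDet (Fin.cons (φ p) (fun i ↦ mvfderiv (𝓡 n) φ p (v i)))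

/-- Smooth (embedded) hypersurfaces of `ℝ^(n+1)`: a subset, with the subspace topology and a
smooth structure for which the inclusion is an immersion. -/
structure Hypersurface (n : ℕ) where
  /-- The underlying set of points. -/
  carrier : Set (Ambient n)
  /-- The atlas. -/
  chartedSpace : ChartedSpace (EuclideanSpace ℝ (Fin n)) carrier
  isManifold : IsManifold (𝓡 n) ∞ carrier
  immersion : IsHypersurfaceImmersion (n := n) (Subtype.val : carrier → Ambient n)

attribute [instance] Hypersurface.chartedSpace Hypersurface.isManifold

/-- The inclusion `ι : ℋ → ℝ^(n+1)`. -/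
def Hypersurface.incl (S : Hypersurface n) : S.carrier → Ambient n := Subtype.val

/-- The polynomial function on `ℝ^(n+1)` given by a polynomial in `n + 1` variables. -/
def polyFun (h : MvPolynomial (Fin (n + 1)) ℝ) : Ambient n → ℝ :=
  fun x ↦ MvPolynomial.eval (fun i ↦ x i) h

/-- `ℋ` is a projective special real manifold: it lies in `{h = 1}` for some homogeneous cubic
polynomial `h` whose Hessian is negative definite on `Tℋ`. -/
def Hypersurface.IsProjectiveSpecialReal (S : Hypersurface n) : Prop :=
  ∃ h : MvPolynomial (Fin (n + 1)) ℝ, h.IsHomogeneous 3 ∧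
    (∀ x ∈ S.carrier, polyFun h x = 1) ∧
    ∀ (p : S.carrier) (v : Ambient n), v ∈ Set.range (mvfderiv (𝓡 n) S.incl p) → v ≠ 0 →
      fderiv ℝ (fderiv ℝ (polyFun h)) (p : Ambient n) v v < 0

/-- `φ : M → ℝ^(n+1)` is an immersion whose image `φ(M)` is a projective special real manifold
with induced centroaffine structure whose pullback under `φ : M → φ(M)` is the given one. -/
def Data.IsRealizedBy [IsManifold (𝓡 n) ∞ M] (D : Data n M) (φ : M → Ambient n) : Prop :=
  IsHypersurfaceImmersion φ ∧
    ∃ S : Hypersurface n, S.carrier = Set.range φ ∧ S.IsProjectiveSpecialReal ∧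
      ∃ D' : Data n S.carrier, D'.IsInducedBy S.incl ∧
        ∃ f : M → S.carrier, (∀ p, S.incl (f p) = φ p) ∧ D.IsPullback f D'

end Extrinsic

end Centroaffine

end

/-! Attach to the cubic `h` the symmetric trilinear form `T` with `T x x x = 6 h(x)`, so that the
Hessian of `h` at `x` is the bilinear form `T x`.

Part (i) comes from differentiating `T(φ,φ,φ) = 6` repeatedly along the hypersurface. The first
derivative `T(φ,φ,dφ v) = 0`, with negativity of the Hessian, gives transversality. Combined with
the Gauss equation, the next ones give `g = -T(φ,dφ,dφ)/3`, then `C = -T(dφ,dφ,dφ)/3`, then the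
formula for `∇C`. Torsion and curvature are read off from flatness of the ambient space, and `ν` is
parallel because the determinant is (`IsCubicPotential.isIntrinsicPSR`).

For part (ii), the centroaffine axioms make the connection on `ℝ ⊕ TM` with form `θ_v (f, w) =
(g(v,w), f v + ∇_v w)` flat. Integrating `dP = P θ` (`exists_flat_frame`) gives local solutions `φ =
P (1, 0)` of the Gauss equation. Two of them differ by a constant linear map
(`exists_linearMap_of_gaussAt`). The transition maps thus form a locally constant cocycle, trivial
on a simply connected manifold, and the local solutions glue (`exists_global_solution`). Both `ν`
and the induced volume form are parallel, so a linear map matches them (`exists_vol_eq_smul`).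

The cubic is recovered by splitting constant vectors as `a = f_a φ + dφ Y_a`. The function `6 f_a
f_b f_c - 3 (f_a g(Y_b,Y_c) + f_b g(Y_a,Y_c) + f_c g(Y_a,Y_b)) - 3 C(Y_a,Y_b,Y_c)` has zero
derivative, by the equation for `∇C` (`mvfderiv_polarForm`). Its constant value is the required `T a
b c`.

The solution `φ` need not be injective, yet its image is embedded: `(t, p) ↦ t φ(p)` is a local
diffeomorphism for `t ≠ 0`, and by homogeneity `T = 6` on the image forces `t = 1`
(`IsCubicPotential.exists_sliceChart`). Finally `isRealizedBy_iff` identifies realisations with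
normalised solutions of the structure equations. These are stable under unimodular maps, and any two
are related by a linear map whose determinant is fixed by the volume form. -/

open scoped Manifold ContDiff Bundle

noncomputable section

namespace Centroaffine

open Set Filter Topology

/-! ### Differential calculus of vector-valued functions on a manifold. -/

section Calculus

variable {n : ℕ} {M : Type*} [TopologicalSpace M] [ChartedSpace (EuclideanSpace ℝ (Fin n)) M]
  {W W₁ W₂ W₃ : Type*} [NormedAddCommGroup W] [NormedSpace ℝ W] [NormedAddCommGroup W₁]
  [NormedSpace ℝ W₁] [NormedAddCommGroup W₂] [NormedSpace ℝ W₂] [NormedAddCommGroup W₃]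
  [NormedSpace ℝ W₃]

/-- Smooth vector-valued functions near a point are differentiable there. -/
lemma mdiffAt_of_smooth {F : M → W} {p : M} (hF : ContMDiffAt (𝓡 n) 𝓘(ℝ, W) ∞ F p) :
    MDifferentiableAt (𝓡 n) 𝓘(ℝ, W) F p :=
  hF.mdifferentiableAt (by simp)

lemma mvfderiv_eq_mfderiv (F : M → W) (p : M) (v : TangentSpace (𝓡 n) p) :
    mvfderiv (𝓡 n) F p v = (mfderiv (𝓡 n) 𝓘(ℝ, W) F p v : W) := rfl

lemma mvfderiv_congr {F G : M → W} {p : M} (h : F =ᶠ[𝓝 p] G) :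
    mvfderiv (𝓡 n) F p = mvfderiv (𝓡 n) G p := by
  ext v
  rw [mvfderiv_eq_mfderiv, mvfderiv_eq_mfderiv, h.mfderiv_eq]
  rfl

/-- Chain rule for a map between normed spaces after a map on a manifold. -/
lemma mvfderiv_comp_left {Φ : W₁ → W₂} {F : M → W₁} {p : M} (hΦ : DifferentiableAt ℝ Φ (F p))
    (hF : MDifferentiableAt (𝓡 n) 𝓘(ℝ, W₁) F p) (v : TangentSpace (𝓡 n) p) :
    mvfderiv (𝓡 n) (fun q ↦ Φ (F q)) p v = fderiv ℝ Φ (F p) (mvfderiv (𝓡 n) F p v) := by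
  have h := mfderiv_comp p hΦ.mdifferentiableAt hF
  rw [mfderiv_eq_fderiv] at h
  exact congrArg (fun L : TangentSpace (𝓡 n) p →L[ℝ] W₂ ↦ L v) h

lemma mvfderiv_clm_comp (L : W₁ →L[ℝ] W₂) {F : M → W₁} {p : M}
    (hF : MDifferentiableAt (𝓡 n) 𝓘(ℝ, W₁) F p) (v : TangentSpace (𝓡 n) p) :
    mvfderiv (𝓡 n) (fun q ↦ L (F q)) p v = L (mvfderiv (𝓡 n) F p v) := by
  rw [mvfderiv_comp_left L.differentiableAt hF, L.fderiv]

lemma mvfderiv_prodMk {F : M → W₁} {G : M → W₂} {p : M}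
    (hF : MDifferentiableAt (𝓡 n) 𝓘(ℝ, W₁) F p) (hG : MDifferentiableAt (𝓡 n) 𝓘(ℝ, W₂) G p)
    (v : TangentSpace (𝓡 n) p) :
    mvfderiv (𝓡 n) (fun q ↦ (F q, G q)) p v = (mvfderiv (𝓡 n) F p v, mvfderiv (𝓡 n) G p v) := by
  have hFG := hF.prodMk_space hG
  exact Prod.ext
    (mvfderiv_clm_comp (ContinuousLinearMap.fst ℝ W₁ W₂) (F := fun q ↦ (F q, G q)) hFG v).symm
    (mvfderiv_clm_comp (ContinuousLinearMap.snd ℝ W₁ W₂) (F := fun q ↦ (F q, G q)) hFG v).symm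

lemma mdiffAt_bilin (b : W₁ →L[ℝ] W₂ →L[ℝ] W₃) {F : M → W₁} {G : M → W₂} {p : M}
    (hF : MDifferentiableAt (𝓡 n) 𝓘(ℝ, W₁) F p) (hG : MDifferentiableAt (𝓡 n) 𝓘(ℝ, W₂) G p) :
    MDifferentiableAt (𝓡 n) 𝓘(ℝ, W₃) (fun q ↦ b (F q) (G q)) p :=
  (b.isBoundedBilinearMap.differentiableAt (F p, G p)).comp_mdifferentiableAt
    (I := 𝓡 n) (f := fun q ↦ (F q, G q)) (hF.prodMk_space hG)

/-- Product rule for a continuous bilinear map. -/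
lemma mvfderiv_bilin (b : W₁ →L[ℝ] W₂ →L[ℝ] W₃) {F : M → W₁} {G : M → W₂} {p : M}
    (hF : MDifferentiableAt (𝓡 n) 𝓘(ℝ, W₁) F p) (hG : MDifferentiableAt (𝓡 n) 𝓘(ℝ, W₂) G p)
    (v : TangentSpace (𝓡 n) p) :
    mvfderiv (𝓡 n) (fun q ↦ b (F q) (G q)) p v =
      b (mvfderiv (𝓡 n) F p v) (G p) + b (F p) (mvfderiv (𝓡 n) G p v) := by
  have h := mvfderiv_comp_left (Φ := fun z : W₁ × W₂ ↦ b z.1 z.2) (F := fun q ↦ (F q, G q))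
    (b.isBoundedBilinearMap.differentiableAt (F p, G p)) (hF.prodMk_space hG) v
  rw [mvfderiv_prodMk hF hG, b.isBoundedBilinearMap.fderiv] at h
  rw [h, add_comm]
  rfl

lemma mdiffAt_smul {f : M → ℝ} {F : M → W} {p : M}
    (hf : MDifferentiableAt (𝓡 n) 𝓘(ℝ, ℝ) f p) (hF : MDifferentiableAt (𝓡 n) 𝓘(ℝ, W) F p) :
    MDifferentiableAt (𝓡 n) 𝓘(ℝ, W) (fun q ↦ f q • F q) p :=
  mdiffAt_bilin (ContinuousLinearMap.lsmul ℝ ℝ) hf hF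

lemma mvfderiv_smul_apply {f : M → ℝ} {F : M → W} {p : M}
    (hf : MDifferentiableAt (𝓡 n) 𝓘(ℝ, ℝ) f p) (hF : MDifferentiableAt (𝓡 n) 𝓘(ℝ, W) F p)
    (v : TangentSpace (𝓡 n) p) :
    mvfderiv (𝓡 n) (fun q ↦ f q • F q) p v =
      mvfderiv (𝓡 n) f p v • F p + f p • mvfderiv (𝓡 n) F p v :=
  mvfderiv_bilin (ContinuousLinearMap.lsmul ℝ ℝ) hf hF v

lemma mvfderiv_mul_apply {f g : M → ℝ} {p : M}
    (hf : MDifferentiableAt (𝓡 n) 𝓘(ℝ, ℝ) f p) (hg : MDifferentiableAt (𝓡 n) 𝓘(ℝ, ℝ) g p)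
    (v : TangentSpace (𝓡 n) p) :
    mvfderiv (𝓡 n) (fun q ↦ f q * g q) p v =
      mvfderiv (𝓡 n) f p v * g p + f p * mvfderiv (𝓡 n) g p v :=
  mvfderiv_smul_apply hf hg v

lemma mvfderiv_add_apply {F G : M → W} {p : M}
    (hF : MDifferentiableAt (𝓡 n) 𝓘(ℝ, W) F p) (hG : MDifferentiableAt (𝓡 n) 𝓘(ℝ, W) G p)
    (v : TangentSpace (𝓡 n) p) :
    mvfderiv (𝓡 n) (fun q ↦ F q + G q) p v = mvfderiv (𝓡 n) F p v + mvfderiv (𝓡 n) G p v := by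
  rw [mvfderiv_fun_add hF hG]; rfl

lemma mvfderiv_sub_apply {F G : M → W} {p : M}
    (hF : MDifferentiableAt (𝓡 n) 𝓘(ℝ, W) F p) (hG : MDifferentiableAt (𝓡 n) 𝓘(ℝ, W) G p)
    (v : TangentSpace (𝓡 n) p) :
    mvfderiv (𝓡 n) (fun q ↦ F q - G q) p v = mvfderiv (𝓡 n) F p v - mvfderiv (𝓡 n) G p v := by
  rw [mvfderiv_fun_sub hF hG]; rfl

variable [IsManifold (𝓡 n) ∞ M]

/-- The derivative of a smooth function along a smooth field is smooth. -/
lemma smoothAt_mvfderiv_apply {F : M → W} {X : VField n M} {p : M}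
    (hF : ContMDiffAt (𝓡 n) 𝓘(ℝ, W) ∞ F p) (hX : ContMDiffAt (𝓡 n) (𝓡 n).tangent ∞ (T% X) p) :
    ContMDiffAt (𝓡 n) 𝓘(ℝ, W) ∞ (fun q ↦ mvfderiv (𝓡 n) F q (X q)) p := by
  have h := ContMDiffAt.clm_apply_of_inCoordinates (hF.mfderiv_const (m := ∞) (by simp)) hX hF
  exact (contMDiff_snd_tangentBundle_modelSpace W 𝓘(ℝ, W)).contMDiffAt.comp p h

lemma mdiffAt_mvfderiv_apply {F : M → W} {X : VField n M} {p : M}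
    (hF : ContMDiffAt (𝓡 n) 𝓘(ℝ, W) ∞ F p)
    (hX : MDifferentiableAt (𝓡 n) (𝓡 n).tangent (T% X) p) :
    MDifferentiableAt (𝓡 n) 𝓘(ℝ, W) (fun q ↦ mvfderiv (𝓡 n) F q (X q)) p := by
  have h := MDifferentiableAt.clm_apply_of_inCoordinates
    ((hF.mfderiv_const (m := ∞) (by simp)).mdifferentiableAt (by simp)) hX
    (hF.mdifferentiableAt (by simp))
  exact ((contMDiff_snd_tangentBundle_modelSpace W 𝓘(ℝ, W)).mdifferentiable
    (n := 1) (by simp)).mdifferentiableAt.comp p h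

/-- A smooth function with vanishing derivative near a point is locally constant there. -/
lemma eventually_eq_of_mvfderiv_eq_zero {F : M → W} {U : Set M} (hU : IsOpen U)
    (hF : ∀ q ∈ U, MDifferentiableAt (𝓡 n) 𝓘(ℝ, W) F q)
    (h0 : ∀ q ∈ U, ∀ v, mvfderiv (𝓡 n) F q v = 0) {p : M} (hp : p ∈ U) :
    ∀ᶠ q in 𝓝 p, F q = F p := by
  set x := extChartAt (𝓡 n) p
  have hV : x.target ∩ x.symm ⁻¹' U ∈ 𝓝 (x p) := by
    refine inter_mem (extChartAt_target_mem_nhds p) ?_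
    exact (continuousAt_extChartAt_symm p).preimage_mem_nhds
      (by rw [extChartAt_to_inv]; exact hU.mem_nhds hp)
  obtain ⟨r, hr, hball⟩ := Metric.mem_nhds_iff.1 hV
  have key : ∀ y ∈ Metric.ball (x p) r, HasFDerivAt (fun y ↦ F (x.symm y)) (0 : _ →L[ℝ] W) y := by
    intro y hy
    have hy' := hball hy
    have hsm : MDifferentiableAt 𝓘(ℝ, EuclideanSpace ℝ (Fin n)) (𝓡 n) x.symm y := by
      have := (contMDiffOn_extChartAt_symm (I := 𝓡 n) (n := ∞) p).contMDiffAt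
        ((isOpen_extChartAt_target p).mem_nhds hy'.1)
      exact this.mdifferentiableAt (by simp)
    have hd := (hF _ hy'.2).comp y hsm
    have hz : mfderiv 𝓘(ℝ, EuclideanSpace ℝ (Fin n)) 𝓘(ℝ, W) (F ∘ x.symm) y = 0 := by
      rw [mfderiv_comp y (hF _ hy'.2) hsm]
      ext v
      exact h0 _ hy'.2 _
    rw [mfderiv_eq_fderiv] at hz
    have := hd.differentiableAt.hasFDerivAt
    rw [hz] at this
    exact this
  have hconst : ∀ y ∈ Metric.ball (x p) r, F (x.symm y) = F (x.symm (x p)) := fun y hy ↦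
    (convex_ball (x p) r).is_const_of_fderivWithin_eq_zero (𝕜 := ℝ)
      (fun z hz ↦ (key z hz).differentiableAt.differentiableWithinAt)
      (fun z hz ↦ by
        rw [fderivWithin_of_isOpen Metric.isOpen_ball hz]; exact (key z hz).fderiv)
      hy (Metric.mem_ball_self hr)
  have hx : ∀ᶠ q in 𝓝 p, x q ∈ Metric.ball (x p) r :=
    (continuousAt_extChartAt p).eventually (Metric.ball_mem_nhds _ hr)
  filter_upwards [hx, extChartAt_source_mem_nhds (I := 𝓡 n) p] with q hq hqs
  have := hconst _ hq
  rwa [x.left_inv hqs, x.left_inv (mem_extChartAt_source p)] at this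

/-- A function on a connected manifold with vanishing derivative is constant. -/
lemma eq_of_mvfderiv_eq_zero [PreconnectedSpace M] {F : M → W}
    (hF : ∀ q, MDifferentiableAt (𝓡 n) 𝓘(ℝ, W) F q)
    (h0 : ∀ q v, mvfderiv (𝓡 n) F q v = 0) (p q : M) : F p = F q :=
  (IsLocallyConstant.iff_eventually_eq F).2 (fun p ↦ eventually_eq_of_mvfderiv_eq_zero isOpen_univ
    (fun q _ ↦ hF q) (fun q _ ↦ h0 q) (mem_univ p)) |>.apply_eq_of_preconnectedSpace p q

end Calculus

/-! ### Globally defined smooth fields that are coordinate fields near a point. -/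

section Frames

variable {n : ℕ} {M : Type*} [TopologicalSpace M] [ChartedSpace (EuclideanSpace ℝ (Fin n)) M]
  {W : Type*} [NormedAddCommGroup W] [NormedSpace ℝ W] [IsManifold (𝓡 n) ∞ M]

/-- Global smooth vector fields which near `p₀` are the constant fields of the chart at `p₀`. -/
structure CoordFrame (p₀ : M) where
  /-- The open set on which the fields are coordinate fields. -/
  dom : Set M
  isOpen_dom : IsOpen dom
  mem_dom : p₀ ∈ dom
  dom_subset : dom ⊆ (chartAt (EuclideanSpace ℝ (Fin n)) p₀).source
  /-- The field with constant coordinates `c`. -/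
  field : EuclideanSpace ℝ (Fin n) →ₗ[ℝ] VField n M
  smooth : ∀ c, IsSmoothField (field c)
  coord_field : ∀ q ∈ dom, ∀ c, mvfderiv (𝓡 n) (extChartAt (𝓡 n) p₀) q (field c q) = c
  field_coord : ∀ q ∈ dom, ∀ v, field (mvfderiv (𝓡 n) (extChartAt (𝓡 n) p₀) q v) q = v

/-- The coordinate fields of the chart are cut off by a bump function equal to one near `p₀`. Global
fields are needed because the axioms of `Data` and `IsCentroaffine` are tested on globally smooth
fields. -/
lemma exists_coordFrame [T2Space M] (p₀ : M) : Nonempty (CoordFrame (n := n) p₀) := by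
  let f : SmoothBumpFunction (𝓡 n) p₀ := Classical.arbitrary _
  let e := trivializationAt (EuclideanSpace ℝ (Fin n)) (TangentSpace (𝓡 n) : M → Type _) p₀
  have hsrc : e.baseSet = (chartAt (EuclideanSpace ℝ (Fin n)) p₀).source := rfl
  obtain ⟨U, hU, hUo, hpU⟩ := eventually_nhds_iff.1 (f.eventuallyEq_one.and
    ((chartAt (EuclideanSpace ℝ (Fin n)) p₀).open_source.eventually_mem (mem_chart_source _ p₀)))
  have hd : ∀ q ∈ (chartAt (EuclideanSpace ℝ (Fin n)) p₀).source, ∀ v : TangentSpace (𝓡 n) q,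
      mvfderiv (𝓡 n) (extChartAt (𝓡 n) p₀) q v = e.continuousLinearMapAt ℝ q v := by
    intro q hq v
    rw [mvfderiv_eq_mfderiv]
    exact (congrArg (fun L : TangentSpace (𝓡 n) q →L[ℝ] EuclideanSpace ℝ (Fin n) ↦ L v)
      (TangentBundle.continuousLinearMapAt_trivializationAt hq)).symm
  refine ⟨⟨U, hUo, hpU, fun q hq ↦ (hU q hq).2,
    { toFun := fun c q ↦ f q • e.symmL ℝ q c
      map_add' := fun c d ↦ by ext1 q; simp
      map_smul' := fun r c ↦ by
        ext1 q
        simp only [map_smul]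
        exact smul_comm _ _ _ }, ?_, ?_, ?_⟩⟩
  · intro c
    have hs : ContMDiffOn (𝓡 n) (𝓡 n).tangent ∞ (T% (fun q : M ↦ e.symmL ℝ q c)) e.baseSet := by
      intro q hq
      refine ((e.contMDiffOn_iff (IB := 𝓡 n) (n := ∞) (f := T% (fun q : M ↦ e.symmL ℝ q c))
        (fun q hq ↦ by simpa [e.mem_source] using hq)).2
        ⟨contMDiffOn_id, (contMDiffOn_const (c := c)).congr fun q hq ↦ ?_⟩) q hq
      have := e.continuousLinearMapAt_symmL (R := ℝ) hq c
      rw [e.continuousLinearMapAt_apply (R := ℝ), e.coe_linearMapAt_of_mem hq] at this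
      exact this
    exact ContMDiffOn.smul_section_of_tsupport (f.contMDiff.contMDiffOn) e.open_baseSet
      (by rw [hsrc]; exact f.tsupport_subset_chartAt_source) hs
  · intro q hq c
    rw [hd q (hU q hq).2]
    have h1 : f q = 1 := (hU q hq).1
    simp only [LinearMap.coe_mk, AddHom.coe_mk, h1, one_smul]
    exact e.continuousLinearMapAt_symmL (R := ℝ) (by exact (hU q hq).2) c
  · intro q hq v
    rw [hd q (hU q hq).2]
    have h1 : f q = 1 := (hU q hq).1
    simp only [LinearMap.coe_mk, AddHom.coe_mk, h1, one_smul]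
    exact e.symmL_continuousLinearMapAt (R := ℝ) (by exact (hU q hq).2) v

end Frames

section Frames

variable {n : ℕ} {M : Type*} [TopologicalSpace M] [ChartedSpace (EuclideanSpace ℝ (Fin n)) M]
  {W : Type*} [NormedAddCommGroup W] [NormedSpace ℝ W] [IsManifold (𝓡 n) ∞ M]

lemma two_le_infty : (2 : WithTop ℕ∞) ≤ ∞ := by
  exact WithTop.coe_le_coe.2 le_top

lemma IsSmoothField.contMDiffAt {X : VField n M} (hX : IsSmoothField X) (p : M) :
    ContMDiffAt (𝓡 n) (𝓡 n).tangent ∞ (T% X) p := ContMDiff.contMDiffAt hX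

lemma IsSmoothField.mdiffAt {X : VField n M} (hX : IsSmoothField X) (p : M) :
    MDifferentiableAt (𝓡 n) (𝓡 n).tangent (T% X) p :=
  (hX.contMDiffAt p).mdifferentiableAt (by simp)

namespace CoordFrame

variable {p₀ : M} (φ : CoordFrame (n := n) p₀)

lemma source_of_mem {q : M} (hq : q ∈ φ.dom) : q ∈ (extChartAt (𝓡 n) p₀).source := by
  rw [extChartAt_source]; exact φ.dom_subset hq

lemma smoothAt_chart {q : M} (hq : q ∈ φ.dom) :
    ContMDiffAt (𝓡 n) 𝓘(ℝ, EuclideanSpace ℝ (Fin n)) ∞ (extChartAt (𝓡 n) p₀) q :=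
  contMDiffAt_extChartAt' (φ.dom_subset hq)

lemma mdiffAt_chart {q : M} (hq : q ∈ φ.dom) :
    MDifferentiableAt (𝓡 n) 𝓘(ℝ, EuclideanSpace ℝ (Fin n)) (extChartAt (𝓡 n) p₀) q :=
  (φ.smoothAt_chart hq).mdifferentiableAt (by simp)

lemma smoothAt_chart_symm {q : M} (hq : q ∈ φ.dom) :
    ContMDiffAt 𝓘(ℝ, EuclideanSpace ℝ (Fin n)) (𝓡 n) ∞ (extChartAt (𝓡 n) p₀).symm
      (extChartAt (𝓡 n) p₀ q) :=
  (contMDiffOn_extChartAt_symm p₀).contMDiffAt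
    ((isOpen_extChartAt_target p₀).mem_nhds ((extChartAt (𝓡 n) p₀).map_source (φ.source_of_mem hq)))

lemma contDiffAt_comp_symm {F : M → W} {q : M} (hq : q ∈ φ.dom)
    (hF : ContMDiffAt (𝓡 n) 𝓘(ℝ, W) ∞ F q) :
    ContDiffAt ℝ ∞ (fun y ↦ F ((extChartAt (𝓡 n) p₀).symm y)) (extChartAt (𝓡 n) p₀ q) := by
  refine ContMDiffAt.contDiffAt (ContMDiffAt.comp _ ?_ (φ.smoothAt_chart_symm hq))
  rwa [(extChartAt (𝓡 n) p₀).left_inv (φ.source_of_mem hq)]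

/-- The coordinate fields act on functions of the coordinates by partial derivatives. -/
lemma mvfderiv_comp_chart {G : EuclideanSpace ℝ (Fin n) → W} {q : M} (hq : q ∈ φ.dom)
    (hG : DifferentiableAt ℝ G (extChartAt (𝓡 n) p₀ q)) (c : EuclideanSpace ℝ (Fin n)) :
    mvfderiv (𝓡 n) (fun q ↦ G (extChartAt (𝓡 n) p₀ q)) q (φ.field c q) =
      fderiv ℝ G (extChartAt (𝓡 n) p₀ q) c := by
  rw [mvfderiv_comp_left hG (φ.mdiffAt_chart hq), φ.coord_field q hq]

lemma mvfderiv_field {F : M → W} {q : M} (hq : q ∈ φ.dom)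
    (hF : MDifferentiableAt (𝓡 n) 𝓘(ℝ, W) F q) (c : EuclideanSpace ℝ (Fin n)) :
    mvfderiv (𝓡 n) F q (φ.field c q) =
      fderiv ℝ (fun y ↦ F ((extChartAt (𝓡 n) p₀).symm y)) (extChartAt (𝓡 n) p₀ q) c := by
  have hG : DifferentiableAt ℝ (fun y ↦ F ((extChartAt (𝓡 n) p₀).symm y))
      (extChartAt (𝓡 n) p₀ q) := by
    refine MDifferentiableAt.differentiableAt (MDifferentiableAt.comp _ ?_
      ((φ.smoothAt_chart_symm hq).mdifferentiableAt (by simp)))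
    rwa [(extChartAt (𝓡 n) p₀).left_inv (φ.source_of_mem hq)]
  rw [← φ.mvfderiv_comp_chart hq hG]
  congr 1
  refine mvfderiv_congr ?_
  filter_upwards [φ.isOpen_dom.mem_nhds hq] with r hr
  rw [(extChartAt (𝓡 n) p₀).left_inv (φ.source_of_mem hr)]

/-- In the chart both sides are second partial derivatives of the same function, and these are
symmetric. -/
lemma field_comm {F : M → W} {q : M} (hq : q ∈ φ.dom) (hF : ContMDiffAt (𝓡 n) 𝓘(ℝ, W) ∞ F q)
    (c d : EuclideanSpace ℝ (Fin n)) :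
    mvfderiv (𝓡 n) (fun r ↦ mvfderiv (𝓡 n) F r (φ.field c r)) q (φ.field d q) =
      mvfderiv (𝓡 n) (fun r ↦ mvfderiv (𝓡 n) F r (φ.field d r)) q (φ.field c q) := by
  set G := fun y ↦ F ((extChartAt (𝓡 n) p₀).symm y)
  have hG : ContDiffAt ℝ ∞ G (extChartAt (𝓡 n) p₀ q) := φ.contDiffAt_comp_symm hq hF
  have h2 : DifferentiableAt ℝ (fderiv ℝ G) (extChartAt (𝓡 n) p₀ q) :=
    (hG.fderiv_right (m := 1) (by norm_cast)).differentiableAt (by simp)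
  have hF1 : ∀ᶠ r in 𝓝 q, MDifferentiableAt (𝓡 n) 𝓘(ℝ, W) F r := by
    have h1 : ContMDiffAt (𝓡 n) 𝓘(ℝ, W) 1 F q := hF.of_le (by norm_cast)
    filter_upwards [(contMDiffAt_iff_contMDiffAt_nhds (by simp)).1 h1] with r hr using
      hr.mdifferentiableAt (by simp)
  have key : ∀ c d, mvfderiv (𝓡 n) (fun r ↦ mvfderiv (𝓡 n) F r (φ.field c r)) q (φ.field d q) =
      fderiv ℝ (fderiv ℝ G) (extChartAt (𝓡 n) p₀ q) d c := by
    intro c d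
    have h : (fun r ↦ mvfderiv (𝓡 n) F r (φ.field c r)) =ᶠ[𝓝 q]
        fun r ↦ (fun y ↦ fderiv ℝ G y c) (extChartAt (𝓡 n) p₀ r) := by
      filter_upwards [φ.isOpen_dom.mem_nhds hq, hF1] with r hr hr1
      exact φ.mvfderiv_field hr hr1 c
    rw [mvfderiv_congr h, φ.mvfderiv_comp_chart hq (h2.clm_apply (differentiableAt_const c)),
      fderiv_clm_apply h2 (differentiableAt_const c)]
    simp
  rw [key, key]
  exact (hG.isSymmSndFDerivAt (by simpa using two_le_infty)).eq d c

lemma isInvertible_chart {q : M} (hq : q ∈ φ.dom) :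
    (mfderiv (𝓡 n) 𝓘(ℝ, EuclideanSpace ℝ (Fin n)) (extChartAt (𝓡 n) p₀) q).IsInvertible :=
  isInvertible_mfderiv_extChartAt (φ.source_of_mem hq)

/-- Near `q` the fields are pullbacks of constant fields under the chart, and pullback commutes with
the Lie bracket. -/
lemma mlieBracket_field {q : M} (hq : q ∈ φ.dom) (c d : EuclideanSpace ℝ (Fin n)) :
    VectorField.mlieBracket (𝓡 n) (φ.field c) (φ.field d) q = 0 := by
  have h : ∀ c, φ.field c =ᶠ[𝓝 q] VectorField.mpullback (𝓡 n) 𝓘(ℝ, EuclideanSpace ℝ (Fin n))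
      (extChartAt (𝓡 n) p₀) (fun _ ↦ c) := by
    intro c
    filter_upwards [φ.isOpen_dom.mem_nhds hq] with r hr
    exact ((φ.isInvertible_chart hr).inverse_apply_eq.2 (φ.coord_field r hr c).symm).symm
  rw [(h c).mlieBracket_vectorField_eq (h d)]
  have : IsManifold (𝓡 n) (minSmoothness ℝ 2) M :=
    IsManifold.of_le (n := ∞) (by simpa using two_le_infty)
  have h2 := VectorField.mpullback_mlieBracket (I := 𝓡 n) (n := ∞)
    (I' := 𝓘(ℝ, EuclideanSpace ℝ (Fin n))) (f := extChartAt (𝓡 n) p₀) (x₀ := q)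
    (V := fun _ ↦ c) (W := fun _ ↦ d)
    ((contMDiff_vectorSpace_iff_contDiff (n := ∞).2 contDiff_const).mdifferentiable
      (by simp)).mdifferentiableAt
    ((contMDiff_vectorSpace_iff_contDiff (n := ∞).2 contDiff_const).mdifferentiable
      (by simp)).mdifferentiableAt
    (φ.smoothAt_chart hq) (by simpa using two_le_infty)
  have h3 : ∀ y : EuclideanSpace ℝ (Fin n), VectorField.mlieBracket (𝓡 n)
      (fun z ↦ (c : TangentSpace (𝓡 n) z)) (fun z ↦ (d : TangentSpace (𝓡 n) z)) y = 0 := by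
    intro y
    have gen : ∀ V W : (z : EuclideanSpace ℝ (Fin n)) → TangentSpace (𝓡 n) z,
        VectorField.mlieBracket (𝓡 n) V W y = VectorField.lieBracket ℝ V W y := by
      intro V W
      rw [← VectorField.mlieBracketWithin_univ, VectorField.mlieBracketWithin_eq_lieBracketWithin]
      exact congrFun VectorField.lieBracketWithin_univ y
    refine (gen _ _).trans ?_
    have hc : VectorField.lieBracket ℝ (fun _ : EuclideanSpace ℝ (Fin n) ↦ c) (fun _ ↦ d) y = 0 := by
      simp [VectorField.lieBracket]
    exact hc
  exact h2.symm.trans ((congrArg _ (h3 _)).trans (map_zero _))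

lemma smoothAt_field (c : EuclideanSpace ℝ (Fin n)) (q : M) :
    ContMDiffAt (𝓡 n) (𝓡 n).tangent ∞ (T% (φ.field c)) q := (φ.smooth c).contMDiffAt q

lemma field_apply_eq_sum (c : EuclideanSpace ℝ (Fin n)) (q : M) :
    φ.field c q = ∑ i, c i • φ.field (EuclideanSpace.single i 1) q := by
  have h : c = ∑ i, c i • EuclideanSpace.single i (1 : ℝ) := by
    ext j
    simp [Finset.sum_apply, Pi.single_apply]
  conv_lhs => rw [h]
  rw [map_sum, Finset.sum_apply]
  simp

/-- A field whose coordinates are smooth is smooth. -/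
lemma smoothAt_of_coord {X : VField n M} {q : M} (hq : q ∈ φ.dom)
    (hX : ContMDiffAt (𝓡 n) 𝓘(ℝ, EuclideanSpace ℝ (Fin n)) ∞
      (fun r ↦ mvfderiv (𝓡 n) (extChartAt (𝓡 n) p₀) r (X r)) q) :
    ContMDiffAt (𝓡 n) (𝓡 n).tangent ∞ (T% X) q := by
  have hs : ContMDiffAt (𝓡 n) (𝓡 n).tangent ∞ (T% (fun r ↦ ∑ i,
      (mvfderiv (𝓡 n) (extChartAt (𝓡 n) p₀) r (X r)) i •
        φ.field (EuclideanSpace.single i 1) r)) q := by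
    refine ContMDiffAt.sum_section fun i _ ↦ ContMDiffAt.smul_section ?_ (φ.smoothAt_field _ q)
    exact ((EuclideanSpace.proj i : EuclideanSpace ℝ (Fin n) →L[ℝ] ℝ).contDiff (n := ∞)
      ).contMDiff.contMDiffAt.comp q hX
  refine hs.congr_of_eventuallyEq ?_
  filter_upwards [φ.isOpen_dom.mem_nhds hq] with r hr
  rw [← φ.field_apply_eq_sum, φ.field_coord r hr]

end CoordFrame

/-- Every tangent vector extends to a global smooth field. -/
lemma exists_smoothField [T2Space M] {p : M} (v : TangentSpace (𝓡 n) p) :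
    ∃ X : VField n M, IsSmoothField X ∧ X p = v := by
  obtain ⟨φ⟩ := exists_coordFrame (n := n) p
  exact ⟨_, φ.smooth _, φ.field_coord p φ.mem_dom v⟩

end Frames

/-! ### The Lie bracket as a commutator of derivations. -/

section Bracket

variable {n : ℕ} {M : Type*} [TopologicalSpace M] [ChartedSpace (EuclideanSpace ℝ (Fin n)) M]
  {W : Type*} [NormedAddCommGroup W] [NormedSpace ℝ W] [IsManifold (𝓡 n) ∞ M]

/-- The derivative of the coefficient `f` produced by the bracket cancels the one produced by
differentiating `dF(fX)`. The commutator formula therefore depends only on the value of `X` at `p`.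
-/
lemma tensorialAt_bracketDefect {F : M → W} {p : M} (hF : ContMDiffAt (𝓡 n) 𝓘(ℝ, W) ∞ F p)
    (Y : VField n M) :
    TensorialAt (𝓡 n) (EuclideanSpace ℝ (Fin n)) (fun X : VField n M ↦
      mvfderiv (𝓡 n) F p (VectorField.mlieBracket (𝓡 n) X Y p)
        - mvfderiv (𝓡 n) (fun q ↦ mvfderiv (𝓡 n) F q (Y q)) p (X p)
        + mvfderiv (𝓡 n) (fun q ↦ mvfderiv (𝓡 n) F q (X q)) p (Y p)) p where
  smul {f X} hf hX := by
    have h1 : mvfderiv (𝓡 n) (fun q ↦ mvfderiv (𝓡 n) F q ((f • X) q)) p (Y p) =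
        mvfderiv (𝓡 n) f p (Y p) • mvfderiv (𝓡 n) F p (X p) +
        f p • mvfderiv (𝓡 n) (fun q ↦ mvfderiv (𝓡 n) F q (X q)) p (Y p) := by
      rw [← mvfderiv_smul_apply hf (mdiffAt_mvfderiv_apply hF hX)]
      simp
    rw [h1, VectorField.mlieBracket_smul_left hf hX]
    simp only [map_add, map_smul, Pi.smul_apply', map_neg, neg_smul]
    module
  add {X X'} hX hX' := by
    have h1 : mvfderiv (𝓡 n) (fun q ↦ mvfderiv (𝓡 n) F q ((X + X') q)) p (Y p) =
        mvfderiv (𝓡 n) (fun q ↦ mvfderiv (𝓡 n) F q (X q)) p (Y p) +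
        mvfderiv (𝓡 n) (fun q ↦ mvfderiv (𝓡 n) F q (X' q)) p (Y p) := by
      rw [← mvfderiv_add_apply (mdiffAt_mvfderiv_apply hF hX) (mdiffAt_mvfderiv_apply hF hX')]
      simp
    rw [h1, VectorField.mlieBracket_add_left hX hX']
    simp only [map_add, Pi.add_apply]
    abel

/-- The Lie bracket acts on functions as a commutator. -/
lemma mvfderiv_mlieBracket [T2Space M] {F : M → W} {p : M}
    (hF : ContMDiffAt (𝓡 n) 𝓘(ℝ, W) ∞ F p) {X Y : VField n M}
    (hX : MDifferentiableAt (𝓡 n) (𝓡 n).tangent (T% X) p)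
    (hY : MDifferentiableAt (𝓡 n) (𝓡 n).tangent (T% Y) p) :
    mvfderiv (𝓡 n) F p (VectorField.mlieBracket (𝓡 n) X Y p) =
      mvfderiv (𝓡 n) (fun q ↦ mvfderiv (𝓡 n) F q (Y q)) p (X p)
        - mvfderiv (𝓡 n) (fun q ↦ mvfderiv (𝓡 n) F q (X q)) p (Y p) := by
  obtain ⟨φ⟩ := exists_coordFrame (n := n) p
  set c := mvfderiv (𝓡 n) (extChartAt (𝓡 n) p) p (X p)
  set d := mvfderiv (𝓡 n) (extChartAt (𝓡 n) p) p (Y p)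
  have hc : X p = φ.field c p := (φ.field_coord p φ.mem_dom (X p)).symm
  have hd : Y p = φ.field d p := (φ.field_coord p φ.mem_dom (Y p)).symm
  have hEc := (φ.smooth c).mdiffAt p
  have hEd := (φ.smooth d).mdiffAt p
  -- Tensoriality replaces `X` and then, using antisymmetry of the bracket, `Y` by coordinate
  -- fields. For these the bracket vanishes and the mixed derivatives agree.
  have h1 := (tensorialAt_bracketDefect hF Y).pointwise hX hEc hc
  have h2 := (tensorialAt_bracketDefect hF (φ.field c)).pointwise hY hEd hd
  have h3 := φ.field_comm φ.mem_dom hF c d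
  beta_reduce at h1 h2
  rw [VectorField.mlieBracket_swap_apply, VectorField.mlieBracket_swap_apply (V := φ.field d),
    φ.mlieBracket_field φ.mem_dom, h3] at h2
  simp only [map_neg, neg_zero, map_zero, zero_sub, neg_add_cancel] at h2
  rw [← sub_eq_zero]
  calc _ = _ := (sub_sub_eq_add_sub _ _ _).trans (sub_add_eq_add_sub _ _ _).symm
    _ = _ := h1
    _ = -(-mvfderiv (𝓡 n) F p (VectorField.mlieBracket (𝓡 n) (φ.field c) Y p)
        - mvfderiv (𝓡 n) (fun q ↦ mvfderiv (𝓡 n) F q (φ.field c q)) p (Y p)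
        + mvfderiv (𝓡 n) (fun q ↦ mvfderiv (𝓡 n) F q (Y q)) p (φ.field c p)) := by abel
    _ = 0 := by rw [h2, neg_zero]

end Bracket

/-! ### Local integration of flat linear systems `dP = P θ`. -/

section FlatSystem

variable {E 𝔸 : Type*} [NormedAddCommGroup E] [NormedSpace ℝ E] [NormedRing 𝔸] [NormedAlgebra ℝ 𝔸]

local instance : NormedAddCommGroup (E →L[ℝ] 𝔸) := ContinuousLinearMap.toNormedAddCommGroup

local instance : NormedAddCommGroup (E →L[ℝ] E →L[ℝ] 𝔸) :=
  ContinuousLinearMap.toNormedAddCommGroup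

local instance : SeminormedAddCommGroup (E →L[ℝ] E →L[ℝ] 𝔸) :=
  NormedAddCommGroup.toSeminormedAddCommGroup

/-- The bound `1 / 2` keeps the solution in the ball of radius `‖1‖` about `1`: there `‖z‖ ≤ 2 ‖1‖`,
so the speed is at most `‖1‖`, and Picard–Lindelöf reaches all of the unit interval. -/
lemma exists_linear_ode_solution [CompleteSpace 𝔸] {A : ℝ → 𝔸} (hA : ContinuousOn A (Icc 0 1))
    (hb : ∀ t ∈ Icc (0 : ℝ) 1, ‖A t‖ ≤ 1 / 2) :
    ∃ α : ℝ → 𝔸, α 0 = 1 ∧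
      ∀ t ∈ Icc (0 : ℝ) 1, HasDerivWithinAt α (α t * A t) (Icc 0 1) t := by
  have hPL : IsPicardLindelof (fun t z ↦ z * A t) (tmin := 0) (tmax := 1)
      ⟨0, by simp⟩ (1 : 𝔸) ‖(1 : 𝔸)‖₊ 0 ‖(1 : 𝔸)‖₊ 1 := by
    constructor
    · intro t ht
      refine LipschitzWith.lipschitzOnWith (LipschitzWith.of_dist_le_mul fun y z ↦ ?_)
      rw [dist_eq_norm, dist_eq_norm, ← sub_mul]
      calc ‖(y - z) * A t‖ ≤ ‖y - z‖ * ‖A t‖ := norm_mul_le _ _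
        _ ≤ ‖y - z‖ * 1 := by gcongr; exact (hb t ht).trans (by norm_num)
        _ = _ := by simp
    · intro z _
      exact continuousOn_const.mul hA
    · intro t ht z hz
      have h1 : ‖z‖ ≤ 2 * ‖(1 : 𝔸)‖ := by
        have := norm_le_norm_add_norm_sub' z 1
        rw [Metric.mem_closedBall, dist_eq_norm] at hz
        simp only [coe_nnnorm] at hz
        linarith
      calc ‖z * A t‖ ≤ ‖z‖ * ‖A t‖ := norm_mul_le _ _
        _ ≤ (2 * ‖(1 : 𝔸)‖) * (1 / 2) := by gcongr; exact hb t ht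
        _ = _ := by rw [coe_nnnorm]; ring
    · simp
  obtain ⟨α, h0, hα⟩ := hPL.exists_eq_forall_mem_Icc_hasDerivWithinAt₀
  exact ⟨α, h0, hα⟩

/-- A Grönwall estimate on the unit interval. -/
lemma norm_le_of_deriv_bound {w w' : ℝ → 𝔸} {δ ε : ℝ}
    (hw : ∀ t ∈ Icc (0 : ℝ) 1, HasDerivWithinAt w (w' t) (Icc 0 1) t)
    (h0 : ‖w 0‖ ≤ δ) (hδ : 0 ≤ δ) (hε : 0 ≤ ε)
    (hb : ∀ t ∈ Icc (0 : ℝ) 1, ‖w' t‖ ≤ ‖w t‖ + ε) {t : ℝ} (ht : t ∈ Icc (0 : ℝ) 1) :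
    ‖w t‖ ≤ (δ + ε) * Real.exp 1 := by
  have h := norm_le_gronwallBound_of_norm_deriv_right_le (K := 1) (ε := ε)
    (fun t ht ↦ (hw t ht).continuousWithinAt)
    (fun t ht ↦ (hw t (Ico_subset_Icc_self ht)).mono_of_mem_nhdsWithin (Icc_mem_nhdsGE_of_mem ht))
    h0 (fun t ht ↦ by simpa using hb t (Ico_subset_Icc_self ht)) t ht
  rw [gronwallBound_of_K_ne_0 one_ne_zero] at h
  have he : Real.exp (1 * (t - 0)) ≤ Real.exp 1 := Real.exp_le_exp.2 (by linarith [ht.2])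
  have he0 := Real.exp_pos (1 * (t - 0))
  have h1 := mul_le_mul_of_nonneg_left he (add_nonneg hδ hε)
  simp only [div_one] at h
  nlinarith

variable {θ : E → E →L[ℝ] 𝔸} {y₀ : E} {r K : ℝ}

set_option synthInstance.maxHeartbeats 400000 in
set_option maxHeartbeats 1000000 in
/-- The second order estimate comparing the solutions along two neighbouring rays. -/
lemma norm_ray_sub_le (hr : r ≤ 1) (hK : 0 ≤ K) (hKr : K * r ≤ 1 / 2)
    (hd : ∀ y ∈ Metric.ball y₀ r, DifferentiableAt ℝ θ y)
    (hθ : ∀ y ∈ Metric.ball y₀ r, ‖θ y‖ ≤ K) (hθ' : ∀ y ∈ Metric.ball y₀ r, ‖fderiv ℝ θ y‖ ≤ K)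
    (hL : ∀ y ∈ Metric.ball y₀ r, ∀ z ∈ Metric.ball y₀ r,
      ‖fderiv ℝ θ z - fderiv ℝ θ y‖ ≤ K * ‖z - y‖)
    (hflat : ∀ y ∈ Metric.ball y₀ r, ∀ v w, θ y v * θ y w - θ y w * θ y v
      + fderiv ℝ θ y v w - fderiv ℝ θ y w v = 0)
    {x h : E} (hx : ‖x‖ < r) (hxh : ‖x + h‖ < r) {α β : ℝ → 𝔸} (hα0 : α 0 = 1) (hβ0 : β 0 = 1)
    (hα : ∀ t ∈ Icc (0 : ℝ) 1, HasDerivWithinAt α (α t * θ (y₀ + t • x) x) (Icc 0 1) t)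
    (hβ : ∀ t ∈ Icc (0 : ℝ) 1,
      HasDerivWithinAt β (β t * θ (y₀ + t • (x + h)) (x + h)) (Icc 0 1) t) :
    ‖β 1 - α 1 * (1 + θ (y₀ + x) h)‖ ≤
      (‖(1 : 𝔸)‖ * Real.exp 1 * (2 * K + 2 * K ^ 2) * Real.exp 1) * ‖h‖ ^ 2 := by
  have hr0 : 0 ≤ r := (norm_nonneg x).trans hx.le
  have hmem : ∀ {z : E}, ‖z‖ < r → ∀ t ∈ Icc (0 : ℝ) 1, y₀ + t • z ∈ Metric.ball y₀ r := by
    intro z hz t ht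
    rw [Metric.mem_ball, dist_eq_norm, add_sub_cancel_left, norm_smul, Real.norm_eq_abs,
      abs_of_nonneg ht.1]
    nlinarith [ht.2, ht.1, norm_nonneg z]
  have hbound : ∀ {z : E}, ‖z‖ < r → ∀ t ∈ Icc (0 : ℝ) 1, ‖θ (y₀ + t • z) z‖ ≤ 1 / 2 := by
    intro z hz t ht
    calc ‖θ (y₀ + t • z) z‖ ≤ ‖θ (y₀ + t • z)‖ * ‖z‖ := ContinuousLinearMap.le_opNorm _ _
      _ ≤ K * r := by gcongr; exact hθ _ (hmem hz t ht)
      _ ≤ _ := hKr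
  set N := ‖(1 : 𝔸)‖ * Real.exp 1
  have hN : ∀ t ∈ Icc (0 : ℝ) 1, ‖α t‖ ≤ N := by
    intro t ht
    have := norm_le_of_deriv_bound hα (δ := ‖(1 : 𝔸)‖) (ε := 0) (by rw [hα0]) (norm_nonneg _) le_rfl
      (fun t ht ↦ by
        calc ‖α t * θ (y₀ + t • x) x‖ ≤ ‖α t‖ * ‖θ (y₀ + t • x) x‖ := norm_mul_le _ _
          _ ≤ ‖α t‖ * 1 := by gcongr; exact (hbound hx t ht).trans (by norm_num)
          _ = ‖α t‖ + 0 := by ring) ht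
    simpa [N] using this
  have hN0 : 0 ≤ N := by positivity
  -- The curve `α t (1 + t θ h)` is the first-order guess for `β`. Both start at `1`, so Grönwall
  -- reduces the claim to a quadratic bound on the defect of this guess in the equation of `β`.
  have hg : ∀ t ∈ Icc (0 : ℝ) 1, HasDerivWithinAt (fun t ↦ α t * (1 + t • θ (y₀ + t • x) h))
      (α t * θ (y₀ + t • x) x * (1 + t • θ (y₀ + t • x) h) +
        α t * (t • fderiv ℝ θ (y₀ + t • x) x h + θ (y₀ + t • x) h)) (Icc 0 1) t := by
    intro t ht
    have h1 : HasDerivAt (fun t : ℝ ↦ y₀ + t • x) x t := by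
      simpa using ((hasDerivAt_id t).smul_const x).const_add y₀
    have h2 : HasDerivAt (fun t : ℝ ↦ θ (y₀ + t • x) h) (fderiv ℝ θ (y₀ + t • x) x h) t :=
      (((hd _ (hmem hx t ht)).hasFDerivAt.comp_hasDerivAt t h1).clm_apply
        (hasDerivAt_const t h)).congr_deriv (by simp)
    have h3 := ((hasDerivAt_id t).smul h2).const_add (1 : 𝔸)
    refine ((hα t ht).mul h3.hasDerivWithinAt).congr_deriv ?_
    simp
  have hw := norm_le_of_deriv_bound (fun t ht ↦ (hβ t ht).sub (hg t ht)) (δ := 0)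
    (ε := N * (2 * K + 2 * K ^ 2) * ‖h‖ ^ 2) (by simp [hα0, hβ0]) le_rfl (by positivity) ?_
    (t := 1) (by simp)
  · simp only [Pi.sub_apply, one_smul] at hw
    refine hw.trans (le_of_eq ?_)
    ring
  intro t ht
  set y := y₀ + t • x with hy
  have hyz : y₀ + t • (x + h) = y + t • h := by rw [hy, smul_add, add_assoc]
  have hyb := hmem hx t ht
  have hzb := hmem hxh t ht
  rw [hyz] at hzb
  have hbx := hbound hxh t ht
  rw [hyz] at hbx ⊢
  have ht' : ‖t • h‖ ≤ ‖h‖ := by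
    rw [norm_smul, Real.norm_eq_abs, abs_of_nonneg ht.1]
    nlinarith [ht.2, norm_nonneg h]
  have hseg : segment ℝ y (y + t • h) ⊆ Metric.ball y₀ r :=
    (convex_ball y₀ r).segment_subset hyb hzb
  have hnear : ∀ z ∈ segment ℝ y (y + t • h), ‖z - y‖ ≤ ‖h‖ := by
    intro z hz
    obtain ⟨s, hs, rfl⟩ := (segment_eq_image' ℝ y (y + t • h) ▸ hz :)
    rw [add_sub_cancel_left, add_sub_cancel_left, norm_smul, Real.norm_eq_abs, abs_of_nonneg hs.1]
    nlinarith [hs.2, hs.1, norm_nonneg (t • h)]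
  have hR : ‖θ (y + t • h) - θ y - fderiv ℝ θ y (t • h)‖ ≤ K * ‖h‖ * ‖h‖ := by
    have := (convex_segment y (y + t • h)).norm_image_sub_le_of_norm_fderiv_le' (f := θ)
      (φ := fderiv ℝ θ y) (C := K * ‖h‖) (𝕜 := ℝ) (fun z hz ↦ hd z (hseg hz))
      (fun z hz ↦ (hL y hyb z (hseg hz)).trans (by gcongr; exact hnear z hz))
      (left_mem_segment ℝ _ _) (right_mem_segment ℝ _ _)
    rw [add_sub_cancel_left] at this
    exact this.trans (by gcongr)
  have hD : ‖θ (y + t • h) - θ y‖ ≤ K * ‖h‖ := by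
    have := (convex_segment y (y + t • h)).norm_image_sub_le_of_norm_fderiv_le (f := θ)
      (C := K) (𝕜 := ℝ) (fun z hz ↦ hd z (hseg hz)) (fun z hz ↦ hθ' z (hseg hz))
      (left_mem_segment ℝ _ _) (right_mem_segment ℝ _ _)
    rw [add_sub_cancel_left] at this
    exact this.trans (by gcongr)
  set R := θ (y + t • h) - θ y - fderiv ℝ θ y (t • h) with hRdef
  set Δ := θ (y + t • h) - θ y with hΔ
  have hfl := hflat y hyb x h
  -- Flatness trades `dθ(x) h` for `dθ(h) x` plus a commutator, and all terms of first order in `h`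
  -- cancel. What remains is the error times the coefficient, plus terms quadratic in `h`: Taylor
  -- remainders and products of two small factors.
  have key : β t * θ (y + t • h) (x + h) - (α t * θ y x * (1 + t • θ y h) +
        α t * (t • fderiv ℝ θ y x h + θ y h)) =
      (β t - α t * (1 + t • θ y h)) * θ (y + t • h) (x + h) +
        α t * ((R (x + h) + t • fderiv ℝ θ y h h) + t • θ y h * (Δ (x + h) + θ y h)) := by
    have e1 : θ (y + t • h) (x + h) = θ y x + θ y h + Δ (x + h) := by
      simp only [hΔ, sub_apply, map_add]; abel
    have e2 : R (x + h) = Δ (x + h) - t • fderiv ℝ θ y h x - t • fderiv ℝ θ y h h := by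
      simp only [hRdef, hΔ, sub_apply, map_add, map_smul,
        smul_apply]
      abel_nf
    have e3 : fderiv ℝ θ y x h = fderiv ℝ θ y h x - θ y x * θ y h + θ y h * θ y x := by
      rw [← sub_eq_zero, ← hfl]; abel
    rw [e1, e2, e3]
    simp only [mul_add, add_mul, mul_sub, sub_mul, smul_add, smul_sub, mul_smul_comm,
      smul_mul_assoc, mul_one, mul_assoc]
    abel
  simp only [Pi.sub_apply]
  rw [key]
  have hxh1 : ‖x + h‖ ≤ 1 := hxh.le.trans hr
  have b1 : ‖R (x + h)‖ ≤ K * ‖h‖ * ‖h‖ := by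
    calc _ ≤ ‖R‖ * ‖x + h‖ := R.le_opNorm _
      _ ≤ (K * ‖h‖ * ‖h‖) * 1 := by gcongr
      _ = _ := mul_one _
  have b2 : ‖t • fderiv ℝ θ y h h‖ ≤ K * ‖h‖ * ‖h‖ := by
    rw [norm_smul, Real.norm_eq_abs, abs_of_nonneg ht.1]
    calc t * ‖fderiv ℝ θ y h h‖ ≤ 1 * (‖fderiv ℝ θ y‖ * ‖h‖ * ‖h‖) := by
          gcongr
          · exact ht.2
          · exact ContinuousLinearMap.le_opNorm₂ _ _ _
      _ ≤ 1 * (K * ‖h‖ * ‖h‖) := by gcongr; exact hθ' y hyb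
      _ = _ := one_mul _
  have b3 : ‖θ y h‖ ≤ K * ‖h‖ :=
    (ContinuousLinearMap.le_opNorm _ _).trans (by gcongr; exact hθ y hyb)
  have b4 : ‖Δ (x + h)‖ ≤ K * ‖h‖ := by
    calc _ ≤ ‖Δ‖ * ‖x + h‖ := Δ.le_opNorm _
      _ ≤ (K * ‖h‖) * 1 := by gcongr
      _ = _ := mul_one _
  have b5 : ‖t • θ y h‖ ≤ K * ‖h‖ := by
    rw [norm_smul, Real.norm_eq_abs, abs_of_nonneg ht.1]
    calc t * ‖θ y h‖ ≤ 1 * (K * ‖h‖) := by gcongr; exact ht.2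
      _ = _ := one_mul _
  calc _ ≤ ‖β t - α t * (1 + t • θ y h)‖ * ‖θ (y + t • h) (x + h)‖ +
        ‖α t‖ * (‖R (x + h)‖ + ‖t • fderiv ℝ θ y h h‖ +
          ‖t • θ y h‖ * (‖Δ (x + h)‖ + ‖θ y h‖)) := by
        refine (norm_add_le _ _).trans (add_le_add (norm_mul_le _ _) ((norm_mul_le _ _).trans ?_))
        gcongr
        refine (norm_add_le _ _).trans (add_le_add (norm_add_le _ _) ((norm_mul_le _ _).trans ?_))
        gcongr
        exact norm_add_le _ _
    _ ≤ ‖β t - α t * (1 + t • θ y h)‖ * 1 +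
        N * (K * ‖h‖ * ‖h‖ + K * ‖h‖ * ‖h‖ + K * ‖h‖ * (K * ‖h‖ + K * ‖h‖)) := by
        gcongr
        · exact hbx.trans (by norm_num)
        · exact hN t ht
    _ = _ := by ring

set_option synthInstance.maxHeartbeats 400000 in
set_option maxHeartbeats 1000000 in
/-- Flat linear systems `dP = P θ` are locally solvable. -/
theorem exists_flat_frame [CompleteSpace 𝔸] {U : Set E} (hU : IsOpen U) (hy₀ : y₀ ∈ U)
    (hθ : ContDiffOn ℝ ∞ θ U)
    (hflat : ∀ y ∈ U, ∀ v w, θ y v * θ y w - θ y w * θ y v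
      + fderiv ℝ θ y v w - fderiv ℝ θ y w v = 0) :
    ∃ (P : E → 𝔸) (r : ℝ), 0 < r ∧ P y₀ = 1 ∧ ∀ y ∈ Metric.ball y₀ r, ContDiffAt ℝ ∞ P y ∧
      HasFDerivAt P ((ContinuousLinearMap.mul ℝ 𝔸 (P y)).comp (θ y)) y ∧ IsUnit (P y) := by
  have hat : ∀ y ∈ U, ContDiffAt ℝ ∞ θ y := fun y hy ↦ hθ.contDiffAt (hU.mem_nhds hy)
  have hd1 : ContDiffAt ℝ 1 (fderiv ℝ θ) y₀ := (hat y₀ hy₀).fderiv_right (by norm_cast)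
  obtain ⟨K₀, t, ht, hlip⟩ := hd1.exists_lipschitzOnWith
  have e1 : ∀ᶠ y in 𝓝 y₀, ‖θ y‖ < ‖θ y₀‖ + 1 :=
    (continuous_norm.continuousAt.comp (hat y₀ hy₀).continuousAt).eventually_lt
      continuousAt_const (lt_add_one _)
  have e2 : ∀ᶠ y in 𝓝 y₀, ‖fderiv ℝ θ y‖ < ‖fderiv ℝ θ y₀‖ + 1 :=
    (continuous_norm.continuousAt.comp hd1.continuousAt).eventually_lt
      continuousAt_const (lt_add_one _)
  obtain ⟨r₀, hr₀, hb⟩ := Metric.mem_nhds_iff.1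
    (inter_mem (inter_mem e1 e2) (inter_mem ht (hU.mem_nhds hy₀)))
  set K : ℝ := max (max (‖θ y₀‖ + 1) (‖fderiv ℝ θ y₀‖ + 1)) K₀
  have hK : 0 ≤ K := le_max_of_le_right K₀.2
  -- Small enough for `K r ≤ 1 / 2`, the bound needed by the equation along rays.
  set r : ℝ := min (min 1 r₀) (1 / (2 * (K + 1)))
  have hr : 0 < r := by positivity
  have hr1 : r ≤ 1 := (min_le_left _ _).trans (min_le_left _ _)
  have hbr : Metric.ball y₀ r ⊆ Metric.ball y₀ r₀ :=
    Metric.ball_subset_ball ((min_le_left _ _).trans (min_le_right _ _))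
  have hKr : K * r ≤ 1 / 2 := by
    have h1 : r ≤ 1 / (2 * (K + 1)) := min_le_right _ _
    rw [le_div_iff₀ (by positivity)] at h1
    nlinarith
  have hbU : ∀ y ∈ Metric.ball y₀ r, y ∈ U := fun y hy ↦ (hb (hbr hy)).2.2
  have b1 : ∀ y ∈ Metric.ball y₀ r, ‖θ y‖ ≤ K := fun y hy ↦
    (hb (hbr hy)).1.1.le.trans ((le_max_left _ _).trans (le_max_left _ _))
  have b2 : ∀ y ∈ Metric.ball y₀ r, ‖fderiv ℝ θ y‖ ≤ K := fun y hy ↦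
    (hb (hbr hy)).1.2.le.trans ((le_max_right _ _).trans (le_max_left _ _))
  have b3 : ∀ y ∈ Metric.ball y₀ r, ∀ z ∈ Metric.ball y₀ r,
      ‖fderiv ℝ θ z - fderiv ℝ θ y‖ ≤ K * ‖z - y‖ := fun y hy z hz ↦ by
    have := hlip.dist_le_mul z (hb (hbr hz)).2.1 y (hb (hbr hy)).2.1
    rw [dist_eq_norm, dist_eq_norm] at this
    exact this.trans (by gcongr; exact le_max_right _ _)
  -- The system is solved along each ray from `y₀`, and `P` is the value at the end of the ray. The
  -- condition `‖x‖ < r` sits inside the existential so that `choose` yields a total function.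
  have hray : ∀ x : E, ∃ α : ℝ → 𝔸, ‖x‖ < r → α 0 = 1 ∧ ∀ t ∈ Icc (0 : ℝ) 1,
      HasDerivWithinAt α (α t * θ (y₀ + t • x) x) (Icc 0 1) t := by
    intro x
    by_cases hx : ‖x‖ < r
    swap
    · exact ⟨0, fun h ↦ (hx h).elim⟩
    have hmem : ∀ t ∈ Icc (0 : ℝ) 1, y₀ + t • x ∈ Metric.ball y₀ r := by
      intro t ht
      rw [Metric.mem_ball, dist_eq_norm, add_sub_cancel_left, norm_smul, Real.norm_eq_abs,
        abs_of_nonneg ht.1]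
      nlinarith [ht.2, ht.1, norm_nonneg x]
    obtain ⟨α, h0, hα⟩ := exists_linear_ode_solution (A := fun t : ℝ ↦ θ (y₀ + t • x) x)
      (by
        refine ContinuousOn.clm_apply ?_ continuousOn_const
        exact hθ.continuousOn.comp (by fun_prop) fun t ht ↦ hbU _ (hmem t ht))
      (fun t ht ↦ by
        calc ‖θ (y₀ + t • x) x‖ ≤ ‖θ (y₀ + t • x)‖ * ‖x‖ := ContinuousLinearMap.le_opNorm _ _
          _ ≤ K * r := by gcongr; exact b1 _ (hmem t ht)
          _ ≤ _ := hKr)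
    exact ⟨α, fun _ ↦ ⟨h0, hα⟩⟩
  choose α hα using hray
  set P : E → 𝔸 := fun y ↦ α (y - y₀) 1 with hP
  have hP0 : P y₀ = 1 := by
    obtain ⟨h0, h1⟩ := hα 0 (by simpa using hr)
    -- On the degenerate ray the coefficient `θ y₀ 0` is zero.
    have : α 0 1 = α 0 0 := constant_of_has_deriv_right_zero
      (fun t ht ↦ (h1 t ht).continuousWithinAt) (fun t ht ↦ by
        have := (h1 t (Ico_subset_Icc_self ht)).mono_of_mem_nhdsWithin (Icc_mem_nhdsGE_of_mem ht)
        simpa using this) 1 (by simp)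
    simp only [hP, sub_self, this, h0]
  have hderiv : ∀ y ∈ Metric.ball y₀ r,
      HasFDerivAt P ((ContinuousLinearMap.mul ℝ 𝔸 (P y)).comp (θ y)) y := by
    intro y hy
    have hy' : ‖y - y₀‖ < r := by rwa [Metric.mem_ball, dist_eq_norm] at hy
    -- The comparison of neighbouring rays is a quadratic error estimate at every point of the ball,
    -- hence differentiability with the prescribed derivative.
    have hO : (fun z ↦ P z - P y * (1 + θ y (z - y))) =O[𝓝 y] fun z ↦ ‖z - y‖ ^ 2 := by
      refine Asymptotics.IsBigO.of_bound
        (‖(1 : 𝔸)‖ * Real.exp 1 * (2 * K + 2 * K ^ 2) * Real.exp 1) ?_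
      filter_upwards [Metric.isOpen_ball.mem_nhds hy] with z hz
      have hz' : ‖z - y₀‖ < r := by rwa [Metric.mem_ball, dist_eq_norm] at hz
      have e : y - y₀ + (z - y) = z - y₀ := by abel
      have := norm_ray_sub_le hr1 hK hKr
        (fun y hy ↦ (hat y (hbU y hy)).differentiableAt (by simp)) b1 b2 b3
        (fun y hy ↦ hflat y (hbU y hy)) hy' (h := z - y) (by rwa [e]) (hα _ hy').1
        (β := α (z - y₀)) (hα _ hz').1 (hα _ hy').2 (by rw [e]; exact (hα _ hz').2)
      rw [add_sub_cancel] at this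
      simpa using this
    have h1 := hO.hasFDerivAt (𝕜 := ℝ) one_lt_two
    have h2 : HasFDerivAt (fun z ↦ P y * (1 + θ y (z - y)))
        ((ContinuousLinearMap.mul ℝ 𝔸 (P y)).comp (θ y)) y := by
      have h3 : HasFDerivAt (fun z ↦ 1 + θ y (z - y)) (θ y) y :=
        ((θ y).hasFDerivAt.comp y ((hasFDerivAt_id y).sub_const y)).const_add 1
      exact (ContinuousLinearMap.mul ℝ 𝔸 (P y)).hasFDerivAt.comp y h3
    have h4 := h1.add h2
    rw [zero_add] at h4
    exact h4.congr_of_eventuallyEq (Eventually.of_forall fun z ↦ by simp)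
  -- Bootstrapping: `dP = P θ` has as many derivatives as `P`, so `P` has one more.
  have hsm : ∀ m : ℕ, ContDiffOn ℝ m P (Metric.ball y₀ r) := by
    intro m
    induction m with
    | zero =>
      exact (contDiffOn_zero (𝕜 := ℝ)).2 fun y hy ↦ (hderiv y hy).continuousAt.continuousWithinAt
    | succ m ih =>
      push_cast
      rw [contDiffOn_succ_iff_fderiv_of_isOpen Metric.isOpen_ball]
      refine ⟨fun y hy ↦ (hderiv y hy).differentiableAt.differentiableWithinAt,
        fun h ↦ (WithTop.coe_ne_top h).elim, ?_⟩
      have h1 : ContDiffOn ℝ m θ (Metric.ball y₀ r) :=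
        (hθ.mono hbU).of_le (by exact_mod_cast le_top)
      have h2 : ContDiffOn ℝ m (fun y ↦ ContinuousLinearMap.mul ℝ 𝔸 (P y)) (Metric.ball y₀ r) :=
        (ContinuousLinearMap.mul ℝ 𝔸).contDiff.comp_contDiffOn ih
      refine (h2.clm_comp h1).congr ?_
      exact fun y hy ↦ (hderiv y hy).fderiv
  have hunit : ∀ᶠ y in 𝓝 y₀, IsUnit (P y) := by
    have hc : ContinuousAt P y₀ := (hderiv y₀ (Metric.mem_ball_self hr)).continuousAt
    exact hc.eventually_mem (Units.isOpen.mem_nhds (by rw [hP0]; exact isUnit_one))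
  obtain ⟨r', hr', hb'⟩ := Metric.mem_nhds_iff.1 hunit
  refine ⟨P, min r r', lt_min hr hr', hP0, fun y hy ↦ ?_⟩
  have hy1 := Metric.ball_subset_ball (min_le_left r r') hy
  exact ⟨(contDiffOn_infty.2 hsm).contDiffAt (Metric.isOpen_ball.mem_nhds hy1), hderiv y hy1,
    hb' (Metric.ball_subset_ball (min_le_right r r') hy)⟩

end FlatSystem

/-! ### The Gauss equation at a point. -/

section Gauss

variable {n : ℕ} {M : Type*} [TopologicalSpace M] [ChartedSpace (EuclideanSpace ℝ (Fin n)) M]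
  [IsManifold (𝓡 n) ∞ M]

/-- The structure equation of a centroaffine immersion at a point. -/
def Data.GaussAt (D : Data n M) (φ : M → Ambient n) (p : M) : Prop :=
  ∀ Y : VField n M, MDifferentiableAt (𝓡 n) (𝓡 n).tangent (T% Y) p →
    ∀ v : TangentSpace (𝓡 n) p,
      mvfderiv (𝓡 n) (fun q ↦ mvfderiv (𝓡 n) φ q (Y q)) p v =
        mvfderiv (𝓡 n) φ p (D.cov Y p v) + D.g p v (Y p) • φ p

/-- For `fY` both sides acquire the same term `df(v) dφ(Y)` by the Leibniz rules. The defect thus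
depends only on `Y p`, and one extension of each tangent vector suffices to check the equation. -/
lemma tensorialAt_gaussDefect (D : Data n M) {φ : M → Ambient n} {p : M}
    (hφ : ContMDiffAt (𝓡 n) 𝓘(ℝ, Ambient n) ∞ φ p) (v : TangentSpace (𝓡 n) p) :
    TensorialAt (𝓡 n) (EuclideanSpace ℝ (Fin n)) (fun Y : VField n M ↦
      mvfderiv (𝓡 n) (fun q ↦ mvfderiv (𝓡 n) φ q (Y q)) p v -
        (mvfderiv (𝓡 n) φ p (D.cov Y p v) + D.g p v (Y p) • φ p)) p where
  smul {f Y} hf hY := by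
    have h1 : mvfderiv (𝓡 n) (fun q ↦ mvfderiv (𝓡 n) φ q ((f • Y) q)) p v =
        mvfderiv (𝓡 n) f p v • mvfderiv (𝓡 n) φ p (Y p) +
        f p • mvfderiv (𝓡 n) (fun q ↦ mvfderiv (𝓡 n) φ q (Y q)) p v := by
      rw [← mvfderiv_smul_apply hf (mdiffAt_mvfderiv_apply hφ hY)]
      simp
    rw [h1, D.cov.isCovariantDerivativeOnUniv.leibniz hY hf]
    simp only [map_add, map_smul, Pi.smul_apply', add_apply, smul_apply,
      ContinuousLinearMap.smulRight_apply, smul_eq_mul]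
    module
  add {Y Y'} hY hY' := by
    have h1 : mvfderiv (𝓡 n) (fun q ↦ mvfderiv (𝓡 n) φ q ((Y + Y') q)) p v =
        mvfderiv (𝓡 n) (fun q ↦ mvfderiv (𝓡 n) φ q (Y q)) p v +
        mvfderiv (𝓡 n) (fun q ↦ mvfderiv (𝓡 n) φ q (Y' q)) p v := by
      rw [← mvfderiv_add_apply (mdiffAt_mvfderiv_apply hφ hY) (mdiffAt_mvfderiv_apply hφ hY')]
      simp
    rw [h1, D.cov.isCovariantDerivativeOnUniv.add hY hY']
    simp only [map_add, Pi.add_apply, add_apply, add_smul]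
    abel

/-- The Gauss equation only has to be checked on fields spanning the tangent space. -/
lemma gaussAt_of_span {D : Data n M} {φ : M → Ambient n} {p : M}
    (hφ : ContMDiffAt (𝓡 n) 𝓘(ℝ, Ambient n) ∞ φ p)
    (h : ∀ w v : TangentSpace (𝓡 n) p, ∃ Y : VField n M,
      MDifferentiableAt (𝓡 n) (𝓡 n).tangent (T% Y) p ∧ Y p = w ∧
      mvfderiv (𝓡 n) (fun q ↦ mvfderiv (𝓡 n) φ q (Y q)) p v =
        mvfderiv (𝓡 n) φ p (D.cov Y p v) + D.g p v (Y p) • φ p) : D.GaussAt φ p := by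
  intro Y hY v
  obtain ⟨Y', hY', h1, h2⟩ := h (Y p) v
  rw [← sub_eq_zero]
  exact ((tensorialAt_gaussDefect D hφ v).pointwise hY hY' h1.symm).trans (sub_eq_zero.2 h2)

lemma Data.IsInducedBy.gaussAt [T2Space M] {D : Data n M} {φ : M → Ambient n}
    (h : D.IsInducedBy φ) (p : M) : D.GaussAt φ p := by
  refine gaussAt_of_span h.immersion.1.1.contMDiffAt fun w v ↦ ?_
  obtain ⟨Y, hY, hw⟩ := exists_smoothField (n := n) w
  obtain ⟨X, hX, rfl⟩ := exists_smoothField (n := n) v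
  exact ⟨Y, hY.mdiffAt p, hw, h.gauss X Y hX hY p⟩

lemma Data.GaussAt.congr {D : Data n M} {φ ψ : M → Ambient n} {p : M} (h : D.GaussAt φ p)
    (he : ∀ᶠ q in 𝓝 p, ψ q = φ q) : D.GaussAt ψ p := by
  intro Y hY v
  have h1 : ∀ᶠ q in 𝓝 p, mvfderiv (𝓡 n) ψ q (Y q) = mvfderiv (𝓡 n) φ q (Y q) := by
    filter_upwards [he.eventually_nhds] with q hq
    rw [mvfderiv_congr hq]
  rw [mvfderiv_congr h1, mvfderiv_congr he, he.self_of_nhds, h Y hY v]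

lemma Data.GaussAt.clm_comp {D : Data n M} {φ : M → Ambient n} {p : M} (h : D.GaussAt φ p)
    (hφ : ContMDiffAt (𝓡 n) 𝓘(ℝ, Ambient n) ∞ φ p)
    (A : Ambient n →L[ℝ] Ambient n) : D.GaussAt (fun q ↦ A (φ q)) p := by
  intro Y hY v
  have h1 : ∀ᶠ q in 𝓝 p, mvfderiv (𝓡 n) (fun q ↦ A (φ q)) q (Y q) =
      A (mvfderiv (𝓡 n) φ q (Y q)) := by
    have h1 : ContMDiffAt (𝓡 n) 𝓘(ℝ, Ambient n) 1 φ p := hφ.of_le (by norm_cast)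
    filter_upwards [(contMDiffAt_iff_contMDiffAt_nhds (by simp)).1 h1] with q hq
    rw [mvfderiv_clm_comp A (hq.mdifferentiableAt (by simp))]
  rw [mvfderiv_congr h1, mvfderiv_clm_comp A (mdiffAt_mvfderiv_apply hφ hY), h Y hY v,
    mvfderiv_clm_comp A (mdiffAt_of_smooth hφ), map_add, map_smul]

end Gauss

/-! ### Splitting ambient vectors into radial and tangential parts. -/

section Decomposition

variable {n : ℕ} {M : Type*} [TopologicalSpace M] [ChartedSpace (EuclideanSpace ℝ (Fin n)) M]

/-- The linear map `(f, v) ↦ f φ + dφ v`. -/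
def framing (φ : M → Ambient n) (p : M) : ℝ × EuclideanSpace ℝ (Fin n) →ₗ[ℝ] Ambient n where
  toFun z := z.1 • φ p + mvfderiv (𝓡 n) φ p (z.2 : EuclideanSpace ℝ (Fin n))
  map_add' z w := by
    rw [Prod.fst_add, Prod.snd_add, add_smul]
    erw [map_add]
    abel
  map_smul' r z := by
    rw [Prod.smul_fst, Prod.smul_snd]
    erw [map_smul]
    simp only [smul_eq_mul, RingHom.id_apply, smul_add, mul_smul]

lemma framing_apply (φ : M → Ambient n) (p : M) (f : ℝ) (v : TangentSpace (𝓡 n) p) :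
    framing φ p (f, v) = f • φ p + mvfderiv (𝓡 n) φ p v := rfl

/-- The position vector is transversal to an immersion at `p`. -/
def TransversalAt (φ : M → Ambient n) (p : M) : Prop := Function.Injective (framing φ p)

lemma finrank_ambient : Module.finrank ℝ (ℝ × EuclideanSpace ℝ (Fin n)) =
    Module.finrank ℝ (Ambient n) := by
  simp [add_comm]

lemma transversalAt_iff {φ : M → Ambient n} {p : M} : TransversalAt φ p ↔
    Function.Injective (mvfderiv (𝓡 n) φ p) ∧ φ p ∉ Set.range (mvfderiv (𝓡 n) φ p) := by
  constructor
  · intro h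
    refine ⟨fun v w hvw ↦ ?_, ?_⟩
    · have : framing φ p (0, v) = framing φ p (0, w) := by
        rw [framing_apply, framing_apply, hvw]
      exact congrArg Prod.snd (h this)
    · rintro ⟨v, hv⟩
      have : framing φ p (1, 0) = framing φ p (0, v) := by
        change (1 : ℝ) • φ p + mvfderiv (𝓡 n) φ p (0 : TangentSpace (𝓡 n) p) =
          (0 : ℝ) • φ p + mvfderiv (𝓡 n) φ p v
        rw [hv, map_zero]
        simp
      exact one_ne_zero (congrArg Prod.fst (h this))
  · rintro ⟨h1, h2⟩
    refine (injective_iff_map_eq_zero _).2 ?_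
    rintro ⟨f, v⟩ hz
    change f • φ p + mvfderiv (𝓡 n) φ p v = 0 at hz
    have hf : f = 0 := by
      by_contra hf
      refine h2 ⟨-f⁻¹ • v, ?_⟩
      erw [map_smul]
      rw [eq_neg_of_add_eq_zero_right hz, smul_neg, neg_smul, neg_neg, inv_smul_smul₀ hf]
    rw [hf, zero_smul, zero_add] at hz
    have hv : v = 0 := h1 (hz.trans (map_zero _).symm)
    rw [hf, hv]; rfl

lemma isCentroaffineImmersion_iff {φ : M → Ambient n} : IsCentroaffineImmersion φ ↔
    ContMDiff (𝓡 n) 𝓘(ℝ, Ambient n) ∞ φ ∧ ∀ p, TransversalAt φ p := by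
  simp only [IsCentroaffineImmersion, IsHypersurfaceImmersion, transversalAt_iff, forall_and,
    and_assoc]

/-- The splitting of the ambient space in its radial and tangential parts. -/
def TransversalAt.decomp {φ : M → Ambient n} {p : M} (h : TransversalAt φ p) :
    Ambient n ≃ₗ[ℝ] ℝ × EuclideanSpace ℝ (Fin n) :=
  ((framing φ p).linearEquivOfInjective h finrank_ambient).symm

namespace TransversalAt

variable {φ : M → Ambient n} {p : M} (h : TransversalAt φ p)

/-- The coefficient of the position vector. -/
def radial (a : Ambient n) : ℝ := (h.decomp a).1

/-- The tangential component. -/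
def tangential (a : Ambient n) : TangentSpace (𝓡 n) p := (h.decomp a).2

lemma framing_decomp (a : Ambient n) : framing φ p (h.decomp a) = a :=
  ((framing φ p).linearEquivOfInjective h finrank_ambient).apply_symm_apply a

lemma decomp_framing (z : ℝ × EuclideanSpace ℝ (Fin n)) : h.decomp (framing φ p z) = z :=
  ((framing φ p).linearEquivOfInjective h finrank_ambient).symm_apply_apply z

lemma radial_tangential (a : Ambient n) :
    h.radial a • φ p + mvfderiv (𝓡 n) φ p (h.tangential a) = a := h.framing_decomp a

lemma radial_eq (f : ℝ) (v : TangentSpace (𝓡 n) p) :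
    h.radial (f • φ p + mvfderiv (𝓡 n) φ p v) = f :=
  congrArg Prod.fst (h.decomp_framing (f, v))

lemma tangential_eq (f : ℝ) (v : TangentSpace (𝓡 n) p) :
    h.tangential (f • φ p + mvfderiv (𝓡 n) φ p v) = v :=
  congrArg Prod.snd (h.decomp_framing (f, v))

lemma radial_add (a b : Ambient n) : h.radial (a + b) = h.radial a + h.radial b := by
  simp [radial]

lemma tangential_add (a b : Ambient n) :
    h.tangential (a + b) = h.tangential a + h.tangential b :=
  congrArg Prod.snd (map_add h.decomp a b)

lemma radial_smul (r : ℝ) (a : Ambient n) : h.radial (r • a) = r * h.radial a := by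
  simp [radial]

lemma tangential_smul (r : ℝ) (a : Ambient n) : h.tangential (r • a) = r • h.tangential a :=
  congrArg Prod.snd (map_smul h.decomp r a)

lemma unique (h : TransversalAt φ p) {f f' : ℝ} {v v' : TangentSpace (𝓡 n) p}
    (e : f • φ p + mvfderiv (𝓡 n) φ p v = f' • φ p + mvfderiv (𝓡 n) φ p v') :
    f = f' ∧ v = v' :=
  ⟨by rw [← h.radial_eq f v, e, h.radial_eq], by rw [← h.tangential_eq f v, e, h.tangential_eq]⟩

end TransversalAt

variable [IsManifold (𝓡 n) ∞ M]

/-- The framing in the coordinates of a chart. -/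
def coordFraming (F : EuclideanSpace ℝ (Fin n) → Ambient n) (y : EuclideanSpace ℝ (Fin n)) :
    ℝ × EuclideanSpace ℝ (Fin n) →L[ℝ] Ambient n :=
  (ContinuousLinearMap.fst ℝ ℝ (EuclideanSpace ℝ (Fin n))).smulRight (F y) +
    (fderiv ℝ F y).comp (ContinuousLinearMap.snd ℝ ℝ (EuclideanSpace ℝ (Fin n)))

lemma contDiffAt_coordFraming {F : EuclideanSpace ℝ (Fin n) → Ambient n}
    {y : EuclideanSpace ℝ (Fin n)} (hF : ContDiffAt ℝ ∞ F y) :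
    ContDiffAt ℝ ∞ (coordFraming F) y := by
  refine ContDiffAt.add ?_ ((hF.fderiv_right (m := ∞) (by simp)).clm_comp contDiffAt_const)
  exact contDiffAt_const.smulRight hF

namespace CoordFrame

variable {p₀ : M} (Φ : CoordFrame (n := n) p₀)

/-- The framing with respect to the coordinate fields. -/
def framing (_Φ : CoordFrame (n := n) p₀) (φ : M → Ambient n) (q : M) :
    ℝ × EuclideanSpace ℝ (Fin n) →L[ℝ] Ambient n :=
  coordFraming (fun y ↦ φ ((extChartAt (𝓡 n) p₀).symm y)) (extChartAt (𝓡 n) p₀ q)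

lemma framing_apply {φ : M → Ambient n} {q : M} (hq : q ∈ Φ.dom)
    (hφ : MDifferentiableAt (𝓡 n) 𝓘(ℝ, Ambient n) φ q) (z : ℝ × EuclideanSpace ℝ (Fin n)) :
    Φ.framing φ q z = z.1 • φ q + mvfderiv (𝓡 n) φ q (Φ.field z.2 q) := by
  rw [Φ.mvfderiv_field hq hφ]
  simp only [framing, coordFraming, (extChartAt (𝓡 n) p₀).left_inv (Φ.source_of_mem hq)]
  rfl

lemma smoothAt_framing {φ : M → Ambient n} {q : M} (hq : q ∈ Φ.dom)
    (hφ : ContMDiffAt (𝓡 n) 𝓘(ℝ, Ambient n) ∞ φ q) :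
    ContMDiffAt (𝓡 n) 𝓘(ℝ, ℝ × EuclideanSpace ℝ (Fin n) →L[ℝ] Ambient n) ∞ (Φ.framing φ) q :=
  (contDiffAt_coordFraming (Φ.contDiffAt_comp_symm hq hφ)).contMDiffAt.comp q (Φ.smoothAt_chart hq)

/-- The framing as an isomorphism. -/
def framingEquiv {φ : M → Ambient n} {q : M} (hq : q ∈ Φ.dom)
    (hφ : MDifferentiableAt (𝓡 n) 𝓘(ℝ, Ambient n) φ q) (h : TransversalAt φ q) :
    (ℝ × EuclideanSpace ℝ (Fin n)) ≃L[ℝ] Ambient n :=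
  ContinuousLinearEquiv.equivOfInverse (Φ.framing φ q)
    (LinearMap.toContinuousLinearMap
      ((LinearMap.id.prodMap (mvfderiv (𝓡 n) (extChartAt (𝓡 n) p₀) q).toLinearMap).comp
        h.decomp.toLinearMap))
    (fun z ↦ by
      rw [Φ.framing_apply hq hφ]
      have := h.decomp_framing (z.1, Φ.field z.2 q)
      rw [Centroaffine.framing_apply] at this
      refine (congrArg (fun w : ℝ × EuclideanSpace ℝ (Fin n) ↦
        (w.1, mvfderiv (𝓡 n) (extChartAt (𝓡 n) p₀) q w.2)) this).trans ?_
      exact Prod.ext rfl (Φ.coord_field q hq z.2))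
    (fun a ↦ by
      rw [Φ.framing_apply hq hφ]
      have := Φ.field_coord q hq (h.tangential a)
      exact (congrArg (fun v : TangentSpace (𝓡 n) q ↦
        h.radial a • φ q + mvfderiv (𝓡 n) φ q v) this).trans (h.radial_tangential a))

end CoordFrame

variable [T2Space M]

/-- In a coordinate frame the two parts are obtained by applying the inverse of the framing, and
inversion of operators is smooth at an isomorphism. -/
lemma smoothAt_decomp {φ V : M → Ambient n} {p : M} (hT : ∀ q, TransversalAt φ q)
    (hφ : ContMDiff (𝓡 n) 𝓘(ℝ, Ambient n) ∞ φ)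
    (hV : ContMDiffAt (𝓡 n) 𝓘(ℝ, Ambient n) ∞ V p) :
    ContMDiffAt (𝓡 n) 𝓘(ℝ, ℝ) ∞ (fun q ↦ (hT q).radial (V q)) p ∧
      ContMDiffAt (𝓡 n) (𝓡 n).tangent ∞ (T% (fun q ↦ (hT q).tangential (V q))) p := by
  obtain ⟨Φ⟩ := exists_coordFrame (n := n) p
  have hd : ∀ q, MDifferentiableAt (𝓡 n) 𝓘(ℝ, Ambient n) φ q := fun q ↦ mdiffAt_of_smooth (hφ q)
  have h1 : ContMDiffAt (𝓡 n) 𝓘(ℝ, ℝ × EuclideanSpace ℝ (Fin n)) ∞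
      (fun q ↦ (Φ.framing φ q).inverse (V q)) p := by
    refine ContMDiffAt.clm_apply ?_ hV
    refine ContMDiffAt.comp p (ContDiffAt.contMDiffAt
      (f := ContinuousLinearMap.inverse (R := ℝ) (M := ℝ × EuclideanSpace ℝ (Fin n))
        (M₂ := Ambient n)) ?_)
      (Φ.smoothAt_framing Φ.mem_dom (hφ p))
    exact contDiffAt_map_inverse (Φ.framingEquiv Φ.mem_dom (hd p) (hT p))
  have h2 : ∀ᶠ q in 𝓝 p, ((hT q).radial (V q),
      mvfderiv (𝓡 n) (extChartAt (𝓡 n) p) q ((hT q).tangential (V q))) =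
        (Φ.framing φ q).inverse (V q) := by
    filter_upwards [Φ.isOpen_dom.mem_nhds Φ.mem_dom] with q hq
    have : Φ.framing φ q = (Φ.framingEquiv hq (hd q) (hT q) : _ →L[ℝ] _) := rfl
    rw [this, ContinuousLinearMap.inverse_equiv]
    rfl
  have h3 := h1.congr_of_eventuallyEq h2
  have h4 := (ContinuousLinearMap.fst ℝ ℝ (EuclideanSpace ℝ (Fin n))).contMDiff (n := ∞)
    |>.contMDiffAt.comp p h3
  have h5 := (ContinuousLinearMap.snd ℝ ℝ (EuclideanSpace ℝ (Fin n))).contMDiff (n := ∞)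
    |>.contMDiffAt.comp p h3
  exact ⟨h4, Φ.smoothAt_of_coord Φ.mem_dom h5⟩

end Decomposition

/-! ### The connection form of the structure equations in a coordinate frame. -/

section ConnectionForm

variable {n : ℕ} {M : Type*} [TopologicalSpace M] [ChartedSpace (EuclideanSpace ℝ (Fin n)) M]
  [IsManifold (𝓡 n) ∞ M]

namespace Data

variable (D : Data n M)

lemma isSmoothField_nabla {X Y : VField n M} (hX : IsSmoothField X) (hY : IsSmoothField Y) :
    IsSmoothField (D.nabla X Y) := by
  have h := D.smooth_cov.contMDiff.contMDiff (σ := Y)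
    (ContMDiff.contMDiffOn (ContMDiff.of_le hY (by simp)))
  exact ContMDiff.clm_bundle_apply (n := ∞) (B := M)
    (E₁ := (TangentSpace (𝓡 n) : M → Type _)) (E₂ := (TangentSpace (𝓡 n) : M → Type _))
    (ϕ := fun p ↦ D.cov Y p) (v := X) (b := id)
    (contMDiffOn_univ.1 h) hX

lemma cov_add {Y Z : VField n M} {p : M}
    (hY : MDifferentiableAt (𝓡 n) (𝓡 n).tangent (T% Y) p)
    (hZ : MDifferentiableAt (𝓡 n) (𝓡 n).tangent (T% Z) p) (v : TangentSpace (𝓡 n) p) :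
    D.cov (Y + Z) p v = D.cov Y p v + D.cov Z p v := by
  rw [D.cov.isCovariantDerivativeOnUniv.add hY hZ]; rfl

lemma cov_smul_const (r : ℝ) {Y : VField n M} {p : M}
    (hY : MDifferentiableAt (𝓡 n) (𝓡 n).tangent (T% Y) p) (v : TangentSpace (𝓡 n) p) :
    D.cov (r • Y) p v = r • D.cov Y p v := by
  rw [D.cov.isCovariantDerivativeOnUniv.smul_const r hY]; rfl

lemma cov_smul {f : M → ℝ} {Y : VField n M} {p : M}
    (hf : MDifferentiableAt (𝓡 n) 𝓘(ℝ, ℝ) f p)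
    (hY : MDifferentiableAt (𝓡 n) (𝓡 n).tangent (T% Y) p) (v : TangentSpace (𝓡 n) p) :
    D.cov (f • Y) p v = f p • D.cov Y p v + mvfderiv (𝓡 n) f p v • Y p := by
  rw [D.cov.isCovariantDerivativeOnUniv.leibniz hY hf]; rfl

end Data

namespace CoordFrame

variable {p₀ : M} (Φ : CoordFrame (n := n) p₀) (D : Data n M)

/-- The matrix of the structure equations in the coordinate frame. -/
def connForm (q : M) : EuclideanSpace ℝ (Fin n) →L[ℝ] (ℝ × EuclideanSpace ℝ (Fin n)) →L[ℝ]
    (ℝ × EuclideanSpace ℝ (Fin n)) :=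
  LinearMap.toContinuousBilinearMap <| LinearMap.mk₂ ℝ
    (fun v z ↦ (D.g q (Φ.field v q) (Φ.field z.2 q),
      z.1 • v + mvfderiv (𝓡 n) (extChartAt (𝓡 n) p₀) q (D.cov (Φ.field z.2) q (Φ.field v q))))
    (fun v w z ↦ by
      ext1
      · simp
      · simp only [map_add, Pi.add_apply, smul_add, Prod.mk_add_mk]; abel)
    (fun r v z ↦ by
      ext1
      · simp
      · simp only [map_smul, Pi.smul_apply, smul_comm z.1 r, Prod.smul_mk, smul_add])
    (fun v z w ↦ by
      ext1
      · simp
      · simp only [Prod.fst_add, Prod.snd_add, map_add, add_smul, Prod.mk_add_mk,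
          D.cov_add ((Φ.smooth z.2).mdiffAt q) ((Φ.smooth w.2).mdiffAt q)]
        abel)
    (fun r v z ↦ by
      ext1
      · simp
      · simp only [Prod.smul_fst, Prod.smul_snd, map_smul, Prod.smul_mk, smul_add, smul_eq_mul,
          mul_smul, D.cov_smul_const r ((Φ.smooth z.2).mdiffAt q)])

lemma connForm_apply (q : M) (v : EuclideanSpace ℝ (Fin n))
    (z : ℝ × EuclideanSpace ℝ (Fin n)) : Φ.connForm D q v z =
      (D.g q (Φ.field v q) (Φ.field z.2 q), z.1 • v +
        mvfderiv (𝓡 n) (extChartAt (𝓡 n) p₀) q (D.cov (Φ.field z.2) q (Φ.field v q))) := rfl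

lemma smoothAt_connForm_apply {q : M} (hq : q ∈ Φ.dom) (v : EuclideanSpace ℝ (Fin n))
    (z : ℝ × EuclideanSpace ℝ (Fin n)) :
    ContMDiffAt (𝓡 n) 𝓘(ℝ, ℝ × EuclideanSpace ℝ (Fin n)) ∞ (fun q ↦ Φ.connForm D q v z) q := by
  refine ContMDiffAt.prodMk_space (D.smooth_g _ _ (Φ.smooth v) (Φ.smooth z.2) q) ?_
  exact contMDiffAt_const.add (smoothAt_mvfderiv_apply (Φ.smoothAt_chart hq)
    ((D.isSmoothField_nabla (Φ.smooth v) (Φ.smooth z.2)).contMDiffAt q))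

/-- Covariant derivatives in coordinates. -/
lemma coord_cov {q : M} (hq : q ∈ Φ.dom) {Y : VField n M}
    (hY : MDifferentiableAt (𝓡 n) (𝓡 n).tangent (T% Y) q) (v : TangentSpace (𝓡 n) q) :
    mvfderiv (𝓡 n) (extChartAt (𝓡 n) p₀) q (D.cov Y q v) =
      mvfderiv (𝓡 n) (fun r ↦ mvfderiv (𝓡 n) (extChartAt (𝓡 n) p₀) r (Y r)) q v +
      mvfderiv (𝓡 n) (extChartAt (𝓡 n) p₀) q
        (D.cov (Φ.field (mvfderiv (𝓡 n) (extChartAt (𝓡 n) p₀) q (Y q))) q v) := by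
  have hx := Φ.smoothAt_chart hq
  have ht : TensorialAt (𝓡 n) (EuclideanSpace ℝ (Fin n)) (fun Y : VField n M ↦
      mvfderiv (𝓡 n) (extChartAt (𝓡 n) p₀) q (D.cov Y q v) -
      mvfderiv (𝓡 n) (fun r ↦ mvfderiv (𝓡 n) (extChartAt (𝓡 n) p₀) r (Y r)) q v) q :=
    { smul := fun {f Y} hf hY ↦ by
        have h1 : mvfderiv (𝓡 n) (fun r ↦ mvfderiv (𝓡 n) (extChartAt (𝓡 n) p₀) r ((f • Y) r)) q v =
            mvfderiv (𝓡 n) f q v • mvfderiv (𝓡 n) (extChartAt (𝓡 n) p₀) q (Y q) +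
            f q • mvfderiv (𝓡 n) (fun r ↦ mvfderiv (𝓡 n) (extChartAt (𝓡 n) p₀) r (Y r)) q v := by
          rw [← mvfderiv_smul_apply hf (mdiffAt_mvfderiv_apply hx hY)]
          simp
        rw [h1, D.cov_smul hf hY, map_add, map_smul, map_smul]
        module
      add := fun {Y Y'} hY hY' ↦ by
        have h1 : mvfderiv (𝓡 n) (fun r ↦ mvfderiv (𝓡 n) (extChartAt (𝓡 n) p₀) r ((Y + Y') r)) q v =
            mvfderiv (𝓡 n) (fun r ↦ mvfderiv (𝓡 n) (extChartAt (𝓡 n) p₀) r (Y r)) q v +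
            mvfderiv (𝓡 n) (fun r ↦ mvfderiv (𝓡 n) (extChartAt (𝓡 n) p₀) r (Y' r)) q v := by
          rw [← mvfderiv_add_apply (mdiffAt_mvfderiv_apply hx hY) (mdiffAt_mvfderiv_apply hx hY')]
          simp
        rw [h1, D.cov_add hY hY', map_add]
        abel }
  set c := mvfderiv (𝓡 n) (extChartAt (𝓡 n) p₀) q (Y q)
  have h := ht.pointwise hY ((Φ.smooth c).mdiffAt q) (Φ.field_coord q hq (Y q)).symm
  have h0 : mvfderiv (𝓡 n) (fun r ↦ mvfderiv (𝓡 n) (extChartAt (𝓡 n) p₀) r (Φ.field c r)) q v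
      = 0 := by
    rw [mvfderiv_congr (G := fun _ ↦ c)]
    · simp [mvfderiv]
    · filter_upwards [Φ.isOpen_dom.mem_nhds hq] with r hr using Φ.coord_field r hr c
  beta_reduce at h
  rw [h0, sub_zero] at h
  rw [← h]; abel

/-- The structure equations for the framing of a solution of the Gauss equation. -/
lemma mvfderiv_framing {φ : M → Ambient n} {q : M} (hq : q ∈ Φ.dom)
    (hφ : ContMDiffAt (𝓡 n) 𝓘(ℝ, Ambient n) ∞ φ q) (hG : D.GaussAt φ q)
    (v : EuclideanSpace ℝ (Fin n)) (z : ℝ × EuclideanSpace ℝ (Fin n)) :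
    mvfderiv (𝓡 n) (fun r ↦ Φ.framing φ r z) q (Φ.field v q) =
      Φ.framing φ q (Φ.connForm D q v z) := by
  have hd := mdiffAt_of_smooth hφ
  have h1 : ∀ᶠ r in 𝓝 q, Φ.framing φ r z = z.1 • φ r + mvfderiv (𝓡 n) φ r (Φ.field z.2 r) := by
    have h1 : ContMDiffAt (𝓡 n) 𝓘(ℝ, Ambient n) 1 φ q := hφ.of_le (by norm_cast)
    filter_upwards [Φ.isOpen_dom.mem_nhds hq, (contMDiffAt_iff_contMDiffAt_nhds (by simp)).1 h1]
      with r hr hr' using Φ.framing_apply hr (hr'.mdifferentiableAt (by simp)) z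
  have h2 := mdiffAt_mvfderiv_apply hφ ((Φ.smooth z.2).mdiffAt q)
  rw [mvfderiv_congr h1, mvfderiv_add_apply (mdiffAt_smul mdifferentiableAt_const hd) h2,
    mvfderiv_smul_apply mdifferentiableAt_const hd, hG _ ((Φ.smooth z.2).mdiffAt q),
    Φ.framing_apply hq hd, Φ.connForm_apply]
  have h0 : mvfderiv (𝓡 n) (fun _ : M ↦ z.1) q (Φ.field v q) = 0 := by simp [mvfderiv]
  simp only [h0, zero_smul, zero_add, map_add, map_smul, Pi.add_apply, Pi.smul_apply]
  rw [Φ.field_coord q hq]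
  abel

end CoordFrame

end ConnectionForm

/-! ### Flatness of the connection form, and local solutions. -/

section LocalSolutions

variable {n : ℕ} {M : Type*} [TopologicalSpace M] [ChartedSpace (EuclideanSpace ℝ (Fin n)) M]
  [IsManifold (𝓡 n) ∞ M]

namespace CoordFrame

variable {p₀ : M} (Φ : CoordFrame (n := n) p₀) {D : Data n M}

/-- The domain of the frame in the chart. -/
def coordDom : Set (EuclideanSpace ℝ (Fin n)) :=
  (extChartAt (𝓡 n) p₀).target ∩ (extChartAt (𝓡 n) p₀).symm ⁻¹' Φ.dom

lemma isOpen_coordDom : IsOpen Φ.coordDom :=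
  (continuousOn_extChartAt_symm p₀).isOpen_inter_preimage (isOpen_extChartAt_target p₀)
    Φ.isOpen_dom

lemma mem_coordDom {q : M} (hq : q ∈ Φ.dom) : extChartAt (𝓡 n) p₀ q ∈ Φ.coordDom :=
  ⟨(extChartAt (𝓡 n) p₀).map_source (Φ.source_of_mem hq), by
    rwa [mem_preimage, (extChartAt (𝓡 n) p₀).left_inv (Φ.source_of_mem hq)]⟩

lemma exists_of_mem_coordDom {y : EuclideanSpace ℝ (Fin n)} (hy : y ∈ Φ.coordDom) :
    ∃ q ∈ Φ.dom, extChartAt (𝓡 n) p₀ q = y :=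
  ⟨_, hy.2, (extChartAt (𝓡 n) p₀).right_inv hy.1⟩

variable (D) in
/-- The connection form as a function of the coordinates. -/
def coordForm (y : EuclideanSpace ℝ (Fin n)) : EuclideanSpace ℝ (Fin n) →L[ℝ]
    (ℝ × EuclideanSpace ℝ (Fin n)) →L[ℝ] (ℝ × EuclideanSpace ℝ (Fin n)) :=
  Φ.connForm D ((extChartAt (𝓡 n) p₀).symm y)

lemma contDiffOn_coordForm : ContDiffOn ℝ ∞ (Φ.coordForm D) Φ.coordDom := by
  rw [contDiffOn_clm_apply]
  intro v
  rw [contDiffOn_clm_apply]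
  intro z y hy
  obtain ⟨q, hq, rfl⟩ := Φ.exists_of_mem_coordDom hy
  exact (Φ.contDiffAt_comp_symm hq (Φ.smoothAt_connForm_apply D hq v z)).contDiffWithinAt

lemma fderiv_coordForm {q : M} (hq : q ∈ Φ.dom) (v w : EuclideanSpace ℝ (Fin n))
    (z : ℝ × EuclideanSpace ℝ (Fin n)) :
    fderiv ℝ (Φ.coordForm D) (extChartAt (𝓡 n) p₀ q) v w z =
      mvfderiv (𝓡 n) (fun r ↦ Φ.connForm D r w z) q (Φ.field v q) := by
  rw [Φ.mvfderiv_field hq (mdiffAt_of_smooth (Φ.smoothAt_connForm_apply D hq w z))]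
  have hd : DifferentiableAt ℝ (Φ.coordForm D) (extChartAt (𝓡 n) p₀ q) :=
    (Φ.contDiffOn_coordForm.contDiffAt (Φ.isOpen_coordDom.mem_nhds (Φ.mem_coordDom hq))
      ).differentiableAt (by simp)
  have e := (hd.hasFDerivAt.clm_apply (hasFDerivAt_const w _)).clm_apply (hasFDerivAt_const z _)
  have e2 := e.fderiv
  have := congrArg (fun L ↦ L v) e2
  simpa [coordForm] using this.symm

/-- The radial component is the symmetry of `∇g` in its first two slots, and the tangential
component is the curvature equation. Vanishing torsion and the symmetry of `g` dispose of the other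
terms. -/
lemma coordForm_flat [T2Space M] (hD : D.IsCentroaffine) {y : EuclideanSpace ℝ (Fin n)}
    (hy : y ∈ Φ.coordDom) (v w : EuclideanSpace ℝ (Fin n)) :
    Φ.coordForm D y v * Φ.coordForm D y w - Φ.coordForm D y w * Φ.coordForm D y v
      + fderiv ℝ (Φ.coordForm D) y v w - fderiv ℝ (Φ.coordForm D) y w v = 0 := by
  obtain ⟨q, hq, rfl⟩ := Φ.exists_of_mem_coordDom hy
  refine ContinuousLinearMap.ext fun z ↦ ?_
  have e : Φ.coordForm D (extChartAt (𝓡 n) p₀ q) = Φ.connForm D q := by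
    rw [coordForm, (extChartAt (𝓡 n) p₀).left_inv (Φ.source_of_mem hq)]
  have htor : ∀ v w, D.cov (Φ.field w) q (Φ.field v q) = D.cov (Φ.field v) q (Φ.field w q) := by
    intro v w
    have := D.cov.torsion_eq_zero_iff.1 hD.torsionFree ((Φ.smooth v).mdiffAt q)
      ((Φ.smooth w).mdiffAt q)
    rwa [Φ.mlieBracket_field hq, sub_eq_zero] at this
  set f := z.1
  set c := z.2
  have hsm := D.isSmoothField_nabla (Φ.smooth v) (Φ.smooth c)
  have hsm' := D.isSmoothField_nabla (Φ.smooth w) (Φ.smooth c)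
  have hder : ∀ v w, mvfderiv (𝓡 n) (fun r ↦ Φ.connForm D r w z) q (Φ.field v q) =
      (D.cubic (Φ.field v) (Φ.field w) (Φ.field c) q
        + D.g q (D.cov (Φ.field w) q (Φ.field v q)) (Φ.field c q)
        + D.g q (Φ.field w q) (D.cov (Φ.field c) q (Φ.field v q)),
      mvfderiv (𝓡 n) (fun r ↦ mvfderiv (𝓡 n) (extChartAt (𝓡 n) p₀) r
        (D.nabla (Φ.field w) (Φ.field c) r)) q (Φ.field v q)) := by
    intro v w
    have hs := smoothAt_mvfderiv_apply (Φ.smoothAt_chart hq)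
      ((D.isSmoothField_nabla (Φ.smooth w) (Φ.smooth c)).contMDiffAt q)
    have h := mvfderiv_prodMk (mdiffAt_of_smooth (D.smooth_g _ _ (Φ.smooth w) (Φ.smooth c) q))
      (mdiffAt_of_smooth (contMDiffAt_const (c := f • w) |>.add hs)) (Φ.field v q)
    refine h.trans (Prod.ext ?_ ?_)
    · simp only [Data.cubic]
      rw [sub_sub, add_assoc]
      exact (sub_add_cancel _ _).symm
    · refine (mvfderiv_add_apply mdifferentiableAt_const (mdiffAt_of_smooth hs) _).trans ?_
      have h0 : mvfderiv (𝓡 n) (fun _ : M ↦ f • w) q (Φ.field v q) = 0 := by simp [mvfderiv]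
      rw [h0, zero_add]
  have hcomp : ∀ v w, Φ.connForm D q v (Φ.connForm D q w z) =
      (f * D.g q (Φ.field v q) (Φ.field w q)
        + D.g q (Φ.field v q) (D.cov (Φ.field c) q (Φ.field w q)),
        D.g q (Φ.field w q) (Φ.field c q) • v
        + (f • mvfderiv (𝓡 n) (extChartAt (𝓡 n) p₀) q (D.cov (Φ.field w) q (Φ.field v q))
        + mvfderiv (𝓡 n) (extChartAt (𝓡 n) p₀) q (D.cov (Φ.field (mvfderiv (𝓡 n)
          (extChartAt (𝓡 n) p₀) q (D.cov (Φ.field c) q (Φ.field w q)))) q (Φ.field v q)))) := by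
    intro v w
    rw [Φ.connForm_apply D q w z, Φ.connForm_apply D q v]
    refine Prod.ext ?_ ?_
    · simp only [map_add, map_smul, Pi.add_apply, Pi.smul_apply]
      rw [Φ.field_coord q hq, smul_eq_mul]
    · simp only [map_add, map_smul]
      rw [D.cov_add, D.cov_smul_const f ((Φ.smooth w).mdiffAt q), map_add, map_smul]
      · have := (Φ.smooth (f • w)).mdiffAt q
        rwa [map_smul] at this
      · exact (Φ.smooth _).mdiffAt q
  have hcoord := fun v w ↦ Φ.coord_cov D hq
    ((D.isSmoothField_nabla (Φ.smooth w) (Φ.smooth c)).mdiffAt q) (Φ.field v q)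
  have hR := congrArg (mvfderiv (𝓡 n) (extChartAt (𝓡 n) p₀) q)
    (hD.curvature_eq _ _ _ (Φ.smooth v) (Φ.smooth w) (Φ.smooth c) q)
  have hC := (hD.cubic_symm _ _ _ (Φ.smooth v) (Φ.smooth w) (Φ.smooth c) q).1
  simp only [Data.curvature, map_sub, map_neg, map_smul, Φ.coord_field q hq] at hR
  have hb : D.nabla (VectorField.mlieBracket (𝓡 n) (Φ.field v) (Φ.field w)) (Φ.field c) q = 0 := by
    simp only [Data.nabla, Φ.mlieBracket_field hq, map_zero]
  rw [hb, map_zero, sub_zero] at hR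
  change mvfderiv (𝓡 n) (extChartAt (𝓡 n) p₀) q (D.cov (D.nabla (Φ.field w) (Φ.field c)) q
    (Φ.field v q)) - mvfderiv (𝓡 n) (extChartAt (𝓡 n) p₀) q
    (D.cov (D.nabla (Φ.field v) (Φ.field c)) q (Φ.field w q)) = _ at hR
  rw [hcoord v w, hcoord w v] at hR
  simp only [Data.nabla] at hR
  change Φ.coordForm D (extChartAt (𝓡 n) p₀ q) v (Φ.coordForm D (extChartAt (𝓡 n) p₀ q) w z)
    - Φ.coordForm D (extChartAt (𝓡 n) p₀ q) w (Φ.coordForm D (extChartAt (𝓡 n) p₀ q) v z)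
    + fderiv ℝ (Φ.coordForm D) (extChartAt (𝓡 n) p₀ q) v w z
    - fderiv ℝ (Φ.coordForm D) (extChartAt (𝓡 n) p₀ q) w v z = 0
  rw [e, Φ.fderiv_coordForm hq, Φ.fderiv_coordForm hq, hder, hder, hcomp, hcomp, htor w v]
  refine Prod.ext ?_ ?_
  · simp only [Prod.fst_sub, Prod.fst_add, Prod.fst_zero, hC,
      hD.g_symm q (Φ.field v q) (Φ.field w q)]
    ring
  · simp only [Prod.snd_sub, Prod.snd_add, Prod.snd_zero, Data.nabla]
    rw [← sub_eq_zero] at hR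
    refine Eq.trans ?_ hR
    module

end CoordFrame

variable {D : Data n M}

/-- Local solvability of the structure equations. -/
theorem exists_local_solution [T2Space M] (hD : D.IsCentroaffine) (p₀ : M) :
    ∃ (φ : M → Ambient n) (U : Set M), IsOpen U ∧ p₀ ∈ U ∧ ∀ q ∈ U,
      ContMDiffAt (𝓡 n) 𝓘(ℝ, Ambient n) ∞ φ q ∧ D.GaussAt φ q ∧ TransversalAt φ q := by
  obtain ⟨Φ⟩ := exists_coordFrame (n := n) p₀
  obtain ⟨P, r, hr, -, hP⟩ := exists_flat_frame Φ.isOpen_coordDom (Φ.mem_coordDom Φ.mem_dom)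
    (Φ.contDiffOn_coordForm (D := D)) fun y hy ↦ Φ.coordForm_flat hD hy
  -- Any linear identification will do: composing with a constant linear map on the left preserves
  -- `dP = P θ`.
  let B : (ℝ × EuclideanSpace ℝ (Fin n)) ≃L[ℝ] Ambient n :=
    ContinuousLinearEquiv.ofFinrankEq finrank_ambient
  let Q : M → (ℝ × EuclideanSpace ℝ (Fin n)) → Ambient n :=
    fun q z ↦ B (P (extChartAt (𝓡 n) p₀ q) z)
  let U : Set M := Φ.dom ∩ ((extChartAt (𝓡 n) p₀).source ∩
    extChartAt (𝓡 n) p₀ ⁻¹' Metric.ball (extChartAt (𝓡 n) p₀ p₀) r)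
  have hU : IsOpen U := Φ.isOpen_dom.inter (isOpen_extChartAt_preimage' p₀ Metric.isOpen_ball)
  have hsm : ∀ q ∈ U, ∀ z, ContMDiffAt (𝓡 n) 𝓘(ℝ, Ambient n) ∞ (fun q ↦ Q q z) q := by
    intro q hq z
    have h1 : ContDiffAt ℝ ∞ (fun y ↦ B (P y z)) (extChartAt (𝓡 n) p₀ q) :=
      B.contDiff.contDiffAt.comp _ ((hP _ hq.2.2).1.clm_apply contDiffAt_const)
    exact h1.contMDiffAt.comp q (Φ.smoothAt_chart hq.1)
  have hder : ∀ q ∈ U, ∀ z v, mvfderiv (𝓡 n) (fun q ↦ Q q z) q (Φ.field v q) =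
      Q q (Φ.connForm D q v z) := by
    intro q hq z v
    have h1 := B.toContinuousLinearMap.hasFDerivAt.comp _
      ((hP _ hq.2.2).2.1.clm_apply (hasFDerivAt_const z _))
    have h2 := Φ.mvfderiv_comp_chart hq.1 h1.differentiableAt v
    refine h2.trans ?_
    rw [h1.fderiv]
    have e : Φ.coordForm D (extChartAt (𝓡 n) p₀ q) = Φ.connForm D q := by
      rw [CoordFrame.coordForm, (extChartAt (𝓡 n) p₀).left_inv (Φ.source_of_mem hq.1)]
    rw [e]
    simp [Q]
  -- Since `θ_c (1, 0) = (0, c)`, the tangential columns of the parallel frame are the partial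
  -- derivatives of its first column.
  have hφ : ∀ q ∈ U, ∀ c, mvfderiv (𝓡 n) (fun q ↦ Q q (1, 0)) q (Φ.field c q) = Q q (0, c) := by
    intro q hq c
    rw [hder q hq, Φ.connForm_apply]
    congr 1
    refine Prod.ext ?_ ?_
    · simp
    · simp
  have hnear : ∀ q ∈ U, ∀ c, ∀ᶠ r in 𝓝 q,
      mvfderiv (𝓡 n) (fun q ↦ Q q (1, 0)) r (Φ.field c r) = Q r (0, c) := fun q hq c ↦ by
    filter_upwards [hU.mem_nhds hq] with r hr using hφ r hr c
  have hfr : ∀ q ∈ U, ∀ (f : ℝ) (v : TangentSpace (𝓡 n) q),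
      f • Q q (1, 0) + mvfderiv (𝓡 n) (fun q ↦ Q q (1, 0)) q v =
        Q q (f, mvfderiv (𝓡 n) (extChartAt (𝓡 n) p₀) q v) := by
    intro q hq f v
    have h1 := hφ q hq (mvfderiv (𝓡 n) (extChartAt (𝓡 n) p₀) q v)
    rw [Φ.field_coord q hq.1] at h1
    rw [h1]
    simp only [Q, ← map_smul, ← map_add]
    simp
  refine ⟨fun q ↦ Q q (1, 0), U, hU, ⟨Φ.mem_dom, mem_extChartAt_source p₀,
    Metric.mem_ball_self hr⟩, fun q hq ↦ ⟨hsm q hq _, ?_, ?_⟩⟩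
  · refine gaussAt_of_span (hsm q hq _) fun w v ↦
      ⟨Φ.field (mvfderiv (𝓡 n) (extChartAt (𝓡 n) p₀) q w), (Φ.smooth _).mdiffAt q,
        Φ.field_coord q hq.1 w, ?_⟩
    set c := mvfderiv (𝓡 n) (extChartAt (𝓡 n) p₀) q w
    have hv : v = Φ.field (mvfderiv (𝓡 n) (extChartAt (𝓡 n) p₀) q v) q :=
      (Φ.field_coord q hq.1 v).symm
    rw [mvfderiv_congr (hnear q hq c)]
    generalize mvfderiv (𝓡 n) (extChartAt (𝓡 n) p₀) q v = d at hv
    subst hv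
    rw [hder q hq, Φ.connForm_apply]
    have h := hfr q hq (D.g q (Φ.field d q) (Φ.field c q)) (D.cov (Φ.field c) q (Φ.field d q))
    rw [zero_smul, zero_add]
    exact h.symm.trans (add_comm _ _)
  · refine (injective_iff_map_eq_zero _).2 ?_
    rintro ⟨f, v⟩ hz
    replace hz := (hfr q hq f v).symm.trans hz
    obtain ⟨u, hu⟩ := (hP _ hq.2.2).2.2
    -- Transversality is the invertibility of `P`, because the framing of `φ` is `B ∘ P` in
    -- coordinates.
    have h1 : P (extChartAt (𝓡 n) p₀ q)
        (f, mvfderiv (𝓡 n) (extChartAt (𝓡 n) p₀) q (v : TangentSpace (𝓡 n) q)) = 0 :=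
      B.map_eq_zero_iff.1 hz
    have h2 := congrArg (u⁻¹ : (_ →L[ℝ] _)ˣ).val h1
    rw [← hu] at h2
    have h3 : ((u⁻¹ : (_ →L[ℝ] _)ˣ).val * u.val)
        (f, mvfderiv (𝓡 n) (extChartAt (𝓡 n) p₀) q (v : TangentSpace (𝓡 n) q)) = 0 :=
      h2.trans (map_zero _)
    rw [u.inv_mul] at h3
    have h4 := congrArg Prod.snd h3
    have h5 : (v : TangentSpace (𝓡 n) q) = 0 := by
      rw [← Φ.field_coord q hq.1 v]
      exact (congrArg (fun c ↦ Φ.field c q) h4).trans (congrFun (map_zero Φ.field) q)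
    have h6 : f = 0 := congrArg Prod.fst h3
    exact Prod.ext h6 h5

end LocalSolutions

/-! ### Local uniqueness up to linear maps. -/

section Uniqueness

variable {n : ℕ} {M : Type*} [TopologicalSpace M] [ChartedSpace (EuclideanSpace ℝ (Fin n)) M]
  [IsManifold (𝓡 n) ∞ M] {D : Data n M}

/-- The structure equations for a variable coefficient vector: the product rule adds `dz` to the
connection term. -/
lemma CoordFrame.mvfderiv_framing_apply {p₀ : M} (Φ : CoordFrame (n := n) p₀) {φ : M → Ambient n}
    {q : M} (hq : q ∈ Φ.dom) (hφ : ContMDiffAt (𝓡 n) 𝓘(ℝ, Ambient n) ∞ φ q) (hG : D.GaussAt φ q)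
    {z : M → ℝ × EuclideanSpace ℝ (Fin n)}
    (hz : MDifferentiableAt (𝓡 n) 𝓘(ℝ, ℝ × EuclideanSpace ℝ (Fin n)) z q)
    (c : EuclideanSpace ℝ (Fin n)) :
    mvfderiv (𝓡 n) (fun r ↦ Φ.framing φ r (z r)) q (Φ.field c q) =
      Φ.framing φ q (Φ.connForm D q c (z q) + mvfderiv (𝓡 n) z q (Φ.field c q)) := by
  have hF := mdiffAt_of_smooth (Φ.smoothAt_framing hq hφ)
  have h1 := mvfderiv_bilin (ContinuousLinearMap.id ℝ
    (ℝ × EuclideanSpace ℝ (Fin n) →L[ℝ] Ambient n)) hF hz (Φ.field c q)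
  have h2 := mvfderiv_clm_comp (ContinuousLinearMap.apply ℝ (Ambient n) (z q)) hF (Φ.field c q)
  have h3 := Φ.mvfderiv_framing D hq hφ hG c (z q)
  refine h1.trans ?_
  rw [map_add, ← h3]
  exact congrArg (· + _) h2.symm

/-- Two solutions of the Gauss equation differ locally by a linear map. -/
theorem exists_linearMap_of_gaussAt [T2Space M] {φ ψ : M → Ambient n} {U : Set M} (hU : IsOpen U)
    (hφ : ∀ q ∈ U, ContMDiffAt (𝓡 n) 𝓘(ℝ, Ambient n) ∞ φ q)
    (hψ : ∀ q ∈ U, ContMDiffAt (𝓡 n) 𝓘(ℝ, Ambient n) ∞ ψ q)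
    (hGφ : ∀ q ∈ U, D.GaussAt φ q) (hGψ : ∀ q ∈ U, D.GaussAt ψ q)
    (hT : ∀ q ∈ U, TransversalAt φ q) {p : M} (hp : p ∈ U) :
    ∃ A : Ambient n →L[ℝ] Ambient n, ∀ᶠ q in 𝓝 p, ∀ z,
      Centroaffine.framing ψ q z = A (Centroaffine.framing φ q z) := by
  obtain ⟨Φ⟩ := exists_coordFrame (n := n) p
  set F : M → Ambient n →L[ℝ] Ambient n :=
    fun q ↦ (Φ.framing ψ q).comp (Φ.framing φ q).inverse
  have hinv : ∀ q ∈ U ∩ Φ.dom, ContMDiffAt (𝓡 n)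
      𝓘(ℝ, Ambient n →L[ℝ] ℝ × EuclideanSpace ℝ (Fin n)) ∞
      (fun q ↦ (Φ.framing φ q).inverse) q := by
    intro q hq
    refine ContMDiffAt.comp q (ContDiffAt.contMDiffAt
      (f := ContinuousLinearMap.inverse (R := ℝ) (M := ℝ × EuclideanSpace ℝ (Fin n))
        (M₂ := Ambient n)) ?_) (Φ.smoothAt_framing hq.2 (hφ q hq.1))
    exact contDiffAt_map_inverse
      (Φ.framingEquiv hq.2 (mdiffAt_of_smooth (hφ q hq.1)) (hT q hq.1))
  have hFinv : ∀ q ∈ U ∩ Φ.dom, ∀ a, Φ.framing φ q ((Φ.framing φ q).inverse a) = a := by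
    intro q hq a
    have : Φ.framing φ q = (Φ.framingEquiv hq.2 (mdiffAt_of_smooth (hφ q hq.1))
      (hT q hq.1) : _ →L[ℝ] _) := rfl
    rw [this, ContinuousLinearMap.inverse_equiv]
    exact ContinuousLinearEquiv.apply_symm_apply _ _
  have hinvF : ∀ q ∈ U ∩ Φ.dom, ∀ a, (Φ.framing φ q).inverse (Φ.framing φ q a) = a := by
    intro q hq a
    have : Φ.framing φ q = (Φ.framingEquiv hq.2 (mdiffAt_of_smooth (hφ q hq.1))
      (hT q hq.1) : _ →L[ℝ] _) := rfl
    rw [this, ContinuousLinearMap.inverse_equiv]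
    exact ContinuousLinearEquiv.symm_apply_apply _ _
  have hFs : ∀ q ∈ U ∩ Φ.dom, MDifferentiableAt (𝓡 n) 𝓘(ℝ, Ambient n →L[ℝ] Ambient n) F q :=
    fun q hq ↦ mdiffAt_of_smooth ((Φ.smoothAt_framing hq.2 (hψ q hq.1)).clm_comp (hinv q hq))
  -- With `z` the coefficients of a fixed vector `a` in the frame of `φ`, differentiating `a` gives
  -- `θ z + dz = 0`. The frame of `ψ` obeys the same equation, so its combination with coefficients
  -- `z`, which is `F a`, also has zero derivative.
  have hF0 : ∀ q ∈ U ∩ Φ.dom, ∀ v, mvfderiv (𝓡 n) F q v = 0 := by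
    intro q hq v
    ext1 a
    have hz := mdiffAt_of_smooth ((hinv q hq).clm_apply (contMDiffAt_const (c := a)))
    have hv := Φ.field_coord q hq.2 v
    set c := mvfderiv (𝓡 n) (extChartAt (𝓡 n) p) q v
    have h1 := Φ.mvfderiv_framing_apply hq.2 (hφ q hq.1) (hGφ q hq.1) hz c
    have h2 := Φ.mvfderiv_framing_apply hq.2 (hψ q hq.1) (hGψ q hq.1) hz c
    have h3 : ∀ᶠ r in 𝓝 q, Φ.framing φ r ((Φ.framing φ r).inverse a) = a := by
      filter_upwards [(hU.inter Φ.isOpen_dom).mem_nhds hq] with r hr using hFinv r hr a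
    rw [mvfderiv_congr h3] at h1
    have h4 : mvfderiv (𝓡 n) (fun _ : M ↦ a) q (Φ.field c q) = 0 := by simp [mvfderiv]
    have h5 := congrArg (Φ.framing φ q).inverse (h4.symm.trans h1)
    rw [map_zero, hinvF q hq] at h5
    rw [← h5, map_zero, hv] at h2
    exact (mvfderiv_clm_comp (ContinuousLinearMap.apply ℝ (Ambient n) a) (hFs q hq) v).symm.trans h2
  refine ⟨F p, ?_⟩
  filter_upwards [eventually_eq_of_mvfderiv_eq_zero (hU.inter Φ.isOpen_dom) hFs hF0
    ⟨hp, Φ.mem_dom⟩, (hU.inter Φ.isOpen_dom).mem_nhds ⟨hp, Φ.mem_dom⟩] with q hq hqU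
  rintro ⟨f, v⟩
  rw [← hq]
  have hv := Φ.field_coord q hqU.2 v
  have e1 := Φ.framing_apply hqU.2 (mdiffAt_of_smooth (hφ q hqU.1))
    (f, mvfderiv (𝓡 n) (extChartAt (𝓡 n) p) q (v : TangentSpace (𝓡 n) q))
  have e2 := Φ.framing_apply hqU.2 (mdiffAt_of_smooth (hψ q hqU.1))
    (f, mvfderiv (𝓡 n) (extChartAt (𝓡 n) p) q (v : TangentSpace (𝓡 n) q))
  dsimp only at e1 e2
  rw [hv] at e1 e2
  have e3 : F q (Φ.framing φ q (f, mvfderiv (𝓡 n) (extChartAt (𝓡 n) p) q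
    (v : TangentSpace (𝓡 n) q))) = Φ.framing ψ q (f, mvfderiv (𝓡 n) (extChartAt (𝓡 n) p) q
    (v : TangentSpace (𝓡 n) q)) := congrArg (Φ.framing ψ q) (hinvF q hqU _)
  rw [e1, e2] at e3
  exact e3.symm

end Uniqueness

/-! ### Gluing local solutions over a simply connected manifold. -/

/-- A locally constant cocycle on a simply connected space is trivial. -/
theorem exists_trivialization_of_cocycle {X G : Type*} [TopologicalSpace X]
    [SimplyConnectedSpace X] [LocallyPathConnectedSpace X] [Group G] {U : X → Set X}
    (hU : ∀ i, IsOpen (U i)) (hmem : ∀ x, x ∈ U x) (c : X → X → X → G)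
    (hloc : ∀ i j, ∀ x ∈ U i ∩ U j, ∀ᶠ y in 𝓝 x, c i j y = c i j x)
    (hself : ∀ i, ∀ x ∈ U i, c i i x = 1)
    (hcomp : ∀ i j k, ∀ x ∈ U i ∩ U j ∩ U k, c j k x * c i j x = c i k x) :
    ∃ s : X → X → G, (∀ i, ∀ x ∈ U i, ∀ᶠ y in 𝓝 x, s i y = s i x) ∧
      ∀ i j, ∀ x ∈ U i ∩ U j, s j x = c i j x * s i x := by
  let : TopologicalSpace G := ⊥
  have : DiscreteTopology G := ⟨rfl⟩
  -- With `G` discrete, local constancy is continuity of the transition maps, so the cocycle defines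
  -- a bundle with discrete fibre, that is, a covering.
  let Z : FiberBundleCore X X G :=
    { baseSet := U
      isOpen_baseSet := hU
      indexAt := id
      mem_baseSet_at := hmem
      coordChange := fun i j x v ↦ c i j x * v
      coordChange_self := fun i x hx v ↦ by rw [hself i x hx, one_mul]
      continuousOn_coordChange := fun i j ↦ by
        rintro ⟨x, v⟩ hx
        refine ContinuousAt.continuousWithinAt (ContinuousAt.congr (f := fun p : X × G ↦
          c i j x * p.2) ?_ ?_)
        · exact ((continuous_of_discreteTopology (f := fun v : G ↦ c i j x * v)).comp
            continuous_snd).continuousAt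
        · filter_upwards [continuousAt_fst.eventually (hloc i j x hx.1)] with p hp
          rw [hp]
      coordChange_comp := fun i j k x hx v ↦ by rw [← mul_assoc, hcomp i j k x hx] }
  have hcov : IsCoveringMap (Bundle.TotalSpace.proj : Z.TotalSpace → X) :=
    FiberBundle.isCoveringMap (F := G) (E := Z.Fiber)
  obtain ⟨x₀⟩ : Nonempty X := inferInstance
  -- A lift of the identity is a global section. Its coordinates in the local trivialisations are
  -- the required `s i`.
  obtain ⟨σ, ⟨-, hσ⟩, -⟩ := hcov.existsUnique_continuousMap_lifts (ContinuousMap.id X) x₀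
    (⟨x₀, (1 : G)⟩ : Z.TotalSpace) rfl
  have hσ' : ∀ x, (σ x).proj = x := fun x ↦ congrFun hσ x
  refine ⟨fun i x ↦ (Z.localTriv i (σ x)).2, fun i x hx ↦ ?_, fun i j x hx ↦ ?_⟩
  · have h1 : ContinuousAt (fun y ↦ (Z.localTriv i (σ y)).2) x := by
      refine ContinuousAt.snd (ContinuousAt.comp (g := Z.localTriv i) ?_ σ.continuous.continuousAt)
      refine (Z.localTriv i).continuousOn_toFun.continuousAt
        ((Z.localTriv i).open_source.mem_nhds ?_)
      rw [Bundle.Trivialization.mem_source]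
      change (σ x).proj ∈ U i
      rwa [hσ']
    exact h1.eventually_mem ((isOpen_discrete {(Z.localTriv i (σ x)).2}).mem_nhds rfl)
  · have hmem' : (σ x).proj ∈ U (σ x).proj := hmem _
    have h := hcomp (σ x).proj i j (σ x).proj ⟨⟨hmem', by rw [hσ']; exact hx.1⟩,
      by rw [hσ']; exact hx.2⟩
    have key : ∀ v : G, c (σ x).proj j (σ x).proj * v =
        c i j x * (c (σ x).proj i (σ x).proj * v) := fun v ↦ by rw [← h, mul_assoc, hσ']
    exact key (σ x).2

section Global

variable {n : ℕ} {M : Type*} [TopologicalSpace M] [ChartedSpace (EuclideanSpace ℝ (Fin n)) M]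

/-- The framing as an isomorphism. -/
def TransversalAt.equiv {φ : M → Ambient n} {p : M} (h : TransversalAt φ p) :
    (ℝ × EuclideanSpace ℝ (Fin n)) ≃ₗ[ℝ] Ambient n :=
  (framing φ p).linearEquivOfInjective h finrank_ambient

lemma TransversalAt.equiv_apply {φ : M → Ambient n} {p : M} (h : TransversalAt φ p)
    (z : ℝ × EuclideanSpace ℝ (Fin n)) : h.equiv z = framing φ p z := rfl

lemma framing_clm_comp (A : Ambient n →L[ℝ] Ambient n) {φ : M → Ambient n} {p : M}
    (hφ : MDifferentiableAt (𝓡 n) 𝓘(ℝ, Ambient n) φ p) (z : ℝ × EuclideanSpace ℝ (Fin n)) :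
    framing (fun q ↦ A (φ q)) p z = A (framing φ p z) := by
  obtain ⟨f, v⟩ := z
  have := mvfderiv_clm_comp A hφ (v : TangentSpace (𝓡 n) p)
  change f • A (φ p) + mvfderiv (𝓡 n) (fun q ↦ A (φ q)) p (v : TangentSpace (𝓡 n) p) =
    A (f • φ p + mvfderiv (𝓡 n) φ p (v : TangentSpace (𝓡 n) p))
  rw [this, map_add, map_smul]

lemma framing_congr {φ ψ : M → Ambient n} {p : M} (h : ∀ᶠ q in 𝓝 p, φ q = ψ q) :
    framing φ p = framing ψ p := by
  refine LinearMap.ext fun z ↦ ?_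
  obtain ⟨f, v⟩ := z
  change f • φ p + mvfderiv (𝓡 n) φ p (v : TangentSpace (𝓡 n) p) =
    f • ψ p + mvfderiv (𝓡 n) ψ p (v : TangentSpace (𝓡 n) p)
  rw [mvfderiv_congr h, h.self_of_nhds]

variable [IsManifold (𝓡 n) ∞ M] {D : Data n M}

/-- Global solvability of the structure equations on simply connected manifolds. -/
theorem exists_global_solution [T2Space M] [SimplyConnectedSpace M] (hD : D.IsCentroaffine) :
    ∃ φ : M → Ambient n, ContMDiff (𝓡 n) 𝓘(ℝ, Ambient n) ∞ φ ∧ (∀ q, D.GaussAt φ q) ∧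
      ∀ q, TransversalAt φ q := by
  classical
  have : LocallyPathConnectedSpace M :=
    ChartedSpace.locallyPathConnectedSpace (EuclideanSpace ℝ (Fin n)) M
  choose Φ U hU hmem hsol using exists_local_solution hD
  have hsm := fun i q hq ↦ (hsol i q hq).1
  have hG := fun i q hq ↦ (hsol i q hq).2.1
  have hT := fun i q hq ↦ (hsol i q hq).2.2
  let c : M → M → M → (Ambient n ≃ₗ[ℝ] Ambient n) := fun i j q ↦
    if h : q ∈ U i ∩ U j then (hT i q h.1).equiv.symm.trans (hT j q h.2).equiv else 1
  have hc : ∀ i j q (h : q ∈ U i ∩ U j), c i j q =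
      (hT i q h.1).equiv.symm.trans (hT j q h.2).equiv := fun i j q h ↦ dif_pos h
  have hcf : ∀ i j q, q ∈ U i ∩ U j → ∀ z, c i j q (framing (Φ i) q z) = framing (Φ j) q z := by
    intro i j q h z
    rw [hc i j q h, ← (hT i q h.1).equiv_apply, LinearEquiv.trans_apply,
      LinearEquiv.symm_apply_apply]
    rfl
  have hext : ∀ i q (h : q ∈ U i) (A B : Ambient n ≃ₗ[ℝ] Ambient n),
      (∀ z, A (framing (Φ i) q z) = B (framing (Φ i) q z)) → A = B := by
    intro i q h A B hAB
    ext1 a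
    have := hAB ((hT i q h).equiv.symm a)
    rwa [← (hT i q h).equiv_apply, LinearEquiv.apply_symm_apply] at this
  obtain ⟨s, hs1, hs2⟩ := exists_trivialization_of_cocycle hU hmem c
    (fun i j x hx ↦ by
      obtain ⟨A, hA⟩ := exists_linearMap_of_gaussAt ((hU i).inter (hU j))
        (fun q hq ↦ hsm i q hq.1) (fun q hq ↦ hsm j q hq.2) (fun q hq ↦ hG i q hq.1)
        (fun q hq ↦ hG j q hq.2) (fun q hq ↦ hT i q hq.1) hx
      have hAc : ∀ᶠ q in 𝓝 x, ∀ a, c i j q a = A a := by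
        filter_upwards [hA, ((hU i).inter (hU j)).mem_nhds hx] with q hq hqU a
        have h1 := hcf i j q hqU ((hT i q hqU.1).equiv.symm a)
        rw [hq, ← (hT i q hqU.1).equiv_apply, LinearEquiv.apply_symm_apply] at h1
        exact h1
      filter_upwards [hAc] with q hq
      ext1 a
      rw [hq, hAc.self_of_nhds])
    (fun i x hx ↦ hext i x hx _ _ fun z ↦ hcf i i x ⟨hx, hx⟩ z)
    (fun i j k x hx ↦ hext i x hx.1.1 _ _ fun z ↦ by
      rw [LinearEquiv.mul_apply, hcf i j x hx.1, hcf j k x ⟨hx.1.2, hx.2⟩,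
        hcf i k x ⟨hx.1.1, hx.2⟩])
  -- The local solution centred at `q` itself is used at `q`. Near `p` the relation `s q = c p q * s
  -- p` turns this into `(s p p)⁻¹ ∘ Φ p`, a fixed linear image of a single local solution.
  let φ : M → Ambient n := fun q ↦ (s q q)⁻¹ (Φ q q)
  have hloc : ∀ p, ∃ A : Ambient n ≃ₗ[ℝ] Ambient n, ∀ᶠ q in 𝓝 p,
      φ q = LinearMap.toContinuousLinearMap A.toLinearMap (Φ p q) := by
    intro p
    refine ⟨(s p p)⁻¹, ?_⟩
    filter_upwards [hs1 p p (hmem p), (hU p).mem_nhds (hmem p)] with q hq hqU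
    have h1 := hcf p q q ⟨hqU, hmem q⟩ (1, 0)
    have h0 : ∀ i, framing (Φ i) q (1, 0) = Φ i q := by
      intro i
      refine (framing_apply (Φ i) q 1 0).trans ?_
      rw [map_zero, one_smul, add_zero]
    rw [h0, h0] at h1
    change (s q q)⁻¹ (Φ q q) = (s p p)⁻¹ (Φ p q)
    rw [hs2 p q q ⟨hqU, hmem q⟩, mul_inv_rev, LinearEquiv.mul_apply, hq, ← h1]
    congr 1
    exact (c p q q).symm_apply_apply _
  have hsmooth : ∀ p, ContMDiffAt (𝓡 n) 𝓘(ℝ, Ambient n) ∞ φ p := by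
    intro p
    obtain ⟨A, hA⟩ := hloc p
    exact ((LinearMap.toContinuousLinearMap A.toLinearMap).contMDiff.contMDiffAt.comp p
      (hsm p p (hmem p))).congr_of_eventuallyEq hA
  refine ⟨φ, hsmooth, fun p ↦ ?_, fun p ↦ ?_⟩
  · obtain ⟨A, hA⟩ := hloc p
    exact ((hG p p (hmem p)).clm_comp (hsm p p (hmem p)) _).congr hA
  · obtain ⟨A, hA⟩ := hloc p
    rw [TransversalAt, framing_congr hA]
    intro z w hzw
    rw [framing_clm_comp _ (mdiffAt_of_smooth (hsm p p (hmem p))),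
      framing_clm_comp _ (mdiffAt_of_smooth (hsm p p (hmem p)))] at hzw
    exact hT p p (hmem p) (A.injective hzw)

/-- On connected manifolds two solutions of the structure equations differ by a linear map. -/
theorem exists_linearMap_global [T2Space M] [ConnectedSpace M] {φ ψ : M → Ambient n}
    (hφ : ContMDiff (𝓡 n) 𝓘(ℝ, Ambient n) ∞ φ) (hψ : ContMDiff (𝓡 n) 𝓘(ℝ, Ambient n) ∞ ψ)
    (hGφ : ∀ q, D.GaussAt φ q) (hGψ : ∀ q, D.GaussAt ψ q) (hT : ∀ q, TransversalAt φ q) :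
    ∃ A : Ambient n →ₗ[ℝ] Ambient n, ∀ q z, framing ψ q z = A (framing φ q z) := by
  let F : M → Ambient n →ₗ[ℝ] Ambient n := fun q ↦
    (framing ψ q).comp (hT q).equiv.symm.toLinearMap
  have hF : ∀ q z, F q (framing φ q z) = framing ψ q z := by
    intro q z
    change framing ψ q ((hT q).equiv.symm ((hT q).equiv z)) = _
    rw [LinearEquiv.symm_apply_apply]
  have hlc : IsLocallyConstant F := by
    rw [IsLocallyConstant.iff_eventually_eq]
    intro p
    obtain ⟨A, hA⟩ := exists_linearMap_of_gaussAt isOpen_univ (fun q _ ↦ hφ q) (fun q _ ↦ hψ q)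
      (fun q _ ↦ hGφ q) (fun q _ ↦ hGψ q) (fun q _ ↦ hT q) (mem_univ p)
    have hFA : ∀ᶠ q in 𝓝 p, F q = A := by
      filter_upwards [hA] with q hq
      ext1 a
      change framing ψ q ((hT q).equiv.symm a) = A a
      rw [hq, ← (hT q).equiv_apply, LinearEquiv.apply_symm_apply]
    filter_upwards [hFA] with q hq
    rw [hq, hFA.self_of_nhds]
  obtain ⟨p₀⟩ : Nonempty M := inferInstance
  refine ⟨F p₀, fun q z ↦ ?_⟩
  rw [hlc.apply_eq_of_preconnectedSpace p₀ q, hF]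

end Global

/-! ### Induced volume forms and their normalisation. -/

section Volume

variable {n : ℕ}

/-- The determinant as a continuous multilinear map. -/
def ambientDetC (n : ℕ) : ContinuousMultilinearMap ℝ (fun _ : Fin (n + 1) ↦ Ambient n) ℝ where
  toMultilinearMap := (EuclideanSpace.basisFun (Fin (n + 1)) ℝ).toBasis.det.toMultilinearMap
  cont := by
    refine Continuous.congr (f := fun v : Fin (n + 1) → Ambient n ↦
      Matrix.det (Matrix.of fun i j ↦ v j i)) ?_ fun v ↦ ?_
    · refine Continuous.matrix_det (continuous_matrix fun i j ↦ ?_)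
      exact (EuclideanSpace.proj i : Ambient n →L[ℝ] ℝ).continuous.comp (continuous_apply j)
    · exact (Module.Basis.det_apply (EuclideanSpace.basisFun (Fin (n + 1)) ℝ).toBasis v).symm

lemma ambientDetC_apply (v : Fin (n + 1) → Ambient n) : ambientDetC n v = ambientDet v := rfl

variable {M : Type*} [TopologicalSpace M] [ChartedSpace (EuclideanSpace ℝ (Fin n)) M]

/-- The volume form induced by a hypersurface. -/
def inducedVol (φ : M → Ambient n) (p : M) : (TangentSpace (𝓡 n) p) [⋀^Fin n]→ₗ[ℝ] ℝ :=
  (((EuclideanSpace.basisFun (Fin (n + 1)) ℝ).toBasis.det).curryLeft (φ p)).compLinearMap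
    (mvfderiv (𝓡 n) φ p).toLinearMap

lemma inducedVol_apply (φ : M → Ambient n) (p : M) (v : Fin n → TangentSpace (𝓡 n) p) :
    inducedVol φ p v = ambientDet (Fin.cons (φ p) fun i ↦ mvfderiv (𝓡 n) φ p (v i)) := rfl

/-- The product rule for the determinant. -/
lemma mvfderiv_ambientDet {G : Fin (n + 1) → M → Ambient n} {p : M}
    (hG : ∀ i, ContMDiffAt (𝓡 n) 𝓘(ℝ, Ambient n) ∞ (G i) p) (v : TangentSpace (𝓡 n) p) :
    mvfderiv (𝓡 n) (fun q ↦ ambientDet fun i ↦ G i q) p v =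
      ∑ i, ambientDet (Function.update (fun j ↦ G j p) i (mvfderiv (𝓡 n) (G i) p v)) := by
  have h1 : ContMDiffAt (𝓡 n) 𝓘(ℝ, Fin (n + 1) → Ambient n) ∞ (fun q i ↦ G i q) p :=
    contMDiffAt_pi_space.2 hG
  have h2 := (ambientDetC n).hasFDerivAt (x := fun i ↦ G i p)
  have h3 := mvfderiv_comp_left (Φ := ambientDetC n) (F := fun q i ↦ G i q) h2.differentiableAt
    (mdiffAt_of_smooth h1) v
  rw [h2.fderiv, ContinuousMultilinearMap.linearDeriv_apply] at h3
  refine h3.trans (Finset.sum_congr rfl fun i _ ↦ ?_)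
  have h4 := mvfderiv_clm_comp (ContinuousLinearMap.proj (R := ℝ) (φ := fun _ ↦ Ambient n) i)
    (mdiffAt_of_smooth h1) v
  rw [ambientDetC_apply]
  exact congrArg (fun a ↦ ambientDet (Function.update (fun j ↦ G j p) i a)) h4.symm

lemma ambientDet_tangent_eq_zero (φ : M → Ambient n) (p : M)
    (v : Fin (n + 1) → TangentSpace (𝓡 n) p) :
    ambientDet (fun i ↦ mvfderiv (𝓡 n) φ p (v i)) = 0 := by
  refine AlternatingMap.map_linearDependent _ _ fun h ↦ ?_
  have h1 : LinearIndependent ℝ v := LinearIndependent.of_comp (mvfderiv (𝓡 n) φ p).toLinearMap h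
  have h2 : Fintype.card (Fin (n + 1)) ≤ Module.finrank ℝ (EuclideanSpace ℝ (Fin n)) :=
    LinearIndependent.fintype_card_le_finrank (M := EuclideanSpace ℝ (Fin n)) h1
  simp at h2

/-- This discards the radial term `g(X, Y) φ` of the Gauss equation, since `φ` already occupies the
first slot. -/
lemma ambientDet_update_add (w : Fin n → Ambient n) (a : Ambient n) (i : Fin n) (r : ℝ)
    (z : Ambient n) : ambientDet (Fin.cons a (Function.update w i (z + r • a))) =
      ambientDet (Fin.cons a (Function.update w i z)) := by
  have h0 : ambientDet (Fin.cons a (Function.update w i a)) = 0 :=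
    AlternatingMap.map_eq_zero_of_eq _ _ (i := 0) (j := i.succ) (by simp) (Fin.succ_ne_zero i).symm
  rw [Fin.cons_update] at h0 ⊢
  rw [Fin.cons_update]
  simp only [ambientDet] at h0 ⊢
  rw [AlternatingMap.map_update_add, AlternatingMap.map_update_smul, h0, smul_zero, add_zero]

lemma inducedVol_ne_zero {φ : M → Ambient n} {p : M} (h : TransversalAt φ p)
    (b : Module.Basis (Fin n) ℝ (TangentSpace (𝓡 n) p)) : inducedVol φ p b ≠ 0 := by
  obtain ⟨h1, h2⟩ := transversalAt_iff.1 h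
  have hli : LinearIndependent ℝ (Fin.cons (φ p) fun i ↦ mvfderiv (𝓡 n) φ p (b i) :
      Fin (n + 1) → Ambient n) := by
    rw [linearIndependent_finCons]
    refine ⟨b.linearIndependent.map' (mvfderiv (𝓡 n) φ p).toLinearMap
      (LinearMap.ker_eq_bot.2 h1), fun hmem ↦ h2 ?_⟩
    have h3 : Submodule.span ℝ (range fun i ↦ mvfderiv (𝓡 n) φ p (b i)) ≤
        (mvfderiv (𝓡 n) φ p).toLinearMap.range := by
      rw [Submodule.span_le]
      rintro _ ⟨i, rfl⟩
      exact ⟨b i, rfl⟩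
    exact h3 hmem
  have hb := (Module.Basis.is_basis_iff_det (EuclideanSpace.basisFun (Fin (n + 1)) ℝ).toBasis).1
    ⟨hli, hli.span_eq_top_of_card_eq_finrank (by simp)⟩
  exact hb.ne_zero

lemma inducedVol_clm_comp (A : Ambient n →L[ℝ] Ambient n) {φ : M → Ambient n} {p : M}
    (hφ : MDifferentiableAt (𝓡 n) 𝓘(ℝ, Ambient n) φ p) (v : Fin n → TangentSpace (𝓡 n) p) :
    inducedVol (fun q ↦ A (φ q)) p v = LinearMap.det A.toLinearMap * inducedVol φ p v := by
  rw [inducedVol_apply, inducedVol_apply, ambientDet, ambientDet]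
  rw [← Module.Basis.det_comp]
  congr 1
  funext i
  refine Fin.cases rfl (fun i ↦ ?_) i
  exact mvfderiv_clm_comp A hφ (v i)

variable [IsManifold (𝓡 n) ∞ M] {D : Data n M}

/-- The volume form induced by a solution of the Gauss equation is parallel. -/
lemma mvfderiv_inducedVol {φ : M → Ambient n} (hφ : ContMDiff (𝓡 n) 𝓘(ℝ, Ambient n) ∞ φ)
    {p : M} (hG : D.GaussAt φ p) {Y : Fin n → VField n M} (hY : ∀ i, IsSmoothField (Y i))
    (v : TangentSpace (𝓡 n) p) :
    mvfderiv (𝓡 n) (fun q ↦ inducedVol φ q fun i ↦ Y i q) p v =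
      ∑ i, inducedVol φ p (Function.update (fun j ↦ Y j p) i (D.cov (Y i) p v)) := by
  have h1 := mvfderiv_ambientDet (G := Fin.cons φ fun i q ↦ mvfderiv (𝓡 n) φ q (Y i q)) (p := p)
    (Fin.cases (hφ p) fun i ↦ smoothAt_mvfderiv_apply (hφ p) ((hY i).contMDiffAt p)) v
  have e : ∀ q, (fun i ↦ (Fin.cons φ fun i q ↦ mvfderiv (𝓡 n) φ q (Y i q) :
      Fin (n + 1) → M → Ambient n) i q) = Fin.cons (φ q) fun i ↦ mvfderiv (𝓡 n) φ q (Y i q) :=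
    fun q ↦ funext (Fin.cases rfl fun i ↦ rfl)
  simp only [e] at h1
  refine h1.trans ?_
  rw [Fin.sum_univ_succ]
  simp only [Fin.cons_zero, Fin.cons_succ, Fin.update_cons_zero]
  -- Differentiating the slot of `φ` leaves `n + 1` vectors in an `n`-dimensional tangent space.
  have h0 : ambientDet (Fin.cons (mvfderiv (𝓡 n) φ p v) fun i ↦ mvfderiv (𝓡 n) φ p (Y i p)) = 0 := by
    rw [← ambientDet_tangent_eq_zero φ p (Fin.cons v fun i ↦ Y i p)]
    exact congrArg ambientDet (funext (Fin.cases rfl fun i ↦ rfl))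
  rw [h0, zero_add]
  refine Finset.sum_congr rfl fun i _ ↦ ?_
  rw [hG _ ((hY i).mdiffAt p), ← Fin.cons_update, ambientDet_update_add, inducedVol_apply]
  congr 2
  funext j
  rcases eq_or_ne j i with rfl | hj
  · simp
  · simp [hj]

/-- A parallel volume form is a constant multiple of the induced one. -/
theorem exists_vol_eq_smul [T2Space M] [ConnectedSpace M]
    (hvol : ∀ (X : VField n M) (Y : Fin n → VField n M), IsSmoothField X →
      (∀ i, IsSmoothField (Y i)) → ∀ p, D.nablaVol X Y p = 0)
    {φ : M → Ambient n} (hφ : ContMDiff (𝓡 n) 𝓘(ℝ, Ambient n) ∞ φ) (hG : ∀ p, D.GaussAt φ p)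
    (hT : ∀ p, TransversalAt φ p) : ∃ ρ : ℝ, ∀ p v, D.vol p v = ρ * inducedVol φ p v := by
  -- This basis need not vary continuously with `p`. It only defines the ratio `ρ`, whose
  -- differentiability is checked below with smooth fields.
  let b (p : M) : Module.Basis (Fin n) ℝ (TangentSpace (𝓡 n) p) :=
    (EuclideanSpace.basisFun (Fin n) ℝ).toBasis
  let ρ : M → ℝ := fun p ↦ D.vol p (b p) / inducedVol φ p (b p)
  have hρ : ∀ p v, D.vol p v = ρ p * inducedVol φ p v := by
    intro p v
    have e1 := congrArg (fun f ↦ f v) ((D.vol p).eq_smul_basis_det (b p))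
    have e2 := congrArg (fun f ↦ f v) ((inducedVol φ p).eq_smul_basis_det (b p))
    simp only [AlternatingMap.smul_apply, smul_eq_mul] at e1 e2
    rw [e1, e2, ← mul_assoc, div_mul_cancel₀ _ (inducedVol_ne_zero (hT p) (b p))]
  have key : ∀ p, MDifferentiableAt (𝓡 n) 𝓘(ℝ, ℝ) ρ p ∧ ∀ v, mvfderiv (𝓡 n) ρ p v = 0 := by
    intro p
    choose Y hY hYp using fun i ↦ exists_smoothField (n := n) (b p i)
    have hν := mdiffAt_of_smooth (D.smooth_vol Y hY p)
    have hYp' : (fun i ↦ Y i p) = b p := funext hYp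
    have hμ : MDifferentiableAt (𝓡 n) 𝓘(ℝ, ℝ) (fun q ↦ inducedVol φ q fun i ↦ Y i q) p := by
      have h1 : ContMDiffAt (𝓡 n) 𝓘(ℝ, Fin (n + 1) → Ambient n) ∞ (fun q ↦
          (Fin.cons (φ q) fun i ↦ mvfderiv (𝓡 n) φ q (Y i q) : Fin (n + 1) → Ambient n)) p :=
        contMDiffAt_pi_space.2 (Fin.cases (hφ p)
          fun i ↦ smoothAt_mvfderiv_apply (hφ p) ((hY i).contMDiffAt p))
      exact ((ambientDetC n).contDiff (n := 1)).differentiable (by simp)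
        |>.differentiableAt.comp_mdifferentiableAt (I := 𝓡 n) (mdiffAt_of_smooth h1)
    have hne : inducedVol φ p (fun i ↦ Y i p) ≠ 0 := by
      rw [hYp']; exact inducedVol_ne_zero (hT p) (b p)
    have hev : ∀ᶠ q in 𝓝 p, ρ q = D.vol q (fun i ↦ Y i q) *
        (inducedVol φ q fun i ↦ Y i q)⁻¹ := by
      filter_upwards [hμ.continuousAt.eventually_ne hne] with q hq
      rw [hρ q, mul_inv_cancel_right₀ hq]
    have hinv : MDifferentiableAt (𝓡 n) 𝓘(ℝ, ℝ)
        (fun q ↦ (inducedVol φ q fun i ↦ Y i q)⁻¹) p :=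
      DifferentiableAt.comp_mdifferentiableAt (I := 𝓡 n) (g := fun t : ℝ ↦ t⁻¹)
        (f := fun q ↦ inducedVol φ q fun i ↦ Y i q) (differentiableAt_inv hne) hμ
    have hd : MDifferentiableAt (𝓡 n) 𝓘(ℝ, ℝ) ρ p :=
      (mdiffAt_smul hν hinv).congr_of_eventuallyEq hev
    refine ⟨hd, fun v ↦ ?_⟩
    obtain ⟨X, hX, rfl⟩ := exists_smoothField (n := n) v
    -- Both forms are parallel, so only `dρ` times the induced volume survives.
    have h1 := hvol X Y hX hY p
    simp only [Data.nablaVol, hρ] at h1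
    rw [mvfderiv_mul_apply hd hμ, mvfderiv_inducedVol hφ (hG p) hY, ← Finset.mul_sum] at h1
    simp only [Data.nabla, add_sub_cancel_right] at h1
    exact (mul_eq_zero.1 h1).resolve_right hne
  obtain ⟨p₀⟩ : Nonempty M := inferInstance
  refine ⟨ρ p₀, fun p v ↦ ?_⟩
  rw [hρ, eq_of_mvfderiv_eq_zero (fun q ↦ (key q).1) (fun q ↦ (key q).2) p p₀]

lemma exists_linearEquiv_det {ρ : ℝ} (hρ : ρ ≠ 0) :
    ∃ A : Ambient n ≃ₗ[ℝ] Ambient n, LinearMap.det A.toLinearMap = ρ := by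
  let b := (EuclideanSpace.basisFun (Fin (n + 1)) ℝ).toBasis
  let A := Matrix.toLin b b (Matrix.diagonal (Function.update 1 0 ρ))
  have hA : LinearMap.det A = ρ := by
    rw [LinearMap.det_toLin, Matrix.det_diagonal, Finset.prod_update_of_mem (Finset.mem_univ _)]
    simp
  exact ⟨LinearMap.equivOfDetNeZero A (by rwa [hA]), hA⟩

/-- Normalised solutions of the structure equations. -/
theorem exists_normalized_solution [T2Space M] [SimplyConnectedSpace M] (hD : D.IsCentroaffine) :
    ∃ φ : M → Ambient n, ContMDiff (𝓡 n) 𝓘(ℝ, Ambient n) ∞ φ ∧ (∀ q, D.GaussAt φ q) ∧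
      (∀ q, TransversalAt φ q) ∧ ∀ q v, D.vol q v = inducedVol φ q v := by
  obtain ⟨φ, hφ, hG, hT⟩ := exists_global_solution hD
  obtain ⟨ρ, hρ⟩ := exists_vol_eq_smul hD.vol_parallel hφ hG hT
  obtain ⟨p₀⟩ : Nonempty M := inferInstance
  have hρ0 : ρ ≠ 0 := by
    rintro rfl
    exact hD.vol_ne_zero p₀ (AlternatingMap.ext fun v ↦ by rw [hρ]; simp)
  -- Composition with `A` multiplies the induced volume form by `det A = ρ`.
  obtain ⟨A, hA⟩ := exists_linearEquiv_det (n := n) hρ0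
  let A' : Ambient n →L[ℝ] Ambient n := LinearMap.toContinuousLinearMap A.toLinearMap
  refine ⟨fun q ↦ A' (φ q), A'.contMDiff.comp hφ, fun q ↦ (hG q).clm_comp (hφ q) A',
    fun q ↦ ?_, fun q v ↦ ?_⟩
  · intro z w hzw
    rw [framing_clm_comp _ (mdiffAt_of_smooth (hφ q)),
      framing_clm_comp _ (mdiffAt_of_smooth (hφ q))] at hzw
    exact hT q (A.injective hzw)
  · rw [inducedVol_clm_comp _ (mdiffAt_of_smooth (hφ q)), hρ, ← hA]
    rfl

end Volume

/-! ### From a cubic potential to the intrinsic identities. -/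

section Potential

/-- Trilinear forms on the ambient space. -/
abbrev TriForm (n : ℕ) : Type := Ambient n →L[ℝ] Ambient n →L[ℝ] Ambient n →L[ℝ] ℝ

variable {n : ℕ} {M : Type*} [TopologicalSpace M] [ChartedSpace (EuclideanSpace ℝ (Fin n)) M]

local instance : NormedAddCommGroup (Ambient n →L[ℝ] ℝ) := ContinuousLinearMap.toNormedAddCommGroup

local instance : NormedAddCommGroup (Ambient n →L[ℝ] Ambient n →L[ℝ] ℝ) :=
  ContinuousLinearMap.toNormedAddCommGroup

lemma mdiffAt_trilin (T : TriForm n) {F G H : M → Ambient n} {p : M}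
    (hF : MDifferentiableAt (𝓡 n) 𝓘(ℝ, Ambient n) F p)
    (hG : MDifferentiableAt (𝓡 n) 𝓘(ℝ, Ambient n) G p)
    (hH : MDifferentiableAt (𝓡 n) 𝓘(ℝ, Ambient n) H p) :
    MDifferentiableAt (𝓡 n) 𝓘(ℝ, ℝ) (fun q ↦ T (F q) (G q) (H q)) p :=
  mdiffAt_bilin (ContinuousLinearMap.id ℝ (Ambient n →L[ℝ] ℝ)) (mdiffAt_bilin T hF hG) hH

/-- Product rule for trilinear forms. -/
lemma mvfderiv_trilin (T : TriForm n) {F G H : M → Ambient n} {p : M}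
    (hF : MDifferentiableAt (𝓡 n) 𝓘(ℝ, Ambient n) F p)
    (hG : MDifferentiableAt (𝓡 n) 𝓘(ℝ, Ambient n) G p)
    (hH : MDifferentiableAt (𝓡 n) 𝓘(ℝ, Ambient n) H p) (v : TangentSpace (𝓡 n) p) :
    mvfderiv (𝓡 n) (fun q ↦ T (F q) (G q) (H q)) p v =
      T (mvfderiv (𝓡 n) F p v) (G p) (H p) + T (F p) (mvfderiv (𝓡 n) G p v) (H p) +
        T (F p) (G p) (mvfderiv (𝓡 n) H p v) := by
  have h := mvfderiv_bilin (ContinuousLinearMap.id ℝ (Ambient n →L[ℝ] ℝ))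
    (mdiffAt_bilin T hF hG) hH v
  rw [mvfderiv_bilin T hF hG] at h
  exact h

lemma smoothAt_trilin (T : TriForm n) {F G H : M → Ambient n} {p : M}
    (hF : ContMDiffAt (𝓡 n) 𝓘(ℝ, Ambient n) ∞ F p)
    (hG : ContMDiffAt (𝓡 n) 𝓘(ℝ, Ambient n) ∞ G p)
    (hH : ContMDiffAt (𝓡 n) 𝓘(ℝ, Ambient n) ∞ H p) :
    ContMDiffAt (𝓡 n) 𝓘(ℝ, ℝ) ∞ (fun q ↦ T (F q) (G q) (H q)) p :=
  ((T.contMDiff.contMDiffAt.comp p hF).clm_apply hG).clm_apply hH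

/-- `T` is (six times the polarisation of) a cubic form which equals one on the hypersurface and
whose Hessian is negative on its tangent spaces. -/
structure IsCubicPotential (T : TriForm n) (φ : M → Ambient n) : Prop where
  symm_left : ∀ x y z, T x y z = T y x z
  symm_right : ∀ x y z, T x y z = T x z y
  eq_six : ∀ p, T (φ p) (φ p) (φ p) = 6
  neg : ∀ p (v : TangentSpace (𝓡 n) p), v ≠ 0 →
    T (φ p) (mvfderiv (𝓡 n) φ p v) (mvfderiv (𝓡 n) φ p v) < 0

namespace IsCubicPotential

variable {T : TriForm n} {φ : M → Ambient n} (h : IsCubicPotential T φ)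

include h

lemma rotate (x y z : Ambient n) : T x y z = T z x y := by
  rw [h.symm_right x, h.symm_left x]

/-- The derivative of the constant `T(φ,φ,φ)` is three times this number. -/
lemma apply_tangent {p : M} (hφ : MDifferentiableAt (𝓡 n) 𝓘(ℝ, Ambient n) φ p)
    (v : TangentSpace (𝓡 n) p) : T (φ p) (φ p) (mvfderiv (𝓡 n) φ p v) = 0 := by
  have h1 := mvfderiv_trilin T hφ hφ hφ v
  simp only [h.eq_six] at h1
  have h0 : mvfderiv (𝓡 n) (fun _ : M ↦ (6 : ℝ)) p v = 0 := by simp [mvfderiv]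
  rw [h0, h.rotate (φ p) (φ p), h.symm_left (φ p) (mvfderiv (𝓡 n) φ p v)] at h1
  rw [h.rotate]
  linarith

/-- Thus `T(φ,φ,·)/6` reads off the radial coefficient. -/
lemma apply_framing {p : M} (hφ : MDifferentiableAt (𝓡 n) 𝓘(ℝ, Ambient n) φ p) (f : ℝ)
    (v : TangentSpace (𝓡 n) p) :
    T (φ p) (φ p) (mvfderiv (𝓡 n) φ p v + f • φ p) = 6 * f := by
  rw [map_add, map_smul, h.apply_tangent hφ, h.eq_six, zero_add, smul_eq_mul, mul_comm]

/-- Applying `T(φ,φ,·)` to a relation `f φ + dφ v = 0` gives `f = 0`. Then negativity of the Hessian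
excludes `v ≠ 0`. -/
lemma transversalAt {p : M} (hφ : MDifferentiableAt (𝓡 n) 𝓘(ℝ, Ambient n) φ p) :
    TransversalAt φ p := by
  refine (injective_iff_map_eq_zero _).2 ?_
  rintro ⟨f, v⟩ hz
  change f • φ p + mvfderiv (𝓡 n) φ p (v : TangentSpace (𝓡 n) p) = 0 at hz
  have h1 := (h.apply_framing hφ f (v : TangentSpace (𝓡 n) p)).symm.trans
    ((congrArg (T (φ p) (φ p)) ((add_comm _ _).trans hz)).trans (map_zero _))
  have hf : f = 0 := by linarith
  rw [hf, zero_smul, zero_add] at hz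
  have hv : (v : TangentSpace (𝓡 n) p) = 0 := by
    by_contra hv
    have := h.neg p v hv
    rw [hz] at this
    simp at this
  rw [hf]
  exact Prod.ext rfl hv

variable [IsManifold (𝓡 n) ∞ M]

/-- Differentiate the identity `T(φ,φ,dφ Y) = 0`; the factor two counts the two slots of `φ`. -/
lemma apply_second_derivative {p : M} (hφ : ContMDiff (𝓡 n) 𝓘(ℝ, Ambient n) ∞ φ) {Y : VField n M}
    (hY : MDifferentiableAt (𝓡 n) (𝓡 n).tangent (T% Y) p) (v : TangentSpace (𝓡 n) p) :
    T (φ p) (φ p) (mvfderiv (𝓡 n) (fun q ↦ mvfderiv (𝓡 n) φ q (Y q)) p v) =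
      -2 * T (φ p) (mvfderiv (𝓡 n) φ p v) (mvfderiv (𝓡 n) φ p (Y p)) := by
  have hd := fun q ↦ mdiffAt_of_smooth (hφ q)
  have h1 := mvfderiv_trilin T (hd p) (hd p) (mdiffAt_mvfderiv_apply (hφ p) hY) v
  simp only [h.apply_tangent (hd _)] at h1
  have h0 : mvfderiv (𝓡 n) (fun _ : M ↦ (0 : ℝ)) p v = 0 := by simp [mvfderiv]
  rw [h0, h.symm_left (mvfderiv (𝓡 n) φ p v)] at h1
  linarith

variable {D : Data n M}

lemma g_eq {p : M} (hφ : ContMDiff (𝓡 n) 𝓘(ℝ, Ambient n) ∞ φ) (hG : D.GaussAt φ p) {Y : VField n M}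
    (hY : MDifferentiableAt (𝓡 n) (𝓡 n).tangent (T% Y) p) (v : TangentSpace (𝓡 n) p) :
    D.g p v (Y p) = -(1 / 3) * T (φ p) (mvfderiv (𝓡 n) φ p v) (mvfderiv (𝓡 n) φ p (Y p)) := by
  have h1 := h.apply_second_derivative hφ hY v
  rw [hG Y hY, h.apply_framing (mdiffAt_of_smooth (hφ p))] at h1
  linarith

lemma g_apply [T2Space M] {p : M} (hφ : ContMDiff (𝓡 n) 𝓘(ℝ, Ambient n) ∞ φ)
    (hG : D.GaussAt φ p) (v w : TangentSpace (𝓡 n) p) :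
    D.g p v w = -(1 / 3) * T (φ p) (mvfderiv (𝓡 n) φ p v) (mvfderiv (𝓡 n) φ p w) := by
  obtain ⟨Y, hY, rfl⟩ := exists_smoothField (n := n) w
  exact h.g_eq hφ hG (hY.mdiffAt p) v

variable [T2Space M] (hφ : ContMDiff (𝓡 n) 𝓘(ℝ, Ambient n) ∞ φ) (hG : ∀ p, D.GaussAt φ p)

include hφ hG

/-- Differentiate the formula for `g`. The tangential parts of the Gauss equation are absorbed by
`∇`, and the radial parts vanish because `T(φ,φ,dφ ·) = 0`. -/
lemma cubic_eq {X Y Z : VField n M} (hY : IsSmoothField Y) (hZ : IsSmoothField Z) (p : M) :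
    D.cubic X Y Z p = -(1 / 3) * T (mvfderiv (𝓡 n) φ p (X p)) (mvfderiv (𝓡 n) φ p (Y p))
      (mvfderiv (𝓡 n) φ p (Z p)) := by
  have hd := fun q ↦ mdiffAt_of_smooth (hφ q)
  have hYs := mdiffAt_of_smooth (smoothAt_mvfderiv_apply (hφ p) (hY.contMDiffAt p))
  have hZs := mdiffAt_of_smooth (smoothAt_mvfderiv_apply (hφ p) (hZ.contMDiffAt p))
  have h1 : mvfderiv (𝓡 n) (D.gFun Y Z) p (X p) =
      -(1 / 3) * mvfderiv (𝓡 n) (fun q ↦ T (φ q) (mvfderiv (𝓡 n) φ q (Y q))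
        (mvfderiv (𝓡 n) φ q (Z q))) p (X p) := by
    have e : D.gFun Y Z = fun q ↦ (-(1 / 3) : ℝ) • T (φ q) (mvfderiv (𝓡 n) φ q (Y q))
        (mvfderiv (𝓡 n) φ q (Z q)) := funext fun q ↦ h.g_apply hφ (hG q) _ _
    have h0 : mvfderiv (𝓡 n) (fun _ : M ↦ (-(1 / 3) : ℝ)) p (X p) = 0 := by simp [mvfderiv]
    rw [e, mvfderiv_smul_apply mdifferentiableAt_const (mdiffAt_trilin T (hd p) hYs hZs), h0]
    simp
  rw [Data.cubic, h1, mvfderiv_trilin T (hd p) hYs hZs, hG p Y (hY.mdiffAt p),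
    hG p Z (hZ.mdiffAt p), Data.gFun, Data.gFun, Data.nabla, Data.nabla,
    h.g_apply hφ (hG p) (D.cov Y p (X p)) (Z p), h.g_apply hφ (hG p) (Y p) (D.cov Z p (X p))]
  simp only [map_add, map_smul, add_apply, smul_apply, smul_eq_mul,
    h.apply_tangent (hd p)]
  rw [h.symm_right (φ p) (mvfderiv (𝓡 n) φ p (Y p)) (φ p), h.apply_tangent (hd p)]
  ring

-- Differentiate the formula for `C`. Here the radial parts survive: each contributes a term like
-- `-g(X,Y) T(φ,dφ Z,dφ W)/3 = g(X,Y) g(Z,W)`.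
set_option synthInstance.maxHeartbeats 400000 in
lemma nablaCubic_eq {X Y Z W : VField n M} (hX : IsSmoothField X) (hY : IsSmoothField Y)
    (hZ : IsSmoothField Z) (hW : IsSmoothField W) (p : M) :
    D.nablaCubic X Y Z W p = D.gFun X Y p * D.gFun Z W p + D.gFun X Z p * D.gFun W Y p
        + D.gFun X W p * D.gFun Y Z p := by
  have hYs := mdiffAt_of_smooth (smoothAt_mvfderiv_apply (hφ p) (hY.contMDiffAt p))
  have hZs := mdiffAt_of_smooth (smoothAt_mvfderiv_apply (hφ p) (hZ.contMDiffAt p))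
  have hWs := mdiffAt_of_smooth (smoothAt_mvfderiv_apply (hφ p) (hW.contMDiffAt p))
  have h1 : mvfderiv (𝓡 n) (D.cubic Y Z W) p (X p) =
      -(1 / 3) * mvfderiv (𝓡 n) (fun q ↦ T (mvfderiv (𝓡 n) φ q (Y q))
        (mvfderiv (𝓡 n) φ q (Z q)) (mvfderiv (𝓡 n) φ q (W q))) p (X p) := by
    have e : D.cubic Y Z W = fun q ↦ (-(1 / 3) : ℝ) • T (mvfderiv (𝓡 n) φ q (Y q))
        (mvfderiv (𝓡 n) φ q (Z q)) (mvfderiv (𝓡 n) φ q (W q)) :=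
      funext fun q ↦ h.cubic_eq hφ hG hZ hW q
    have h0 : mvfderiv (𝓡 n) (fun _ : M ↦ (-(1 / 3) : ℝ)) p (X p) = 0 := by simp [mvfderiv]
    rw [e, mvfderiv_smul_apply mdifferentiableAt_const (mdiffAt_trilin T hYs hZs hWs), h0]
    simp
  rw [Data.nablaCubic, h1, mvfderiv_trilin T hYs hZs hWs, hG p Y (hY.mdiffAt p),
    hG p Z (hZ.mdiffAt p), hG p W (hW.mdiffAt p), h.cubic_eq hφ hG hZ hW,
    h.cubic_eq hφ hG (D.isSmoothField_nabla hX hZ) hW,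
    h.cubic_eq hφ hG hZ (D.isSmoothField_nabla hX hW)]
  simp only [Data.gFun, Data.nabla, map_add, map_smul, add_apply, smul_apply, smul_eq_mul]
  rw [h.symm_left (mvfderiv (𝓡 n) φ p (Y p)) (φ p), h.rotate (mvfderiv (𝓡 n) φ p (Y p))
    (mvfderiv (𝓡 n) φ p (Z p)) (φ p)]
  have e1 := h.g_apply hφ (hG p) (Z p) (W p)
  have e2 := h.g_apply hφ (hG p) (W p) (Y p)
  have e3 := h.g_apply hφ (hG p) (Y p) (Z p)
  rw [h.symm_right] at e2
  rw [e1, e2, e3]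
  ring

lemma g_symm (p : M) (v w : TangentSpace (𝓡 n) p) : D.g p v w = D.g p w v := by
  rw [h.g_apply hφ (hG p), h.g_apply hφ (hG p), h.symm_right]

lemma g_pos (p : M) (v : TangentSpace (𝓡 n) p) (hv : v ≠ 0) : 0 < D.g p v v := by
  rw [h.g_apply hφ (hG p)]
  have := h.neg p v hv
  linarith

/-- After the injective map `dφ`, the torsion is the commutator of derivatives minus the bracket
term, the radial parts cancelling by symmetry of `g`. -/
lemma torsion_eq_zero : D.cov.torsion = 0 := by
  rw [D.cov.torsion_eq_zero_iff]
  intro X Y p hX hY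
  have hT := h.transversalAt (mdiffAt_of_smooth (hφ p))
  refine (transversalAt_iff.1 hT).1 ?_
  rw [mvfderiv_mlieBracket (hφ p) hX hY, map_sub, hG p Y hY, hG p X hX,
    h.g_symm hφ hG p (X p) (Y p)]
  abel

lemma curvature_eq {X Y Z : VField n M} (hX : IsSmoothField X) (hY : IsSmoothField Y)
    (hZ : IsSmoothField Z) (p : M) :
    D.curvature X Y Z p = -(D.g p (Y p) (Z p) • X p - D.g p (X p) (Z p) • Y p) := by
  have hd := fun q ↦ mdiffAt_of_smooth (hφ q)
  have hT := h.transversalAt (hd p)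
  have hZs := fun q ↦ smoothAt_mvfderiv_apply (hφ q) (hZ.contMDiffAt q)
  -- The Gauss equation applied twice expresses `dφ(∇_X ∇_Y Z)` through iterated ambient
  -- derivatives.
  have key : ∀ X Y : VField n M, IsSmoothField X → IsSmoothField Y →
      mvfderiv (𝓡 n) φ p (D.cov (D.nabla Y Z) p (X p)) =
        mvfderiv (𝓡 n) (fun q ↦ mvfderiv (𝓡 n) (fun r ↦ mvfderiv (𝓡 n) φ r (Z r)) q (Y q)) p (X p)
        - (mvfderiv (𝓡 n) (D.gFun Y Z) p (X p) + D.g p (X p) (D.nabla Y Z p)) • φ p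
        - D.g p (Y p) (Z p) • mvfderiv (𝓡 n) φ p (X p) := by
    intro X Y hX hY
    have e : (fun q ↦ mvfderiv (𝓡 n) φ q (D.nabla Y Z q)) = fun q ↦
        mvfderiv (𝓡 n) (fun r ↦ mvfderiv (𝓡 n) φ r (Z r)) q (Y q) - D.gFun Y Z q • φ q := by
      funext q
      rw [hG q Z (hZ.mdiffAt q)]
      exact (add_sub_cancel_right _ _).symm
    have h1 := hG p _ ((D.isSmoothField_nabla hY hZ).mdiffAt p) (X p)
    have hg : MDifferentiableAt (𝓡 n) 𝓘(ℝ, ℝ) (D.gFun Y Z) p :=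
      mdiffAt_of_smooth (D.smooth_g Y Z hY hZ p)
    have hs := mdiffAt_of_smooth (smoothAt_mvfderiv_apply (hZs p) (hY.contMDiffAt p))
    rw [e, mvfderiv_sub_apply hs (mdiffAt_smul hg (hd p)), mvfderiv_smul_apply hg (hd p)] at h1
    rw [← sub_eq_iff_eq_add] at h1
    rw [← h1, add_smul]
    simp only [Data.gFun]
    abel
  have hb := hG p Z (hZ.mdiffAt p) (VectorField.mlieBracket (𝓡 n) X Y p)
  rw [mvfderiv_mlieBracket (hZs p) (hX.mdiffAt p) (hY.mdiffAt p), ← sub_eq_iff_eq_add] at hb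
  -- Flatness of the ambient space makes the whole expression vanish. The coefficient `f` collects
  -- its radial part, and the tangential component is the curvature equation.
  refine (hT.unique (f := (mvfderiv (𝓡 n) (D.gFun Y Z) p (X p) + D.g p (X p) (D.nabla Y Z p))
    - (mvfderiv (𝓡 n) (D.gFun X Z) p (Y p) + D.g p (Y p) (D.nabla X Z p))
    - D.g p (VectorField.mlieBracket (𝓡 n) X Y p) (Z p)) (f' := 0) ?_).2
  simp only [Data.curvature, map_sub, map_neg, map_smul]
  change _ + (mvfderiv (𝓡 n) φ p (D.cov (D.nabla Y Z) p (X p)) -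
    mvfderiv (𝓡 n) φ p (D.cov (D.nabla X Z) p (Y p)) -
    mvfderiv (𝓡 n) φ p (D.cov Z p (VectorField.mlieBracket (𝓡 n) X Y p))) = _
  rw [key X Y hX hY, key Y X hY hX, ← hb]
  module

/-- The centroaffine data of a hypersurface in a level set of a cubic form. -/
theorem isIntrinsicPSR (hvol : ∀ p v, D.vol p v = inducedVol φ p v) : D.IsIntrinsicPSR where
  centroaffine :=
    { torsionFree := h.torsion_eq_zero hφ hG
      g_symm := h.g_symm hφ hG
      g_nondegenerate := fun p v hv ↦ by
        by_contra hne
        exact (h.g_pos hφ hG p v hne).ne' (hv v)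
      vol_ne_zero := fun p h0 ↦ by
        let b : Module.Basis (Fin n) ℝ (TangentSpace (𝓡 n) p) :=
          (EuclideanSpace.basisFun (Fin n) ℝ).toBasis
        refine inducedVol_ne_zero (h.transversalAt (mdiffAt_of_smooth (hφ p))) b ?_
        rw [← hvol, h0]
        rfl
      vol_parallel := fun X Y _ hY p ↦ by
        simp only [Data.nablaVol, hvol]
        rw [mvfderiv_inducedVol hφ (hG p) hY]
        exact sub_self _
      curvature_eq := fun X Y Z hX hY hZ p ↦ h.curvature_eq hφ hG hX hY hZ p
      cubic_symm := fun X Y Z hX hY hZ p ↦ by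
        rw [h.cubic_eq hφ hG hY hZ, h.cubic_eq hφ hG hX hZ, h.cubic_eq hφ hG hZ hY]
        exact ⟨by rw [h.symm_left], by rw [h.symm_right]⟩ }
  g_pos := h.g_pos hφ hG
  nablaCubic_eq := fun _ _ _ _ hX hY hZ hW p ↦ h.nablaCubic_eq hφ hG hX hY hZ hW p

end IsCubicPotential

end Potential

/-! ### Construction of the induced data. -/

section InducedData

variable {n : ℕ} {M : Type*} [TopologicalSpace M] [ChartedSpace (EuclideanSpace ℝ (Fin n)) M]

/-- The tangential projection as a continuous linear map. -/
def TransversalAt.tangentialL {φ : M → Ambient n} {p : M} (h : TransversalAt φ p) :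
    Ambient n →L[ℝ] TangentSpace (𝓡 n) p :=
  (ContinuousLinearMap.snd ℝ ℝ (EuclideanSpace ℝ (Fin n))).comp
    h.decomp.toContinuousLinearEquiv.toContinuousLinearMap

lemma smoothAt_of_apply {W : Type*} [NormedAddCommGroup W] [NormedSpace ℝ W]
    {L : M → EuclideanSpace ℝ (Fin n) →L[ℝ] W} {p : M}
    (h : ∀ c, ContMDiffAt (𝓡 n) 𝓘(ℝ, W) ∞ (fun q ↦ L q c) p) :
    ContMDiffAt (𝓡 n) 𝓘(ℝ, EuclideanSpace ℝ (Fin n) →L[ℝ] W) ∞ L p := by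
  have e : L = fun q ↦ ∑ i, ContinuousLinearMap.smulRightL ℝ (EuclideanSpace ℝ (Fin n)) W
      (EuclideanSpace.proj i) (L q (EuclideanSpace.single i 1)) := by
    funext q
    refine ContinuousLinearMap.ext fun c ↦ ?_
    have hc : c = ∑ i, c i • EuclideanSpace.single i (1 : ℝ) := by
      ext j
      simp [Finset.sum_apply, Pi.single_apply]
    conv_lhs => rw [hc]
    simp
  rw [e]
  exact ContMDiffAt.sum fun i _ ↦ (ContinuousLinearMap.smulRightL ℝ (EuclideanSpace ℝ (Fin n)) W
    (EuclideanSpace.proj i)).contMDiff.contMDiffAt.comp p (h _)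

variable [IsManifold (𝓡 n) ∞ M]

/-- The connection induced by a centroaffine immersion. -/
def inducedCov {φ : M → Ambient n} (hφ : ContMDiff (𝓡 n) 𝓘(ℝ, Ambient n) ∞ φ)
    (hT : ∀ p, TransversalAt φ p) : CovariantDerivative (𝓡 n) (EuclideanSpace ℝ (Fin n))
      (fun p : M ↦ TangentSpace (𝓡 n) p) where
  toFun Y p := (hT p).tangentialL.comp (mvfderiv (𝓡 n) (fun q ↦ mvfderiv (𝓡 n) φ q (Y q)) p)
  isCovariantDerivativeOnUniv :=
    { add := fun {Y Y' p} hY hY' _ ↦ by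
        refine ContinuousLinearMap.ext fun v ↦ ?_
        have h1 : mvfderiv (𝓡 n) (fun q ↦ mvfderiv (𝓡 n) φ q ((Y + Y') q)) p v =
            mvfderiv (𝓡 n) (fun q ↦ mvfderiv (𝓡 n) φ q (Y q)) p v +
            mvfderiv (𝓡 n) (fun q ↦ mvfderiv (𝓡 n) φ q (Y' q)) p v := by
          rw [← mvfderiv_add_apply (mdiffAt_mvfderiv_apply (hφ p) hY)
            (mdiffAt_mvfderiv_apply (hφ p) hY')]
          simp
        exact (congrArg (hT p).tangentialL h1).trans (map_add _ _ _)
      leibniz := fun {Y f p} hY hf _ ↦ by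
        refine ContinuousLinearMap.ext fun v ↦ ?_
        have h1 : mvfderiv (𝓡 n) (fun q ↦ mvfderiv (𝓡 n) φ q ((f • Y) q)) p v =
            f p • mvfderiv (𝓡 n) (fun q ↦ mvfderiv (𝓡 n) φ q (Y q)) p v +
            mvfderiv (𝓡 n) f p v • mvfderiv (𝓡 n) φ p (Y p) := by
          have h3 := mvfderiv_smul_apply hf (mdiffAt_mvfderiv_apply (hφ p) hY) v
          refine Eq.trans ?_ (h3.trans (add_comm _ _))
          simp
        have h2 : (hT p).tangentialL (mvfderiv (𝓡 n) φ p (Y p)) = Y p := by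
          have := (hT p).tangential_eq 0 (Y p)
          rwa [zero_smul, zero_add] at this
        refine (congrArg (hT p).tangentialL h1).trans ?_
        rw [map_add, map_smul, map_smul, h2]
        rfl }

variable [T2Space M]

/-- A connection mapping smooth fields to smooth fields is smooth. -/
lemma contMDiff_cov_of_apply {cov : CovariantDerivative (𝓡 n) (EuclideanSpace ℝ (Fin n))
      (fun p : M ↦ TangentSpace (𝓡 n) p)}
    (h : ∀ X Y : VField n M, IsSmoothField X → IsSmoothField Y →
      IsSmoothField fun p ↦ cov Y p (X p)) :
    CovariantDerivative.ContMDiffCovariantDerivative cov ∞ where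
  contMDiff :=
    { contMDiff := fun {Y} hY ↦ by
        have hY' : IsSmoothField Y := ContMDiff.of_le (contMDiffOn_univ.1 hY) (by simp)
        refine ContMDiff.contMDiffOn fun p ↦ ?_
        rw [contMDiffAt_hom_bundle]
        refine ⟨contMDiffAt_id, ?_⟩
        obtain ⟨Φ⟩ := exists_coordFrame (n := n) p
        refine smoothAt_of_apply fun c ↦ ?_
        have h1 := smoothAt_mvfderiv_apply (Φ.smoothAt_chart Φ.mem_dom)
          ((h _ _ (Φ.smooth c) hY').contMDiffAt p)
        refine h1.congr_of_eventuallyEq ?_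
        filter_upwards [Φ.isOpen_dom.mem_nhds Φ.mem_dom] with q hq
        let e := trivializationAt (EuclideanSpace ℝ (Fin n)) (TangentSpace (𝓡 n) : M → Type _) p
        have hd : ∀ v : TangentSpace (𝓡 n) q,
            mvfderiv (𝓡 n) (extChartAt (𝓡 n) p) q v = e.continuousLinearMapAt ℝ q v := fun v ↦
          (congrArg (fun L : TangentSpace (𝓡 n) q →L[ℝ] EuclideanSpace ℝ (Fin n) ↦ L v)
            (TangentBundle.continuousLinearMapAt_trivializationAt (Φ.dom_subset hq))).symm
        have h2 : e.symmL ℝ q c = Φ.field c q := by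
          rw [← Φ.field_coord q hq (e.symmL ℝ q c), hd]
          exact congrArg (fun c ↦ Φ.field c q)
            (e.continuousLinearMapAt_symmL (R := ℝ) (Φ.dom_subset hq) c)
        rw [hd, ← h2]
        rfl }

namespace IsCubicPotential

variable {T : TriForm n} {φ : M → Ambient n}

/-- The data induced on a hypersurface in a level set of a cubic form. -/
def inducedData (h : IsCubicPotential T φ) (hφ : ContMDiff (𝓡 n) 𝓘(ℝ, Ambient n) ∞ φ) :
    Data n M where
  cov := inducedCov hφ fun p ↦ h.transversalAt (mdiffAt_of_smooth (hφ p))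
  g p := LinearMap.mk₂ ℝ
    (fun v w ↦ -(1 / 3) * T (φ p) (mvfderiv (𝓡 n) φ p v) (mvfderiv (𝓡 n) φ p w))
    (fun v w z ↦ by simp only [map_add, add_apply]; ring)
    (fun r v w ↦ by simp only [map_smul, smul_apply, smul_eq_mul]; ring)
    (fun v w z ↦ by simp only [map_add]; ring)
    (fun r v w ↦ by simp only [map_smul, smul_eq_mul]; ring)
  vol := inducedVol φ
  smooth_cov := contMDiff_cov_of_apply fun X Y hX hY p ↦
    (smoothAt_decomp (fun p ↦ h.transversalAt (mdiffAt_of_smooth (hφ p))) hφ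
      (smoothAt_mvfderiv_apply (smoothAt_mvfderiv_apply (hφ p) (hY.contMDiffAt p))
        (hX.contMDiffAt p))).2
  smooth_g X Y hX hY p := by
    exact contMDiffAt_const.mul (smoothAt_trilin T (hφ p)
      (smoothAt_mvfderiv_apply (hφ p) (hX.contMDiffAt p))
      (smoothAt_mvfderiv_apply (hφ p) (hY.contMDiffAt p)))
  smooth_vol Y hY p := by
    have h1 : ContMDiffAt (𝓡 n) 𝓘(ℝ, Fin (n + 1) → Ambient n) ∞ (fun q ↦
        (Fin.cons (φ q) fun i ↦ mvfderiv (𝓡 n) φ q (Y i q) : Fin (n + 1) → Ambient n)) p :=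
      contMDiffAt_pi_space.2 (Fin.cases (hφ p)
        fun i ↦ smoothAt_mvfderiv_apply (hφ p) ((hY i).contMDiffAt p))
    exact (ambientDetC n).contDiff.contMDiff.contMDiffAt.comp p h1

/-- The tangential part holds by construction of the connection. The radial part is identified by
applying `T(φ,φ,·)`. -/
lemma gaussAt_inducedData (h : IsCubicPotential T φ)
    (hφ : ContMDiff (𝓡 n) 𝓘(ℝ, Ambient n) ∞ φ) (p : M) : (h.inducedData hφ).GaussAt φ p := by
  intro Y hY v
  have hT := h.transversalAt (mdiffAt_of_smooth (hφ p))
  set a := mvfderiv (𝓡 n) (fun q ↦ mvfderiv (𝓡 n) φ q (Y q)) p v with ha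
  have h1 := hT.radial_tangential a
  have h2 := h.apply_second_derivative hφ hY v
  have h4 := h.apply_framing (mdiffAt_of_smooth (hφ p)) (hT.radial a) (hT.tangential a)
  rw [add_comm] at h1
  rw [← ha] at h2
  replace h4 := h4.symm.trans ((congrArg (T (φ p) (φ p)) h1).trans h2)
  have h3 : (h.inducedData hφ).g p v (Y p) = hT.radial a := by
    change -(1 / 3) * T (φ p) (mvfderiv (𝓡 n) φ p v) (mvfderiv (𝓡 n) φ p (Y p)) = _
    linarith
  rw [h3]
  exact h1.symm

theorem isInducedBy_inducedData (h : IsCubicPotential T φ)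
    (hφ : ContMDiff (𝓡 n) 𝓘(ℝ, Ambient n) ∞ φ) : (h.inducedData hφ).IsInducedBy φ where
  immersion := isCentroaffineImmersion_iff.2
    ⟨hφ, fun p ↦ h.transversalAt (mdiffAt_of_smooth (hφ p))⟩
  gauss X Y _ hY p := h.gaussAt_inducedData hφ p Y (hY.mdiffAt p) (X p)
  vol_eq _ _ := rfl

end IsCubicPotential

end InducedData

/-! ### Homogeneous cubic polynomials and symmetric trilinear forms. -/

section Cubic

variable {n : ℕ}

lemma contDiff_polyFun (h : MvPolynomial (Fin (n + 1)) ℝ) : ContDiff ℝ ∞ (polyFun h) := by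
  have e : polyFun h = fun x : Ambient n ↦
      ∑ d ∈ h.support, h.coeff d * ∏ i, x i ^ d i := funext fun x ↦ MvPolynomial.eval_eq' _ _
  rw [e]
  refine ContDiff.sum fun d _ ↦ contDiff_const.mul (contDiff_prod fun i _ ↦ ContDiff.pow ?_ _)
  exact (EuclideanSpace.proj i : Ambient n →L[ℝ] ℝ).contDiff

lemma polyFun_smul {h : MvPolynomial (Fin (n + 1)) ℝ} {k : ℕ} (hh : h.IsHomogeneous k) (t : ℝ)
    (x : Ambient n) : polyFun h (t • x) = t ^ k * polyFun h x := by
  rw [polyFun, polyFun, MvPolynomial.eval_eq', MvPolynomial.eval_eq', Finset.mul_sum]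
  refine Finset.sum_congr rfl fun d hd ↦ ?_
  have hk : ∑ i, d i = k := by
    have h1 := hh (MvPolynomial.mem_support_iff.1 hd)
    have h2 : Finsupp.degree d = Finsupp.weight 1 d := DFunLike.congr_fun Finsupp.degree_eq_weight_one d
    rw [← h1, ← h2, Finsupp.degree_eq_sum]
  simp only [PiLp.smul_apply, smul_eq_mul, mul_pow, Finset.prod_mul_distrib,
    Finset.prod_pow_eq_pow_sum, hk]
  ring

variable {W : Type*} [NormedAddCommGroup W] [NormedSpace ℝ W]

lemma fderiv_homogeneous {G : Ambient n → W} {k : ℕ}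
    (hk : ∀ t : ℝ, t ≠ 0 → ∀ x, G (t • x) = t ^ (k + 1) • G x) (t : ℝ) (ht : t ≠ 0) (x : Ambient n)
    (hd : Differentiable ℝ G) : fderiv ℝ G (t • x) = t ^ k • fderiv ℝ G x := by
  have h1 := fderiv_comp_smul (𝕜 := ℝ) (f := G) (x := x) t
  have h2 : (fun y ↦ G (t • y)) = fun y ↦ t ^ (k + 1) • G y := funext fun y ↦ hk t ht y
  rw [h2, fderiv_fun_const_smul hd.differentiableAt, pow_succ', mul_smul] at h1
  exact (smul_right_injective _ ht h1).symm

lemma euler_homogeneous {G : Ambient n → W} {k : ℕ}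
    (hk : ∀ t : ℝ, t ≠ 0 → ∀ x, G (t • x) = t ^ k • G x) (hd : Differentiable ℝ G)
    (x : Ambient n) : fderiv ℝ G x x = (k : ℝ) • G x := by
  have h1 : HasDerivAt (fun t : ℝ ↦ G (t • x)) (fderiv ℝ G x x) 1 := by
    have h2 : HasDerivAt (fun t : ℝ ↦ t • x) x 1 := by
      simpa using (hasDerivAt_id (1 : ℝ)).smul_const x
    have h3 : HasFDerivAt G (fderiv ℝ G x) ((1 : ℝ) • x) := by
      rw [one_smul]; exact hd.differentiableAt.hasFDerivAt
    exact h3.comp_hasDerivAt 1 h2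
  have h2 : HasDerivAt (fun t : ℝ ↦ t ^ k • G x) ((k : ℝ) • G x) 1 := by
    simpa using (hasDerivAt_pow k (1 : ℝ)).smul_const (G x)
  refine h1.unique (h2.congr_of_eventuallyEq ?_)
  filter_upwards [eventually_ne_nhds one_ne_zero] with t ht using hk t ht x

/-- Compare the two derivatives at `t = 0` of `t ↦ G (t x) = t G x`. This makes the Hessian of a
cubic linear in the base point. -/
lemma eq_fderiv_zero_of_homogeneous {G : Ambient n → W} (hd : Differentiable ℝ G)
    (h1 : ∀ t : ℝ, t ≠ 0 → ∀ x, G (t • x) = t • G x) (x : Ambient n) : G x = fderiv ℝ G 0 x := by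
  -- Homogeneity is only assumed for `t ≠ 0`, so the value at the origin is obtained from `t = 2`.
  have h0 : G 0 = 0 := by
    have h2 := h1 2 two_ne_zero 0
    rw [smul_zero, two_smul] at h2
    exact left_eq_add.1 h2
  have h3 : HasDerivAt (fun t : ℝ ↦ G (t • x)) (fderiv ℝ G 0 x) 0 := by
    have h2 : HasDerivAt (fun t : ℝ ↦ t • x) x 0 := by
      simpa using (hasDerivAt_id (0 : ℝ)).smul_const x
    have h3 : HasFDerivAt G (fderiv ℝ G 0) ((0 : ℝ) • x) := by
      rw [zero_smul]; exact hd.differentiableAt.hasFDerivAt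
    exact h3.comp_hasDerivAt 0 h2
  have h2 : HasDerivAt (fun t : ℝ ↦ t • G x) (G x) 0 := by
    simpa using (hasDerivAt_id (0 : ℝ)).smul_const (G x)
  refine (h3.unique (h2.congr_of_eventuallyEq (Eventually.of_forall fun t ↦ ?_))).symm
  rcases eq_or_ne t 0 with rfl | ht
  · simp [h0]
  · exact h1 t ht x

lemma clm_apply_eq_sum (L : Ambient n →L[ℝ] W) (x : Ambient n) :
    L x = ∑ i, x i • L (EuclideanSpace.single i 1) := by
  have hx : x = ∑ i, x i • EuclideanSpace.single i (1 : ℝ) := by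
    ext j
    simp [Finset.sum_apply, Pi.single_apply]
  conv_lhs => rw [hx]
  simp

set_option synthInstance.maxHeartbeats 400000

/-- The third derivative of a homogeneous cubic polynomial. -/
def cubicForm (h : MvPolynomial (Fin (n + 1)) ℝ) : TriForm n :=
  fderiv ℝ (fderiv ℝ (fderiv ℝ (polyFun h))) 0

variable {h : MvPolynomial (Fin (n + 1)) ℝ}

lemma contDiff_fderiv_polyFun (h : MvPolynomial (Fin (n + 1)) ℝ) :
    ContDiff ℝ ∞ (fderiv ℝ (polyFun h)) := (contDiff_polyFun h).fderiv_right (by simp)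

lemma contDiff_fderiv_fderiv_polyFun (h : MvPolynomial (Fin (n + 1)) ℝ) :
    ContDiff ℝ ∞ (fderiv ℝ (fderiv ℝ (polyFun h))) :=
  (contDiff_fderiv_polyFun h).fderiv_right (by simp)

lemma fderiv_polyFun_smul (hh : h.IsHomogeneous 3) (t : ℝ) (ht : t ≠ 0) (x : Ambient n) :
    fderiv ℝ (polyFun h) (t • x) = t ^ 2 • fderiv ℝ (polyFun h) x :=
  fderiv_homogeneous (fun t _ x ↦ polyFun_smul hh t x) t ht x
    ((contDiff_polyFun h).differentiable (by simp))

lemma fderiv_fderiv_polyFun_smul (hh : h.IsHomogeneous 3) (t : ℝ) (ht : t ≠ 0) (x : Ambient n) :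
    fderiv ℝ (fderiv ℝ (polyFun h)) (t • x) = t • fderiv ℝ (fderiv ℝ (polyFun h)) x := by
  have := fderiv_homogeneous (k := 1) (fun t ht x ↦ fderiv_polyFun_smul hh t ht x) t ht x
    ((contDiff_fderiv_polyFun h).differentiable (by simp))
  rwa [pow_one] at this

/-- The Hessian of a homogeneous cubic is linear. -/
lemma hessian_eq_cubicForm (hh : h.IsHomogeneous 3) (x : Ambient n) :
    fderiv ℝ (fderiv ℝ (polyFun h)) x = cubicForm h x := by
  exact eq_fderiv_zero_of_homogeneous
    ((contDiff_fderiv_fderiv_polyFun h).differentiable (by simp)) (fderiv_fderiv_polyFun_smul hh) x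

lemma cubicForm_symm_right (hh : h.IsHomogeneous 3) (x y z : Ambient n) :
    cubicForm h x y z = cubicForm h x z y := by
  rw [← hessian_eq_cubicForm hh]
  exact ((contDiff_polyFun h).contDiffAt.isSymmSndFDerivAt (by simpa using two_le_infty)).eq y z

lemma cubicForm_symm_left (h : MvPolynomial (Fin (n + 1)) ℝ) (x y z : Ambient n) :
    cubicForm h x y z = cubicForm h y x z := by
  have := ((contDiff_fderiv_polyFun h).contDiffAt (x := 0)).isSymmSndFDerivAt
    (by simpa using two_le_infty)
  rw [cubicForm]
  exact congrArg (fun L : Ambient n →L[ℝ] ℝ ↦ L z) (this.eq x y)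

lemma cubicForm_self (hh : h.IsHomogeneous 3) (x : Ambient n) :
    cubicForm h x x x = 6 * polyFun h x := by
  rw [← hessian_eq_cubicForm hh, euler_homogeneous (k := 2) (fderiv_polyFun_smul hh)
    ((contDiff_fderiv_polyFun h).differentiable (by simp)), smul_apply,
    euler_homogeneous (k := 3) (fun t _ x ↦ polyFun_smul hh t x)
    ((contDiff_polyFun h).differentiable (by simp))]
  simp only [smul_eq_mul]
  push_cast
  ring

/-- A projective special real manifold carries a cubic potential. -/
lemma isCubicPotential_cubicForm {S : Hypersurface n} (hh : h.IsHomogeneous 3)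
    (h1 : ∀ x ∈ S.carrier, polyFun h x = 1)
    (hneg : ∀ (p : S.carrier) (v : Ambient n), v ∈ Set.range (mvfderiv (𝓡 n) S.incl p) → v ≠ 0 →
      fderiv ℝ (fderiv ℝ (polyFun h)) (p : Ambient n) v v < 0) :
    IsCubicPotential (cubicForm h) S.incl where
  symm_left := cubicForm_symm_left h
  symm_right := cubicForm_symm_right hh
  eq_six p := by rw [cubicForm_self hh, Hypersurface.incl, h1 _ p.2, mul_one]
  neg p v hv := by
    rw [← hessian_eq_cubicForm hh]
    refine hneg p _ ⟨v, rfl⟩ fun h0 ↦ hv ?_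
    exact S.immersion.2 p (h0.trans (map_zero _).symm)

/-- The cubic polynomial of a trilinear form. -/
def triPoly (T : TriForm n) : MvPolynomial (Fin (n + 1)) ℝ :=
  ∑ i, ∑ j, ∑ k, MvPolynomial.C (1 / 6 * T (EuclideanSpace.single i 1)
    (EuclideanSpace.single j 1) (EuclideanSpace.single k 1)) *
      (MvPolynomial.X i * MvPolynomial.X j * MvPolynomial.X k)

lemma isHomogeneous_triPoly (T : TriForm n) : (triPoly T).IsHomogeneous 3 := by
  refine MvPolynomial.IsHomogeneous.sum _ _ _ fun i _ ↦ MvPolynomial.IsHomogeneous.sum _ _ _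
    fun j _ ↦ MvPolynomial.IsHomogeneous.sum _ _ _ fun k _ ↦ ?_
  exact (MvPolynomial.isHomogeneous_C _ _).mul
    (((MvPolynomial.isHomogeneous_X _ i).mul (MvPolynomial.isHomogeneous_X _ j)).mul
      (MvPolynomial.isHomogeneous_X _ k))

lemma polyFun_triPoly (T : TriForm n) (x : Ambient n) : polyFun (triPoly T) x = 1 / 6 * T x x x := by
  have e : T x x x = ∑ i, ∑ j, ∑ k, x i * (x j * (x k * T (EuclideanSpace.single i 1)
      (EuclideanSpace.single j 1) (EuclideanSpace.single k 1))) := by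
    have h1 := congrArg (fun L : Ambient n →L[ℝ] Ambient n →L[ℝ] ℝ ↦ L x x) (clm_apply_eq_sum T x)
    simp only [sum_apply, smul_apply] at h1
    rw [h1]
    refine Finset.sum_congr rfl fun i _ ↦ ?_
    have h2 := congrArg (fun L : Ambient n →L[ℝ] ℝ ↦ L x)
      (clm_apply_eq_sum (T (EuclideanSpace.single i 1)) x)
    simp only [sum_apply, smul_apply] at h2
    rw [h2, Finset.smul_sum]
    refine Finset.sum_congr rfl fun j _ ↦ ?_
    rw [clm_apply_eq_sum (T (EuclideanSpace.single i 1) (EuclideanSpace.single j 1)) x,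
      Finset.smul_sum, Finset.smul_sum]
    rfl
  rw [e, polyFun, triPoly, Finset.mul_sum]
  simp only [map_sum, map_mul, MvPolynomial.eval_C, MvPolynomial.eval_X, Finset.mul_sum]
  exact Finset.sum_congr rfl fun i _ ↦ Finset.sum_congr rfl fun j _ ↦
    Finset.sum_congr rfl fun k _ ↦ by ring

/-- Symmetry carries linearity from the first slot to the others; continuity is automatic in finite
dimension. -/
lemma exists_triForm {τ : Ambient n → Ambient n → Ambient n → ℝ}
    (hadd : ∀ a a' b c, τ (a + a') b c = τ a b c + τ a' b c)
    (hsmul : ∀ (r : ℝ) a b c, τ (r • a) b c = r * τ a b c)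
    (hl : ∀ a b c, τ a b c = τ b a c) (hr : ∀ a b c, τ a b c = τ a c b) :
    ∃ T : TriForm n, ∀ a b c, T a b c = τ a b c := by
  let B : Ambient n → Ambient n →L[ℝ] Ambient n →L[ℝ] ℝ := fun a ↦
    LinearMap.toContinuousBilinearMap <| LinearMap.mk₂ ℝ (fun b c ↦ τ a b c)
      (fun b b' c ↦ by rw [hl, hadd, hl b, hl b']) (fun r b c ↦ by rw [hl, hsmul, hl b]; rfl)
      (fun b c c' ↦ by rw [hr, hl, hadd, hl c, hr a c, hl c', hr a c'])
      (fun r b c ↦ by rw [hr, hl, hsmul, hl c, hr a c]; rfl)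
  refine ⟨LinearMap.toContinuousLinearMap
    { toFun := B
      map_add' := fun a a' ↦ by ext b c; exact hadd a a' b c
      map_smul' := fun r a ↦ by ext b c; exact hsmul r a b c }, fun a b c ↦ rfl⟩

end Cubic

/-! ### Recovering the cubic from the intrinsic structure. -/

section PotentialOfPSR

variable {n : ℕ} {M : Type*} [TopologicalSpace M] [ChartedSpace (EuclideanSpace ℝ (Fin n)) M]
  [IsManifold (𝓡 n) ∞ M]

/-- The cubic form is tensorial in its first argument. -/
lemma Data.cubic_of_eq (D : Data n M) {X X' X'' Y Z : VField n M} {p : M} {r : ℝ}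
    (e : X p = r • X' p + X'' p) :
    D.cubic X Y Z p = r * D.cubic X' Y Z p + D.cubic X'' Y Z p := by
  simp only [Data.cubic, Data.gFun, Data.nabla, e, map_add, map_smul, LinearMap.add_apply,
    LinearMap.smul_apply, smul_eq_mul]
  ring

lemma Data.cubic_of_smul (D : Data n M) {X X' Y Z : VField n M} {p : M} {r : ℝ}
    (e : X p = r • X' p) : D.cubic X Y Z p = r * D.cubic X' Y Z p := by
  simp only [Data.cubic, Data.gFun, Data.nabla, e, map_smul,
    LinearMap.smul_apply, smul_eq_mul]
  ring

lemma Data.contMDiff_cubic (D : Data n M) {X Y Z : VField n M} (hX : IsSmoothField X) (hY : IsSmoothField Y)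
    (hZ : IsSmoothField Z) : ContMDiff (𝓡 n) 𝓘(ℝ, ℝ) ∞ (D.cubic X Y Z) := fun p ↦
  ((smoothAt_mvfderiv_apply (D.smooth_g Y Z hY hZ p) (hX p)).sub
    (D.smooth_g _ Z (D.isSmoothField_nabla hX hY) hZ p)).sub
      (D.smooth_g Y _ hY (D.isSmoothField_nabla hX hZ) p)

variable {D : Data n M} {φ : M → Ambient n} (hφ : ContMDiff (𝓡 n) 𝓘(ℝ, Ambient n) ∞ φ)
  (hG : ∀ p, D.GaussAt φ p) (hT : ∀ p, TransversalAt φ p)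

/-- The radial part of a constant vector, as a function. -/
def radialFun (hT : ∀ p, TransversalAt φ p) (a : Ambient n) : M → ℝ := fun q ↦ (hT q).radial a

/-- The tangential part of a constant vector, as a vector field. -/
def tangentialField (hT : ∀ p, TransversalAt φ p) (a : Ambient n) : VField n M :=
  fun q ↦ (hT q).tangential a

/-- Six times the polarised cubic form of a projective special real structure. -/
def polarForm (D : Data n M) (hT : ∀ p, TransversalAt φ p) (a b c : Ambient n) : M → ℝ :=
  fun p ↦ 6 * (radialFun hT a p * (radialFun hT b p * radialFun hT c p))
    - 3 * (radialFun hT a p * D.gFun (tangentialField hT b) (tangentialField hT c) p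
      + radialFun hT b p * D.gFun (tangentialField hT a) (tangentialField hT c) p
      + radialFun hT c p * D.gFun (tangentialField hT a) (tangentialField hT b) p)
    - 3 * D.cubic (tangentialField hT a) (tangentialField hT b) (tangentialField hT c) p

variable (a b c : Ambient n)

section

variable [T2Space M]

include hφ

lemma contMDiff_radialFun : ContMDiff (𝓡 n) 𝓘(ℝ, ℝ) ∞ (radialFun hT a) := fun q ↦
  (smoothAt_decomp (p := q) hT hφ contMDiff_const.contMDiffAt).1

lemma isSmoothField_tangentialField : IsSmoothField (tangentialField hT a) := fun q ↦
  (smoothAt_decomp (p := q) hT hφ contMDiff_const.contMDiffAt).2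

lemma contMDiff_polarForm : ContMDiff (𝓡 n) 𝓘(ℝ, ℝ) ∞ (polarForm D hT a b c) := by
  have hY := isSmoothField_tangentialField hφ hT
  have hf := contMDiff_radialFun hφ hT
  have hg := fun d e ↦ D.smooth_g _ _ (hY d) (hY e)
  have hC := D.contMDiff_cubic (hY a) (hY b) (hY c)
  exact ((contMDiff_const.mul ((hf a).mul ((hf b).mul (hf c)))).sub (contMDiff_const.mul
    ((((hf a).mul (hg b c)).add ((hf b).mul (hg a c))).add ((hf c).mul (hg a b))))).sub
      (contMDiff_const.mul hC)

include hG

/-- Differentiate the constant `a = f φ + dφ Y` and separate radial and tangential parts. -/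
lemma structure_equations (p : M) (v : TangentSpace (𝓡 n) p) :
    mvfderiv (𝓡 n) (radialFun hT a) p v = -D.g p v (tangentialField hT a p) ∧
      D.cov (tangentialField hT a) p v = -radialFun hT a p • v := by
  have hf := mdiffAt_of_smooth (contMDiff_radialFun hφ hT a p)
  have hY := (isSmoothField_tangentialField hφ hT a).mdiffAt p
  have h0 : mvfderiv (𝓡 n) (fun _ : M ↦ a) p v = 0 := by simp [mvfderiv]
  have e : (fun _ : M ↦ a) = fun q ↦ radialFun hT a q • φ q +
      mvfderiv (𝓡 n) φ q (tangentialField hT a q) :=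
    funext fun q ↦ ((hT q).radial_tangential a).symm
  have hd := mdiffAt_of_smooth (hφ p)
  rw [e, mvfderiv_add_apply (mdiffAt_smul hf hd) (mdiffAt_mvfderiv_apply (hφ p) hY),
    mvfderiv_smul_apply hf hd, hG p _ hY] at h0
  have h1 := (hT p).unique (f := mvfderiv (𝓡 n) (radialFun hT a) p v +
      D.g p v (tangentialField hT a p)) (f' := 0)
    (v := radialFun hT a p • v + D.cov (tangentialField hT a) p v) (v' := 0) (by
      rw [map_add, map_smul, map_zero, zero_smul, add_zero, ← h0]
      module)
  refine ⟨by linarith [h1.1], ?_⟩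
  rw [neg_smul]
  exact eq_neg_of_add_eq_zero_right h1.2

lemma nabla_tangentialField (X : VField n M) :
    D.nabla X (tangentialField hT a) = fun q ↦ -radialFun hT a q • X q :=
  funext fun q ↦ (structure_equations hφ hG hT a q (X q)).2

variable (hD : D.IsIntrinsicPSR)

include hD

lemma mvfderiv_gFun_tangentialField {X : VField n M} (p : M) :
    mvfderiv (𝓡 n) (D.gFun (tangentialField hT a) (tangentialField hT b)) p (X p) =
      D.cubic X (tangentialField hT a) (tangentialField hT b) p
        - radialFun hT a p * D.gFun X (tangentialField hT b) p
        - radialFun hT b p * D.gFun X (tangentialField hT a) p := by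
  rw [Data.cubic, nabla_tangentialField hφ hG, nabla_tangentialField hφ hG]
  simp only [Data.gFun, map_smul, LinearMap.smul_apply, smul_eq_mul]
  rw [hD.centroaffine.g_symm p (tangentialField hT a p) (X p)]
  ring

lemma mvfderiv_cubic_tangentialField {X : VField n M} (hX : IsSmoothField X) (p : M) :
    mvfderiv (𝓡 n) (D.cubic (tangentialField hT a) (tangentialField hT b)
      (tangentialField hT c)) p (X p) =
      D.gFun X (tangentialField hT a) p * D.gFun (tangentialField hT b) (tangentialField hT c) p
      + D.gFun X (tangentialField hT b) p * D.gFun (tangentialField hT a) (tangentialField hT c) p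
      + D.gFun X (tangentialField hT c) p * D.gFun (tangentialField hT a) (tangentialField hT b) p
      - radialFun hT a p * D.cubic X (tangentialField hT b) (tangentialField hT c) p
      - radialFun hT b p * D.cubic X (tangentialField hT a) (tangentialField hT c) p
      - radialFun hT c p * D.cubic X (tangentialField hT a) (tangentialField hT b) p := by
  have ha := isSmoothField_tangentialField hφ hT a
  have hb := isSmoothField_tangentialField hφ hT b
  have hc := isSmoothField_tangentialField hφ hT c
  have hC := hD.centroaffine.cubic_symm
  have h1 := hD.nablaCubic_eq X _ _ _ hX ha hb hc p
  have hs : ∀ d, IsSmoothField (D.nabla X (tangentialField hT d)) := fun d ↦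
    D.isSmoothField_nabla hX (isSmoothField_tangentialField hφ hT d)
  have hv : ∀ d, D.nabla X (tangentialField hT d) p = -radialFun hT d p • X p := fun d ↦
    congrFun (nabla_tangentialField hφ hG hT d X) p
  -- Total symmetry moves each `∇_X Y_d = -f_d X` into the first slot, where `D.cubic` depends only
  -- on the value at `p`.
  rw [Data.nablaCubic, (hC _ _ _ ha (hs b) hc p).1, (hC _ _ _ ha hb (hs c) p).2,
    (hC _ _ _ ha (hs c) hb p).1, D.cubic_of_smul (hv a), D.cubic_of_smul (hv b),
    D.cubic_of_smul (hv c)] at h1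
  have e : D.gFun (tangentialField hT c) (tangentialField hT a) p =
    D.gFun (tangentialField hT a) (tangentialField hT c) p := hD.centroaffine.g_symm _ _ _
  rw [e] at h1
  linarith

/-- The coefficients of `polarForm` are dictated by the values of the sought `T` on `φ` and `dφ`:
`6`, `0`, `-3 g` and `-3 C`. In the derivative, the terms of types `f f g`, `f C` and `g g` cancel
separately; for the last type this is the equation for `∇C`. -/
lemma mvfderiv_polarForm (p : M) (v : TangentSpace (𝓡 n) p) :
    mvfderiv (𝓡 n) (polarForm D hT a b c) p v = 0 := by
  obtain ⟨X, hX, rfl⟩ := exists_smoothField (n := n) v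
  have hY := isSmoothField_tangentialField hφ hT
  have hf := fun d ↦ mdiffAt_of_smooth (contMDiff_radialFun hφ hT d p)
  have hg : ∀ d e, MDifferentiableAt (𝓡 n) 𝓘(ℝ, ℝ)
      (D.gFun (tangentialField hT d) (tangentialField hT e)) p := fun d e ↦
    mdiffAt_of_smooth (D.smooth_g _ _ (hY d) (hY e) p)
  have hC := mdiffAt_of_smooth (D.contMDiff_cubic (hY a) (hY b) (hY c) p)
  have hconst : ∀ (r : ℝ) {F : M → ℝ}, MDifferentiableAt (𝓡 n) 𝓘(ℝ, ℝ) F p →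
      mvfderiv (𝓡 n) (fun q ↦ r * F q) p (X p) = r * mvfderiv (𝓡 n) F p (X p) := by
    intro r F hF
    have h0 : mvfderiv (𝓡 n) (fun _ : M ↦ r) p (X p) = 0 := by simp [mvfderiv]
    rw [mvfderiv_mul_apply mdifferentiableAt_const hF, h0]
    simp
  have hmul : ∀ {F G : M → ℝ}, MDifferentiableAt (𝓡 n) 𝓘(ℝ, ℝ) F p →
      MDifferentiableAt (𝓡 n) 𝓘(ℝ, ℝ) G p →
      MDifferentiableAt (𝓡 n) 𝓘(ℝ, ℝ) (fun q ↦ F q * G q) p := fun hF hG ↦ mdiffAt_smul hF hG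
  have hbc := hmul (hf b) (hf c)
  have h1 := hmul (hf a) (hg b c)
  have h2 := hmul (hf b) (hg a c)
  have h3 := hmul (hf c) (hg a b)
  have h12 : MDifferentiableAt (𝓡 n) 𝓘(ℝ, ℝ) (fun q ↦
    radialFun hT a q * D.gFun (tangentialField hT b) (tangentialField hT c) q
      + radialFun hT b q * D.gFun (tangentialField hT a) (tangentialField hT c) q) p := h1.add h2
  have h123 : MDifferentiableAt (𝓡 n) 𝓘(ℝ, ℝ) (fun q ↦
    radialFun hT a q * D.gFun (tangentialField hT b) (tangentialField hT c) q
      + radialFun hT b q * D.gFun (tangentialField hT a) (tangentialField hT c) q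
      + radialFun hT c q * D.gFun (tangentialField hT a) (tangentialField hT b) q) p := h12.add h3
  have hcm : ∀ (r : ℝ) {F : M → ℝ}, MDifferentiableAt (𝓡 n) 𝓘(ℝ, ℝ) F p →
      MDifferentiableAt (𝓡 n) 𝓘(ℝ, ℝ) (fun q ↦ r * F q) p := fun r F hF ↦
    hmul mdifferentiableAt_const hF
  have hS := mvfderiv_sub_apply (hcm 6 (hmul (hf a) hbc)) (hcm 3 h123) (X p)
  have hSd : MDifferentiableAt (𝓡 n) 𝓘(ℝ, ℝ) _ p := (hcm 6 (hmul (hf a) hbc)).sub (hcm 3 h123)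
  have hTot := mvfderiv_sub_apply hSd (hcm 3 hC) (X p)
  refine hTot.trans ?_
  refine (congrArg (· - _) hS).trans ?_
  rw [hconst 6 (hmul (hf a) hbc), hconst 3 h123, hconst 3 hC, mvfderiv_add_apply h12 h3,
    mvfderiv_add_apply h1 h2, mvfderiv_mul_apply (hf a) hbc, mvfderiv_mul_apply (hf b) (hf c),
    mvfderiv_mul_apply (hf a) (hg b c), mvfderiv_mul_apply (hf b) (hg a c),
    mvfderiv_mul_apply (hf c) (hg a b), mvfderiv_cubic_tangentialField hφ hG hT a b c hD hX,
    mvfderiv_gFun_tangentialField hφ hG hT b c hD, mvfderiv_gFun_tangentialField hφ hG hT a c hD,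
    mvfderiv_gFun_tangentialField hφ hG hT a b hD]
  have hr : ∀ d, mvfderiv (𝓡 n) (radialFun hT d) p (X p) =
      -D.gFun X (tangentialField hT d) p := fun d ↦ (structure_equations hφ hG hT d p (X p)).1
  rw [hr, hr, hr]
  ring

include hT in
/-- The cubic form of an intrinsic projective special real manifold realised in `ℝ^(n+1)`. -/
theorem exists_isCubicPotential [ConnectedSpace M] : ∃ T : TriForm n, IsCubicPotential T φ := by
  obtain ⟨p₀⟩ := (inferInstance : Nonempty M)
  have hY := isSmoothField_tangentialField hφ hT
  have hg := hD.centroaffine.g_symm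
  have hC := hD.centroaffine.cubic_symm
  have hconst : ∀ a b c p, polarForm D hT a b c p = polarForm D hT a b c p₀ := fun a b c p ↦
    eq_of_mvfderiv_eq_zero
      (fun q ↦ mdiffAt_of_smooth (contMDiff_polarForm hφ hT a b c q))
      (mvfderiv_polarForm hφ hG hT a b c hD) p p₀
  -- The form is defined at one base point. Constancy then allows each property to be checked at
  -- whichever point is convenient.
  obtain ⟨T, h⟩ := exists_triForm (τ := fun a b c ↦ polarForm D hT a b c p₀)
    (fun a a' b c ↦ by
      have e : tangentialField hT (a + a') p₀ = (1 : ℝ) • tangentialField hT a p₀ +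
        tangentialField hT a' p₀ := by rw [one_smul]; exact (hT p₀).tangential_add a a'
      have e' : radialFun hT (a + a') p₀ = radialFun hT a p₀ + radialFun hT a' p₀ :=
        (hT p₀).radial_add a a'
      simp only [polarForm, D.cubic_of_eq e, Data.gFun, e, e', map_add, map_smul,
        LinearMap.add_apply, LinearMap.smul_apply, smul_eq_mul]
      ring)
    (fun r a b c ↦ by
      have e : tangentialField hT (r • a) p₀ = r • tangentialField hT a p₀ :=
        (hT p₀).tangential_smul r a
      have e' : radialFun hT (r • a) p₀ = r * radialFun hT a p₀ := (hT p₀).radial_smul r a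
      simp only [polarForm, D.cubic_of_smul e, Data.gFun, e, e', map_smul,
        LinearMap.smul_apply, smul_eq_mul]
      ring)
    (fun a b c ↦ by
      simp only [polarForm, (hC _ _ _ (hY a) (hY b) (hY c) p₀).1, Data.gFun,
        hg p₀ (tangentialField hT b p₀) (tangentialField hT a p₀)]
      ring)
    (fun a b c ↦ by
      simp only [polarForm, (hC _ _ _ (hY a) (hY b) (hY c) p₀).2, Data.gFun,
        hg p₀ (tangentialField hT c p₀) (tangentialField hT b p₀)]
      ring)
  have hp : ∀ a b c p, T a b c = polarForm D hT a b c p := fun a b c p ↦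
    (h a b c).trans (hconst a b c p).symm
  have r1 : ∀ p, radialFun hT (φ p) p = 1 := fun p ↦ by
    have := (hT p).radial_eq 1 0
    rwa [map_zero, add_zero, one_smul] at this
  have t1 : ∀ p, tangentialField hT (φ p) p = 0 := fun p ↦ by
    have := (hT p).tangential_eq 1 0
    rwa [map_zero, add_zero, one_smul] at this
  have r2 : ∀ p v, radialFun hT (mvfderiv (𝓡 n) φ p v) p = 0 := fun p v ↦ by
    have := (hT p).radial_eq 0 v
    rwa [zero_smul, zero_add] at this
  have t2 : ∀ p v, tangentialField hT (mvfderiv (𝓡 n) φ p v) p = v := fun p v ↦ by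
    have := (hT p).tangential_eq 0 v
    rwa [zero_smul, zero_add] at this
  -- The tangential field of the constant vector `φ p` vanishes at `p`, which is enough by
  -- tensoriality in the first slot.
  have c0 : ∀ p b c, D.cubic (tangentialField hT (φ p)) (tangentialField hT b)
      (tangentialField hT c) p = 0 := fun p b c ↦ by
    rw [D.cubic_of_smul (r := 0) (X' := tangentialField hT b) (by rw [t1, zero_smul]), zero_mul]
  refine ⟨T, fun a b c ↦ ?_, fun a b c ↦ ?_, fun p ↦ ?_, fun p v hv ↦ ?_⟩
  · rw [hp a b c p₀, hp b a c p₀]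
    simp only [polarForm, (hC _ _ _ (hY a) (hY b) (hY c) p₀).1, Data.gFun,
      hg p₀ (tangentialField hT b p₀) (tangentialField hT a p₀)]
    ring
  · rw [hp a b c p₀, hp a c b p₀]
    simp only [polarForm, (hC _ _ _ (hY a) (hY b) (hY c) p₀).2, Data.gFun,
      hg p₀ (tangentialField hT c p₀) (tangentialField hT b p₀)]
    ring
  · rw [hp _ _ _ p]
    simp only [polarForm, c0, Data.gFun, r1, t1, map_zero]
    norm_num
  · rw [hp _ _ _ p]
    simp only [polarForm, c0, Data.gFun, r1, r2, t1, t2, map_zero, LinearMap.zero_apply]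
    have := hD.g_pos p v hv
    linarith

end

end PotentialOfPSR

/-! ### Hypersurface structures from slice charts. -/

section SliceChart

variable {n : ℕ}

/-- A local parametrisation of a subset of `ℝ^(n+1)` together with an ambient smooth extension of
its inverse. -/
structure SliceChart (R : Set (Ambient n)) where
  /-- The parametrisation. -/
  param : EuclideanSpace ℝ (Fin n) → Ambient n
  /-- The extension of the inverse. -/
  coord : Ambient n → EuclideanSpace ℝ (Fin n)
  /-- The open set on which the chart is defined. -/
  dom : Set (Ambient n)
  isOpen_dom : IsOpen dom
  /-- The open set of parameters. -/
  target : Set (EuclideanSpace ℝ (Fin n))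
  isOpen_target : IsOpen target
  -- Imposed for all `y` because the inverse of the chart is a total map into `R`.
  param_mem : ∀ y, param y ∈ R
  param_mem_dom : ∀ y ∈ target, param y ∈ dom
  coord_mem : ∀ x ∈ R, x ∈ dom → coord x ∈ target
  coord_param : ∀ y ∈ target, coord (param y) = y
  param_coord : ∀ x ∈ R, x ∈ dom → param (coord x) = x
  smooth_param : ContDiffOn ℝ ∞ param target
  smooth_coord : ContDiffOn ℝ ∞ coord dom

namespace SliceChart

variable {R : Set (Ambient n)}

/-- The chart of the subset. -/
def toChart (c : SliceChart R) : OpenPartialHomeomorph R (EuclideanSpace ℝ (Fin n)) where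
  toFun x := c.coord x
  invFun y := ⟨c.param y, c.param_mem y⟩
  source := Subtype.val ⁻¹' c.dom
  target := c.target
  map_source' x hx := c.coord_mem x x.2 hx
  map_target' y hy := c.param_mem_dom y hy
  left_inv' x hx := Subtype.ext (c.param_coord x x.2 hx)
  right_inv' y hy := c.coord_param y hy
  open_source := c.isOpen_dom.preimage continuous_subtype_val
  open_target := c.isOpen_target
  continuousOn_toFun := c.smooth_coord.continuousOn.comp continuous_subtype_val.continuousOn
    fun _ hx ↦ hx
  continuousOn_invFun :=
    Topology.IsInducing.subtypeVal.continuousOn_iff.2 c.smooth_param.continuousOn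

lemma contDiffOn_transition (c d : SliceChart R) :
    ContDiffOn ℝ ∞ (fun y ↦ d.coord (c.param y)) (c.target ∩ c.param ⁻¹' d.dom) :=
  d.smooth_coord.comp (c.smooth_param.mono inter_subset_left) inter_subset_right

variable (c : R → SliceChart R) (hc : ∀ x : R, (x : Ambient n) ∈ (c x).dom)

/-- The atlas of a family of slice charts. -/
@[reducible] def chartedSpace : ChartedSpace (EuclideanSpace ℝ (Fin n)) R where
  atlas := range fun x ↦ (c x).toChart
  chartAt x := (c x).toChart
  mem_chart_source := hc
  chart_mem_atlas x := ⟨x, rfl⟩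

lemma isManifold : @IsManifold ℝ _ _ _ _ _ _ (𝓡 n) ∞ R _ (chartedSpace c hc) := by
  let _ := chartedSpace c hc
  refine isManifold_of_contDiffOn (𝓡 n) ∞ R ?_
  rintro _ _ ⟨x, rfl⟩ ⟨y, rfl⟩
  exact (contDiffOn_transition (c x) (c y)).mono fun z hz ↦ hz.1

lemma contMDiff_val : letI := chartedSpace c hc
    ContMDiff (𝓡 n) 𝓘(ℝ, Ambient n) ∞ (Subtype.val : R → Ambient n) := by
  let _ := chartedSpace c hc
  intro x
  rw [contMDiffAt_iff_source]
  have h1 : ContDiffAt ℝ ∞ (c x).param ((c x).coord x) :=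
    (c x).smooth_param.contDiffAt ((c x).isOpen_target.mem_nhds ((c x).coord_mem x x.2 (hc x)))
  exact h1.contMDiffAt.contMDiffWithinAt

/-- The inclusion followed by the ambient map `coord` is the chart, whose differential is
invertible. -/
lemma injective_mvfderiv_val (x : R) : letI := chartedSpace c hc
    Function.Injective (mvfderiv (𝓡 n) (Subtype.val : R → Ambient n) x) := by
  let _ := chartedSpace c hc
  have := isManifold c hc
  refine (injective_iff_map_eq_zero _).2 fun v hv ↦ ?_
  have h1 := mvfderiv_comp_left (Φ := (c x).coord) (F := (Subtype.val : R → Ambient n))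
    (((c x).smooth_coord.contDiffAt ((c x).isOpen_dom.mem_nhds (hc x))).differentiableAt (by simp))
    (mdiffAt_of_smooth (contMDiff_val c hc x)) v
  rw [hv, map_zero] at h1
  have h2 := (isInvertible_mfderiv_extChartAt (I := 𝓡 n) (mem_extChartAt_source (I := 𝓡 n) x))
  exact h2.injective (h1.trans (map_zero _).symm)

/-- The hypersurface defined by a family of slice charts. -/
def hypersurface : Hypersurface n :=
  let _ := chartedSpace c hc
  { carrier := R
    chartedSpace := chartedSpace c hc
    isManifold := isManifold c hc
    immersion := ⟨contMDiff_val c hc, injective_mvfderiv_val c hc⟩ }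

/-- Each chart is the restriction of a smooth ambient map, so smoothness into the ambient space
gives smoothness into the hypersurface. Continuity holds because the topology is the induced one. -/
lemma contMDiff_hypersurface {M : Type*} [TopologicalSpace M]
    [ChartedSpace (EuclideanSpace ℝ (Fin n)) M] {f : M → (hypersurface c hc).carrier}
    (hf : ContMDiff (𝓡 n) 𝓘(ℝ, Ambient n) ∞ fun p ↦ (hypersurface c hc).incl (f p)) :
    ContMDiff (𝓡 n) (𝓡 n) ∞ f := by
  intro p
  rw [contMDiffAt_iff_target]
  refine ⟨(Topology.IsInducing.subtypeVal.continuous_iff.2 hf.continuous).continuousAt, ?_⟩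
  have h1 : ContDiffAt ℝ ∞ (c (f p)).coord ((f p : R) : Ambient n) :=
    (c (f p)).smooth_coord.contDiffAt ((c (f p)).isOpen_dom.mem_nhds (hc (f p)))
  exact ContMDiffAt.comp (I' := 𝓘(ℝ, Ambient n)) (g := (c (f p)).coord)
    (f := fun q ↦ (hypersurface c hc).incl (f q)) p h1.contMDiffAt (hf p)

end SliceChart

/-- A set which has slice charts at all of its points is a smooth hypersurface. -/
lemma exists_hypersurface {R : Set (Ambient n)} (h : ∀ x ∈ R, ∃ c : SliceChart R, x ∈ c.dom) :
    ∃ S : Hypersurface n, S.carrier = R ∧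
      ∀ {M : Type*} [TopologicalSpace M] [ChartedSpace (EuclideanSpace ℝ (Fin n)) M]
        (f : M → S.carrier), ContMDiff (𝓡 n) 𝓘(ℝ, Ambient n) ∞ (fun p ↦ S.incl (f p)) →
        ContMDiff (𝓡 n) (𝓡 n) ∞ f := by
  choose c hc using h
  exact ⟨SliceChart.hypersurface (fun x : R ↦ c x x.2) (fun x ↦ hc x x.2), rfl,
    fun f hf ↦ SliceChart.contMDiff_hypersurface _ _ hf⟩

end SliceChart

/-! ### Embeddedness of the image, by means of its cone. -/

section Cone

variable {n : ℕ} {M : Type*} [TopologicalSpace M] [ChartedSpace (EuclideanSpace ℝ (Fin n)) M]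
  [IsManifold (𝓡 n) ∞ M] [T2Space M]

set_option synthInstance.maxHeartbeats 400000 in
lemma triForm_smul_self (T : TriForm n) (r : ℝ) (x : Ambient n) :
    T (r • x) (r • x) (r • x) = r ^ 3 * T x x x := by
  simp only [map_smul, smul_apply, smul_eq_mul]
  ring

/-- The image of a hypersurface in a level set of a cubic form has slice charts. -/
lemma IsCubicPotential.exists_sliceChart {T : TriForm n} {φ : M → Ambient n}
    (h : IsCubicPotential T φ) (hφ : ContMDiff (𝓡 n) 𝓘(ℝ, Ambient n) ∞ φ) (p₀ : M) :
    ∃ c : SliceChart (range φ), φ p₀ ∈ c.dom := by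
  obtain ⟨Φ⟩ := exists_coordFrame (n := n) p₀
  set e := extChartAt (𝓡 n) p₀ with he
  let F : EuclideanSpace ℝ (Fin n) → Ambient n := fun y ↦ φ (e.symm y)
  let G : ℝ × EuclideanSpace ℝ (Fin n) → Ambient n := fun z ↦ z.1 • F z.2
  let V : Set (EuclideanSpace ℝ (Fin n)) := e.target ∩ e.symm ⁻¹' Φ.dom
  have hV : IsOpen V := (continuousOn_extChartAt_symm p₀).isOpen_inter_preimage
    (isOpen_extChartAt_target p₀) Φ.isOpen_dom
  have hF : ∀ y ∈ V, ContDiffAt ℝ ∞ F y := fun y hy ↦ by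
    have := Φ.contDiffAt_comp_symm hy.2 (hφ _)
    rwa [e.right_inv hy.1] at this
  have hGs : ∀ z : ℝ × EuclideanSpace ℝ (Fin n), z.2 ∈ V → ContDiffAt ℝ ∞ G z := fun z hz ↦
    contDiffAt_fst.smul ((hF z.2 hz).comp z contDiffAt_snd)
  have hGd : ∀ z : ℝ × EuclideanSpace ℝ (Fin n), z.1 ≠ 0 → z.2 ∈ V →
      ∃ L : (ℝ × EuclideanSpace ℝ (Fin n)) ≃L[ℝ] Ambient n,
        HasFDerivAt G (L : ℝ × EuclideanSpace ℝ (Fin n) →L[ℝ] Ambient n) z := by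
    intro z hz1 hz2
    have hq := mdiffAt_of_smooth (hφ (e.symm z.2))
    -- The differential of the cone map at `(t, y)` is the framing after scaling the tangential
    -- factor by `t ≠ 0`.
    let L₀ : (ℝ × EuclideanSpace ℝ (Fin n)) ≃L[ℝ] Ambient n :=
      Φ.framingEquiv hz2.2 hq (h.transversalAt hq)
    let s : (ℝ × EuclideanSpace ℝ (Fin n)) ≃L[ℝ] (ℝ × EuclideanSpace ℝ (Fin n)) :=
      (ContinuousLinearEquiv.refl ℝ ℝ).prodCongr
        (ContinuousLinearEquiv.smulLeft (R₁ := ℝ) (Units.mk0 z.1 hz1))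
    refine ⟨s.trans L₀, ?_⟩
    have h1 := (hasFDerivAt_fst (𝕜 := ℝ) (p := z)).smul
      (((hF z.2 hz2).differentiableAt (by simp)).hasFDerivAt.comp z
        (hasFDerivAt_snd (𝕜 := ℝ) (p := z)))
    refine h1.congr_fderiv (ContinuousLinearMap.ext fun w ↦ ?_)
    have h2 : (s.trans L₀) w = w.1 • F (e (e.symm z.2)) + fderiv ℝ F (e (e.symm z.2)) (z.1 • w.2) :=
      rfl
    refine Eq.trans ?_ h2.symm
    rw [e.right_inv hz2.1, map_smul]
    exact add_comm (z.1 • fderiv ℝ F z.2 w.2) (w.1 • F z.2)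
  have hp₀ : e p₀ ∈ V := ⟨mem_extChartAt_target p₀, by
    rw [mem_preimage, he, extChartAt_to_inv]; exact Φ.mem_dom⟩
  -- This makes the image embedded: `t ^ 3 = 1` has only one real root, so even image points coming
  -- from far away in `M` lie on the slice `t = 1` once they enter the chart.
  have hT : ∀ z : ℝ × EuclideanSpace ℝ (Fin n), G z ∈ range φ → z.1 = 1 := by
    rintro z ⟨q, hq⟩
    have h1 := h.eq_six q
    rw [hq] at h1
    rw [triForm_smul_self, h.eq_six] at h1
    have h2 : z.1 ^ 3 = 1 := by linarith
    exact Odd.pow_injective (by decide : Odd 3) (h2.trans (one_pow 3).symm)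
  obtain ⟨L, hL⟩ := hGd (1, e p₀) one_ne_zero hp₀
  let Ψ₀ := (hGs (1, e p₀) hp₀).toOpenPartialHomeomorph G hL (by simp)
  -- On `W` the differential is invertible at every point, so the local inverse is smooth on the
  -- whole target.
  let W : Set (ℝ × EuclideanSpace ℝ (Fin n)) := {0}ᶜ ×ˢ V
  have hW : IsOpen W := isOpen_compl_singleton.prod hV
  let Ψ := Ψ₀.restrOpen W hW
  have hΨ : ∀ z, Ψ z = G z := fun z ↦ rfl
  have hsub : ∀ z ∈ Ψ.source, z ∈ W := fun z hz ↦ hz.2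
  have h0 : (1, e p₀) ∈ Ψ.source :=
    ⟨(hGs (1, e p₀) hp₀).mem_toOpenPartialHomeomorph_source hL (by simp), one_ne_zero, hp₀⟩
  have hfst : ∀ x ∈ range φ, x ∈ Ψ.target → Ψ.symm x = (1, (Ψ.symm x).2) := fun x hx hxt ↦
    Prod.ext (hT _ (by rw [← hΨ, Ψ.right_inv hxt]; exact hx)) rfl
  have hone : ∀ y, Ψ (1, y) = F y := fun y ↦ one_smul _ _
  refine ⟨⟨F, fun x ↦ (Ψ.symm x).2, Ψ.target, Ψ.open_target, (fun y ↦ (1, y)) ⁻¹' Ψ.source,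
    Ψ.open_source.preimage (by fun_prop), fun y ↦ mem_range_self _, fun y hy ↦ ?_,
    fun x hx hxt ↦ ?_, fun y hy ↦ ?_, fun x hx hxt ↦ ?_, fun y hy ↦ ?_, fun x hx ↦ ?_⟩, ?_⟩
  · rw [← hone]; exact Ψ.map_source hy
  · rw [mem_preimage, ← hfst x hx hxt]; exact Ψ.map_target hxt
  · rw [← hone, Ψ.left_inv hy]
  · rw [← hone, ← hfst x hx hxt, Ψ.right_inv hxt]
  · exact (hF y (hsub _ hy).2).contDiffWithinAt
  · have hs := hsub _ (Ψ.map_target hx)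
    obtain ⟨L', hL'⟩ := hGd _ hs.1 hs.2
    exact (contDiffAt_snd.comp x (Ψ.contDiffAt_symm hx hL' (hGs _ hs.2))).contDiffWithinAt
  · have := Ψ.map_source h0
    rw [hone] at this
    simpa only [F, he, extChartAt_to_inv] using this

end Cone

/-! ### The Hessian of a cubic by polarisation. -/

section Polarization

variable {n : ℕ}

-- Two symmetric forms with the same cubic thus have the same values `T x v v`, so the Hessian of
-- `triPoly T` can be found from its values alone.
set_option synthInstance.maxHeartbeats 400000 in
lemma triForm_polarization {T : TriForm n} (hl : ∀ x y z, T x y z = T y x z)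
    (hr : ∀ x y z, T x y z = T x z y) (x v : Ambient n) :
    T x v v = (T (x + v) (x + v) (x + v) + T (x - v) (x - v) (x - v) - 2 * T x x x) / 6 := by
  simp only [map_add, map_sub, add_apply, sub_apply]
  rw [hl v x v, hr v v x, hl v x v]
  ring

/-- The Hessian of the cubic polynomial of a symmetric trilinear form. -/
lemma hessian_triPoly {T : TriForm n} (hl : ∀ x y z, T x y z = T y x z)
    (hr : ∀ x y z, T x y z = T x z y) (x v : Ambient n) :
    fderiv ℝ (fderiv ℝ (polyFun (triPoly T))) x v v = T x v v := by
  have hh := isHomogeneous_triPoly T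
  have hs : ∀ y, cubicForm (triPoly T) y y y = T y y y := fun y ↦ by
    rw [cubicForm_self hh, polyFun_triPoly]; ring
  rw [hessian_eq_cubicForm hh, triForm_polarization hl hr,
    triForm_polarization (cubicForm_symm_left _) (cubicForm_symm_right hh), hs, hs, hs]

end Polarization

/-! ### Realisations as normalised solutions of the structure equations. -/

section Realization

variable {n : ℕ} {M : Type*} [TopologicalSpace M] [ChartedSpace (EuclideanSpace ℝ (Fin n)) M]
  {N : Type*} [TopologicalSpace N] [ChartedSpace (EuclideanSpace ℝ (Fin n)) N]
  {W : Type*} [NormedAddCommGroup W] [NormedSpace ℝ W]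

lemma mvfderiv_comp_right {F : N → W} {f : M → N} {p : M}
    (hF : MDifferentiableAt (𝓡 n) 𝓘(ℝ, W) F (f p)) (hf : MDifferentiableAt (𝓡 n) (𝓡 n) f p)
    (v : TangentSpace (𝓡 n) p) :
    mvfderiv (𝓡 n) (fun q ↦ F (f q)) p v =
      mvfderiv (𝓡 n) F (f p) (mfderiv (𝓡 n) (𝓡 n) f p v) :=
  congrArg (fun L : TangentSpace (𝓡 n) p →L[ℝ] W ↦ L v) (mfderiv_comp p hF hf)

variable [IsManifold (𝓡 n) ∞ M] [IsManifold (𝓡 n) ∞ N] {D : Data n M} {D' : Data n N}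
  {φ : M → Ambient n} {ι : N → Ambient n} {f : M → N}

/-- The Gauss equation for `ι`, along `f`. -/
lemma Data.GaussAt.comp_right {p : M} (hG : D'.GaussAt ι (f p))
    (hι : ContMDiff (𝓡 n) 𝓘(ℝ, Ambient n) ∞ ι) (hf : MDifferentiableAt (𝓡 n) (𝓡 n) f p)
    {Y : VField n N} (hY : IsSmoothField Y) (v : TangentSpace (𝓡 n) p) :
    mvfderiv (𝓡 n) (fun q ↦ mvfderiv (𝓡 n) ι (f q) (Y (f q))) p v =
      mvfderiv (𝓡 n) ι (f p) (D'.cov Y (f p) (mfderiv (𝓡 n) (𝓡 n) f p v)) +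
        D'.g (f p) (mfderiv (𝓡 n) (𝓡 n) f p v) (Y (f p)) • ι (f p) :=
  (mvfderiv_comp_right (F := fun r ↦ mvfderiv (𝓡 n) ι r (Y r))
    (mdiffAt_mvfderiv_apply (hι (f p)) (hY.mdiffAt _)) hf v).trans (hG Y (hY.mdiffAt _) _)

/-- Both sets of data come from the same ambient derivatives and the same `T`. Uniqueness of the
radial–tangential splitting matches the connections, and the formula for `g` matches the metrics. -/
lemma isPullback_of_isCubicPotential [T2Space M] [T2Space N] {T : TriForm n}
    (h : IsCubicPotential T φ) (h' : IsCubicPotential T ι)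
    (hφ : ContMDiff (𝓡 n) 𝓘(ℝ, Ambient n) ∞ φ) (hι : ContMDiff (𝓡 n) 𝓘(ℝ, Ambient n) ∞ ι)
    (hf : ContMDiff (𝓡 n) (𝓡 n) ∞ f) (hfb : ∀ p, Function.Bijective (mfderiv (𝓡 n) (𝓡 n) f p))
    (hcomp : ∀ p, ι (f p) = φ p) (hG : ∀ p, D.GaussAt φ p) (hG' : ∀ p, D'.GaussAt ι p)
    (hvol : ∀ p v, D.vol p v = inducedVol φ p v) (hvol' : ∀ p v, D'.vol p v = inducedVol ι p v) :
    D.IsPullback f D' := by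
  have hfd : ∀ p, MDifferentiableAt (𝓡 n) (𝓡 n) f p := fun p ↦ (hf p).mdifferentiableAt (by simp)
  have hιd := fun p ↦ mdiffAt_of_smooth (hι p)
  have hT := fun p ↦ h'.transversalAt (hιd p)
  obtain rfl : (fun p ↦ ι (f p)) = φ := funext hcomp
  have hd : ∀ p (v : TangentSpace (𝓡 n) p), mvfderiv (𝓡 n) (fun p ↦ ι (f p)) p v =
      mvfderiv (𝓡 n) ι (f p) (mfderiv (𝓡 n) (𝓡 n) f p v) := fun p v ↦
    mvfderiv_comp_right (hιd _) (hfd p) v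
  refine ⟨hf, hfb, fun X Y hX hY hXY p v ↦ ?_, fun p v w ↦ ?_, fun p v ↦ ?_⟩
  · have h1 := hG p X (hX.mdiffAt p) v
    simp only [hd, hXY] at h1
    rw [(hG' (f p)).comp_right hι (hfd p) hY, add_comm, add_comm (mvfderiv (𝓡 n) ι (f p) _)] at h1
    exact ((hT (f p)).unique h1).2.symm
  · rw [h.g_apply hφ (hG p), h'.g_apply hι (hG' (f p)), hd, hd]
  · rw [hvol, hvol', inducedVol_apply, inducedVol_apply]
    simp only [hd]

/-- The corestriction `f` of `φ` to its image is onto and, by equality of dimensions, a local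
diffeomorphism. The potential therefore descends to the image, and `triPoly T` is the defining
cubic. -/
theorem isRealizedBy_of_isCubicPotential [T2Space M] {T : TriForm n} (h : IsCubicPotential T φ)
    (hφ : ContMDiff (𝓡 n) 𝓘(ℝ, Ambient n) ∞ φ) (hG : ∀ p, D.GaussAt φ p)
    (hvol : ∀ p v, D.vol p v = inducedVol φ p v) : D.IsRealizedBy φ := by
  have hφd := fun p ↦ mdiffAt_of_smooth (hφ p)
  have hinj : ∀ p, Function.Injective (mvfderiv (𝓡 n) φ p) := fun p ↦
    (transversalAt_iff.1 (h.transversalAt (hφd p))).1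
  obtain ⟨S, hS, hsm⟩ := exists_hypersurface (R := range φ)
    (by rintro _ ⟨p, rfl⟩; exact h.exists_sliceChart hφ p)
  let f : M → S.carrier := fun p ↦ ⟨φ p, hS ▸ mem_range_self p⟩
  have hf : ContMDiff (𝓡 n) (𝓡 n) ∞ f := hsm f hφ
  have hfd : ∀ p, MDifferentiableAt (𝓡 n) (𝓡 n) f p := fun p ↦ (hf p).mdifferentiableAt (by simp)
  have hι : ContMDiff (𝓡 n) 𝓘(ℝ, Ambient n) ∞ S.incl := S.immersion.1
  have hd : ∀ p (v : TangentSpace (𝓡 n) p), mvfderiv (𝓡 n) φ p v =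
      mvfderiv (𝓡 n) S.incl (f p) (mfderiv (𝓡 n) (𝓡 n) f p v) := fun p v ↦
    mvfderiv_comp_right (F := S.incl) (mdiffAt_of_smooth (hι _)) (hfd p) v
  have hfi : ∀ p, Function.Injective (mfderiv (𝓡 n) (𝓡 n) f p) := fun p v w hvw ↦
    hinj p (by rw [hd, hd, hvw])
  have hfs : ∀ p, Function.Surjective (mfderiv (𝓡 n) (𝓡 n) f p) := by
    have : ∀ L : EuclideanSpace ℝ (Fin n) →L[ℝ] EuclideanSpace ℝ (Fin n),
        Function.Injective L → Function.Surjective L := fun L ↦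
      (LinearMap.injective_iff_surjective (f := L.toLinearMap)).1
    exact fun p ↦ this _ (hfi p)
  have hsurj : ∀ x, ∃ p, f p = x := by
    rintro ⟨x, hx⟩
    obtain ⟨p, hp⟩ : x ∈ range φ := hS ▸ hx
    exact ⟨p, Subtype.ext hp⟩
  have h' : IsCubicPotential T S.incl :=
    { symm_left := h.symm_left
      symm_right := h.symm_right
      eq_six := fun x ↦ by
        obtain ⟨p, rfl⟩ := hsurj x
        exact h.eq_six p
      neg := fun x v hv ↦ by
        obtain ⟨p, rfl⟩ := hsurj x
        obtain ⟨w, rfl⟩ := hfs p v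
        rw [← hd]
        exact h.neg p w fun hw ↦ hv (by rw [hw, map_zero]) }
  refine ⟨⟨hφ, hinj⟩, S, hS, ⟨triPoly T, isHomogeneous_triPoly T, fun x hx ↦ ?_,
    fun p v hv hv0 ↦ ?_⟩, h'.inducedData hι, h'.isInducedBy_inducedData hι, f, fun _ ↦ rfl, ?_⟩
  · have := h'.eq_six ⟨x, hx⟩
    rw [polyFun_triPoly, show T x x x = 6 from this]
    norm_num
  · obtain ⟨w, rfl⟩ := hv
    rw [hessian_triPoly h.symm_left h.symm_right]
    exact h'.neg p w fun hw ↦ hv0 (by rw [hw, map_zero])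
  · exact isPullback_of_isCubicPotential h h' hφ hι hf (fun p ↦ ⟨hfi p, hfs p⟩) (fun _ ↦ rfl) hG
      (h'.gaussAt_inducedData hι) hvol fun _ _ ↦ rfl

/-- The map to a realisation satisfies the structure equations. -/
lemma Data.IsRealizedBy.structure_equations [T2Space M] (h : D.IsRealizedBy φ) :
    ContMDiff (𝓡 n) 𝓘(ℝ, Ambient n) ∞ φ ∧ (∀ p, D.GaussAt φ p) ∧ (∀ p, TransversalAt φ p) ∧
      ∀ p v, D.vol p v = inducedVol φ p v := by
  obtain ⟨⟨hφ, -⟩, S, -, -, D', hD', f, hcomp, hf⟩ := h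
  obtain rfl : (fun p ↦ S.incl (f p)) = φ := funext hcomp
  obtain ⟨hι, hT'⟩ := isCentroaffineImmersion_iff.1 hD'.immersion
  have hfd : ∀ p, MDifferentiableAt (𝓡 n) (𝓡 n) f p := fun p ↦
    (hf.smooth p).mdifferentiableAt (by simp)
  have hd : ∀ p (v : TangentSpace (𝓡 n) p), mvfderiv (𝓡 n) (fun p ↦ S.incl (f p)) p v =
      mvfderiv (𝓡 n) S.incl (f p) (mfderiv (𝓡 n) (𝓡 n) f p v) := fun p v ↦
    mvfderiv_comp_right (mdiffAt_of_smooth (hι _)) (hfd p) v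
  have hT : ∀ p, TransversalAt (fun p ↦ S.incl (f p)) p := by
    intro p
    obtain ⟨h1, h2⟩ := transversalAt_iff.1 (hT' (f p))
    refine transversalAt_iff.2 ⟨fun v w hvw ↦ (hf.bijective p).1 (h1 ?_), ?_⟩
    · rw [← hd, ← hd, hvw]
    · rintro ⟨v, hv⟩
      exact h2 ⟨_, (hd p v).symm.trans hv⟩
  refine ⟨hφ, fun p ↦ gaussAt_of_span (hφ p) fun w v ↦ ?_, hT, fun p v ↦ ?_⟩
  · obtain ⟨Y, hY, hYw⟩ := exists_smoothField (n := n) (mfderiv (𝓡 n) (𝓡 n) f p w)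
    have hV : ContMDiff (𝓡 n) 𝓘(ℝ, Ambient n) ∞
        (fun q ↦ mvfderiv (𝓡 n) S.incl (f q) (Y (f q))) := fun q ↦
      ContMDiffAt.comp (I' := 𝓡 n) (g := fun x ↦ mvfderiv (𝓡 n) S.incl x (Y x)) (f := f) q
        (smoothAt_mvfderiv_apply (hι _) (hY.contMDiffAt _)) (hf.smooth q)
    -- The condition on connections in `IsPullback` concerns globally related pairs of fields. This
    -- is the pullback of `Y` under `f`, written as a tangential part to make its smoothness
    -- visible.
    let X : VField n M := fun q ↦ (hT q).tangential (mvfderiv (𝓡 n) S.incl (f q) (Y (f q)))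
    have hX : IsSmoothField X := fun q ↦ (smoothAt_decomp hT hφ (hV q)).2
    have hXeq : ∀ q z, mfderiv (𝓡 n) (𝓡 n) f q z = Y (f q) → X q = z := fun q z hz ↦ by
      have h1 := (hT q).tangential_eq 0 z
      rw [zero_smul, zero_add, hd, hz] at h1
      exact h1
    have hXY : ∀ q, mfderiv (𝓡 n) (𝓡 n) f q (X q) = Y (f q) := fun q ↦ by
      obtain ⟨z, hz⟩ := (hf.bijective q).2 (Y (f q))
      rw [hXeq q z hz, hz]
    refine ⟨X, hX.mdiffAt p, hXeq p w hYw.symm, ?_⟩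
    simp only [hd, hXY]
    rw [(hD'.gaussAt (f p)).comp_right hι (hfd p) hY, hf.cov_eq X Y hX hY hXY, hf.g_eq, hXY]
  · rw [hf.vol_eq, hD'.vol_eq, inducedVol_apply]
    simp only [hd]

variable [T2Space M] [ConnectedSpace M]

/-- The right-hand side mentions neither the image nor the cubic, and it is visibly preserved by
unimodular linear maps. -/
lemma isRealizedBy_iff (hD : D.IsIntrinsicPSR) : D.IsRealizedBy φ ↔
    ContMDiff (𝓡 n) 𝓘(ℝ, Ambient n) ∞ φ ∧ (∀ p, D.GaussAt φ p) ∧ (∀ p, TransversalAt φ p) ∧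
      ∀ p v, D.vol p v = inducedVol φ p v := by
  refine ⟨fun h ↦ h.structure_equations, fun ⟨hφ, hG, hT, hvol⟩ ↦ ?_⟩
  obtain ⟨T, h⟩ := exists_isCubicPotential hφ hG hT hD
  exact isRealizedBy_of_isCubicPotential h hφ hG hvol

/-- Realisations are unique up to unimodular transformations. -/
lemma Data.IsRealizedBy.isRealizedBy_iff_linearMap (hD : D.IsIntrinsicPSR) (h : D.IsRealizedBy φ)
    (ψ : M → Ambient n) : D.IsRealizedBy ψ ↔
      ∃ A : Ambient n →ₗ[ℝ] Ambient n, LinearMap.det A = 1 ∧ ∀ p, ψ p = A (φ p) := by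
  obtain ⟨hφ, hG, hT, hvol⟩ := h.structure_equations
  have hφd := fun p ↦ mdiffAt_of_smooth (hφ p)
  constructor
  · intro hψ
    obtain ⟨hψs, hGψ, -, hvolψ⟩ := hψ.structure_equations
    obtain ⟨A, hA⟩ := exists_linearMap_global hφ hψs hG hGψ hT
    have hAp : ∀ p, ψ p = A (φ p) := fun p ↦ by
      have h1 := hA p (1, 0)
      have h2 : ∀ χ : M → Ambient n, framing χ p (1, 0) = χ p := fun χ ↦ by
        change (1 : ℝ) • χ p + mvfderiv (𝓡 n) χ p (0 : TangentSpace (𝓡 n) p) = χ p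
        rw [map_zero, one_smul, add_zero]
      rwa [h2, h2] at h1
    refine ⟨A, ?_, hAp⟩
    obtain ⟨p⟩ := (inferInstance : Nonempty M)
    let A' : Ambient n →L[ℝ] Ambient n := LinearMap.toContinuousLinearMap A
    obtain rfl : ψ = fun q ↦ A' (φ q) := funext hAp
    let b : Module.Basis (Fin n) ℝ (TangentSpace (𝓡 n) p) :=
      (EuclideanSpace.basisFun (Fin n) ℝ).toBasis
    -- Both solutions induce the same nonzero volume, while composition with `A` multiplies it by
    -- `det A`.
    have h1 : inducedVol (fun q ↦ A' (φ q)) p b = LinearMap.det A * inducedVol φ p b :=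
      inducedVol_clm_comp A' (hφd p) b
    rw [← hvolψ, ← hvol] at h1
    have h0 : D.vol p b ≠ 0 := by
      rw [hvol]; exact inducedVol_ne_zero (hT p) b
    exact mul_right_cancel₀ h0 (by rw [one_mul, ← h1])
  · rintro ⟨A, hdet, hA⟩
    let A' : Ambient n →L[ℝ] Ambient n := LinearMap.toContinuousLinearMap A
    obtain rfl : ψ = fun q ↦ A' (φ q) := funext hA
    have hAi : Function.Injective A :=
      (A.equivOfDetNeZero (by rw [hdet]; exact one_ne_zero)).injective
    refine (isRealizedBy_iff hD).2 ⟨A'.contMDiff.comp hφ, fun p ↦ (hG p).clm_comp (hφ p) A',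
      fun p z w hzw ↦ ?_, fun p v ↦ ?_⟩
    · rw [framing_clm_comp A' (hφd p), framing_clm_comp A' (hφd p)] at hzw
      exact hT p (hAi hzw)
    · rw [inducedVol_clm_comp A' (hφd p), hvol]
      have : LinearMap.det A'.toLinearMap = 1 := hdet
      rw [this, one_mul]

end Realization

/-! ### The extrinsic-to-intrinsic direction. -/

section Extrinsic

variable {n : ℕ}

/-- Projective special real manifolds are intrinsic projective special real manifolds. -/
theorem Hypersurface.IsProjectiveSpecialReal.isIntrinsicPSR {S : Hypersurface n}
    (h : S.IsProjectiveSpecialReal) : IsCentroaffineImmersion S.incl ∧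
      (∃ D : Data n S.carrier, D.IsInducedBy S.incl) ∧
      ∀ D : Data n S.carrier, D.IsInducedBy S.incl → D.IsIntrinsicPSR := by
  obtain ⟨h, hh, h1, hneg⟩ := h
  have hp := isCubicPotential_cubicForm hh h1 hneg
  have hι : ContMDiff (𝓡 n) 𝓘(ℝ, Ambient n) ∞ S.incl := S.immersion.1
  have hi := hp.isInducedBy_inducedData hι
  -- The potential argument uses only the Gauss equation and the volume formula, so it applies to
  -- any induced data, not just to the constructed one.
  exact ⟨hi.immersion, ⟨_, hi⟩, fun D hD ↦ hp.isIntrinsicPSR hι hD.gaussAt hD.vol_eq⟩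

end Extrinsic

end Centroaffine

end

open Centroaffine in
theorem theorem2p2 (n : ℕ) :
    (∀ S : Hypersurface n, S.IsProjectiveSpecialReal →
      IsCentroaffineImmersion S.incl ∧
      (∃ D : Data n S.carrier, D.IsInducedBy S.incl) ∧
      ∀ D : Data n S.carrier, D.IsInducedBy S.incl → D.IsIntrinsicPSR) ∧
    (∀ (M : Type*) [TopologicalSpace M] [T2Space M] [SecondCountableTopology M]
      [ChartedSpace (EuclideanSpace ℝ (Fin n)) M] [IsManifold (𝓡 n) ∞ M]
      [ConnectedSpace M] [SimplyConnectedSpace M] (D : Data n M), D.IsIntrinsicPSR →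
      ∃ φ : M → Ambient n, D.IsRealizedBy φ ∧
        ∀ ψ : M → Ambient n, D.IsRealizedBy ψ ↔
          ∃ A : Ambient n →ₗ[ℝ] Ambient n, LinearMap.det A = 1 ∧ ∀ p, ψ p = A (φ p)) := by
  refine ⟨fun S hS ↦ hS.isIntrinsicPSR, ?_⟩
  intro M _ _ _ _ _ _ _ D hD
  obtain ⟨φ, hφ⟩ := exists_normalized_solution hD.centroaffine
  have h := (isRealizedBy_iff hD).2 hφ
  exact ⟨φ, h, h.isRealizedBy_iff_linearMap hD⟩
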